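/- A pseudo-Riemannian metric $g$ on a smooth 4-manifold $M$ is called a Walker metric if $M$ carries a field of tangent 2-planes $D$ and is covered by charts $(x,y,u,v)$ in which $D=\operatorname{span}(\partial_x,\partial_y)$ and $$(g_{ij})=\begin{pmatrix}0&0&1&0\\0&0&0&1\\1&0&f_1&f_2\\0&1&f_2&f_3\end{pmatrix}$$ with smooth functions $f_1,f_2,f_3$ of the coordinates (so $D$ is null and parallel). Let $\operatorname{Ric}$ and $R$ be the Ricci tensor and the scalar curvature of $g$. Theorem. Let $(M^4,g)$ be a nonempty closed (compact, Hausdorff, without boundary) 4-dimensional Walker manifold, let $f$ be a smooth function on $M$, let $Y$ be a smooth vector field on $M$ with $\operatorname{div}Y=0$, and put $X=\nabla f+Y$. Suppose that $(M,g,X)$ is a Ricci–Yamabe soliton with real constants $\beta_1,\lambda,\beta_2$, that is, $$2\beta_1\operatorname{Ric}+\mathcal L_Xg=(\beta_2R-2\lambda)\,g .$$ Then either the soliton is steady, i.e. $\lambda=0$, or $\beta_2\neq2\beta_1$ and the scalar curvature is the constant $R=\dfrac{2\lambda}{\beta_2-2\beta_1}$. (In particular $\lambda=0$ if $\beta_2=2\beta_1$.)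 -/

import Mathlib

open scoped Manifold ContDiff

noncomputable section

namespace WalkerSoliton

/-- The model space of 4-dimensional manifolds; the coordinates `0, 1, 2, 3` are `x, y, u, v`. -/
abbrev E4 : Type := EuclideanSpace ℝ (Fin 4)

/-- The standard basis of the model space. -/
def stdBasis (i : Fin 4) : E4 := EuclideanSpace.single i (1 : ℝ)

/-- The partial derivative `∂φ/∂xⁱ`. -/
def pderiv (i : Fin 4) (φ : E4 → ℝ) (x : E4) : ℝ := fderiv ℝ φ x (stdBasis i)

/-! ### Metrics on an open set of the coordinate space, given by their components -/

/-- The Christoffel symbols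
`Γᵏᵢⱼ = ½ gᵏˡ (∂ⱼ gᵢₗ + ∂ᵢ gⱼₗ - ∂ₗ gᵢⱼ)` of a matrix-valued function `G = (gᵢⱼ)`. -/
def christoffel (G : E4 → Matrix (Fin 4) (Fin 4) ℝ) (k i j : Fin 4) (x : E4) : ℝ :=
  (1 / 2 : ℝ) * ∑ l, (G x)⁻¹ k l *
    (pderiv j (fun z => G z i l) x + pderiv i (fun z => G z j l) x - pderiv l (fun z => G z i j) x)

/-- The components of the Ricci tensor:
`Rᵢⱼ = ∂ₖ Γᵏᵢⱼ - ∂ⱼ Γᵏᵢₖ + Γᵏᵢⱼ Γˡₖₗ - Γˡᵢₖ Γᵏⱼₗ` (summation over `k`, `l`). -/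
def ricci (G : E4 → Matrix (Fin 4) (Fin 4) ℝ) (i j : Fin 4) (x : E4) : ℝ :=
  (∑ k, pderiv k (christoffel G k i j) x) - (∑ k, pderiv j (christoffel G k i k) x)
    + (∑ k, ∑ l, christoffel G k i j x * christoffel G l k l x)
    - (∑ k, ∑ l, christoffel G l i k x * christoffel G k j l x)

/-- The scalar curvature `R = gⁱʲ Rᵢⱼ`. -/
def scalar (G : E4 → Matrix (Fin 4) (Fin 4) ℝ) (x : E4) : ℝ :=
  ∑ i, ∑ j, (G x)⁻¹ i j * ricci G i j x

/-- The components of the Lie derivative of the metric along `X`: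
`(L_X g)ᵢⱼ = Xᵏ ∂ₖ gᵢⱼ + gₖⱼ ∂ᵢ Xᵏ + gᵢₖ ∂ⱼ Xᵏ`. -/
def lieMetric (G : E4 → Matrix (Fin 4) (Fin 4) ℝ) (X : E4 → E4) (i j : Fin 4) (x : E4) : ℝ :=
  ∑ k, (X x k * pderiv k (fun z => G z i j) x
    + G x k j * pderiv i (fun z => X z k) x + G x i k * pderiv j (fun z => X z k) x)

/-- The divergence `div X = |g|^{-1/2} ∂ᵢ (|g|^{1/2} Xⁱ)`. -/
def divergence (G : E4 → Matrix (Fin 4) (Fin 4) ℝ) (X : E4 → E4) (x : E4) : ℝ :=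
  (Real.sqrt |(G x).det|)⁻¹ * ∑ i, pderiv i (fun z => Real.sqrt |(G z).det| * X z i) x

/-- The matrix of a Walker metric in canonical coordinates `(x, y, u, v)`. -/
def walkerMatrix (a b c : ℝ) : Matrix (Fin 4) (Fin 4) ℝ :=
  !![0, 0, 1, 0;
     0, 0, 0, 1;
     1, 0, a, b;
     0, 1, b, c]

/-! ### Pseudo-Riemannian metrics on a manifold -/

/-- A smooth pseudo-Riemannian metric on a 4-dimensional manifold: a smooth field of symmetric
nondegenerate bilinear forms on the tangent spaces. -/
structure PseudoMetric (M : Type*) [TopologicalSpace M] [ChartedSpace E4 M]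
    [IsManifold (𝓡 4) ∞ M] where
  /-- The bilinear form on each tangent space. -/
  val (p : M) : TangentSpace (𝓡 4) p →L[ℝ] TangentSpace (𝓡 4) p →L[ℝ] ℝ
  symm (p : M) (v w : TangentSpace (𝓡 4) p) : val p v w = val p w v
  nondegenerate (p : M) (v : TangentSpace (𝓡 4) p) : (∀ w, val p v w = 0) → v = 0
  contMDiff : ContMDiff (𝓡 4) ((𝓡 4).prod 𝓘(ℝ, E4 →L[ℝ] E4 →L[ℝ] ℝ)) ∞
    (fun p => Bundle.TotalSpace.mk' (E4 →L[ℝ] E4 →L[ℝ] ℝ)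
      (E := fun q : M => TangentSpace (𝓡 4) q →L[ℝ] TangentSpace (𝓡 4) q →L[ℝ] ℝ) p (val p))

section Manifold

variable {M : Type*} [TopologicalSpace M] [ChartedSpace E4 M]

/-- The coordinate vector field `∂/∂xⁱ` of a chart `e`, at the point with coordinates `x`. -/
def coordField (e : OpenPartialHomeomorph M E4) (i : Fin 4) (x : E4) :
    TangentSpace (𝓡 4) (e.symm x) :=
  mfderiv (𝓡 4) (𝓡 4) e.symm x (stdBasis i)

/-- The components `(X¹, …, X⁴)` of a vector field in the chart `e`, as functions of the
coordinates. -/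
def components (X : ∀ p : M, TangentSpace (𝓡 4) p) (e : OpenPartialHomeomorph M E4) (x : E4) :
    E4 :=
  mfderiv (𝓡 4) (𝓡 4) e (e.symm x) (X (e.symm x))

/-- A vector field on `M` is smooth. -/
def IsSmoothField [IsManifold (𝓡 4) ∞ M] (X : ∀ p : M, TangentSpace (𝓡 4) p) : Prop :=
  ContMDiff (𝓡 4) (𝓡 4).tangent ∞ (fun p => (⟨p, X p⟩ : TangentBundle (𝓡 4) M))

variable [IsManifold (𝓡 4) ∞ M]

/-- The components `gᵢⱼ = g(∂/∂xⁱ, ∂/∂xʲ)` of the metric in the chart `e`, as functions of the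
coordinates. -/
def gram (g : PseudoMetric M) (e : OpenPartialHomeomorph M E4) (x : E4) :
    Matrix (Fin 4) (Fin 4) ℝ :=
  Matrix.of fun i j => g.val (e.symm x) (coordField e i x) (coordField e j x)

/-- The scalar curvature `R` as a function on `M`. Its value does not depend on the chart that is
used to compute it. -/
def scalarCurvature (g : PseudoMetric M) (p : M) : ℝ :=
  scalar (gram g (chartAt E4 p)) (chartAt E4 p p)

/-- The metric at a point as a bilinear form. -/
def PseudoMetric.form (g : PseudoMetric M) (p : M) :
    LinearMap.BilinForm ℝ (TangentSpace (𝓡 4) p) :=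
  LinearMap.mk₂ ℝ (fun v w => g.val p v w) (by simp) (by simp) (by simp) (by simp)

theorem PseudoMetric.form_nondegenerate (g : PseudoMetric M) (p : M) :
    (g.form p).Nondegenerate := by
  refine ⟨fun v hv => g.nondegenerate p v hv, fun v hv => g.nondegenerate p v fun w => ?_⟩
  rw [g.symm]
  exact hv w

instance (p : M) : FiniteDimensional ℝ (TangentSpace (𝓡 4) p) :=
  inferInstanceAs (FiniteDimensional ℝ E4)

/-- The gradient `∇f` of a function `f` on `M`: the vector field with `g(∇f, w) = df(w)`. -/
def gradient (g : PseudoMetric M) (f : M → ℝ) (p : M) : TangentSpace (𝓡 4) p :=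
  ((g.form p).toDual (g.form_nondegenerate p)).symm
    ((mfderiv (𝓡 4) 𝓘(ℝ, ℝ) f p).toLinearMap :
      TangentSpace (𝓡 4) p →ₗ[ℝ] ℝ)

theorem val_gradient (g : PseudoMetric M) (f : M → ℝ) (p : M) (w : TangentSpace (𝓡 4) p) :
    g.val p (gradient g f p) w = (mfderiv (𝓡 4) 𝓘(ℝ, ℝ) f p w : ℝ) :=
  LinearMap.BilinForm.apply_toDual_symm_apply (B := g.form p) (hB := g.form_nondegenerate p) _ w

/-- `div Y = 0`, in all local coordinates. -/
def IsDivergenceFree (g : PseudoMetric M) (Y : ∀ p : M, TangentSpace (𝓡 4) p) : Prop :=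
  ∀ e ∈ IsManifold.maximalAtlas (𝓡 4) ∞ M, ∀ x ∈ e.target,
    divergence (gram g e) (components Y e) x = 0

/-- `g` is a Walker metric: `M` carries a field of planes `D` and is covered by charts
`(x, y, u, v)` in which the metric has the canonical form, for smooth functions `f₁, f₂, f₃` of the
coordinates, and in which `D` is spanned by `∂/∂x` and `∂/∂y`. (These coordinate expressions make
`D` smooth, totally null, and parallel for the Levi-Civita connection.) -/
def IsWalker (g : PseudoMetric M) : Prop :=
  ∃ D : ∀ p : M, Submodule ℝ (TangentSpace (𝓡 4) p),
    ∀ p : M, ∃ e ∈ IsManifold.maximalAtlas (𝓡 4) ∞ M, p ∈ e.source ∧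
      (∃ f₁ f₂ f₃ : E4 → ℝ, ContDiffOn ℝ ∞ f₁ e.target ∧ ContDiffOn ℝ ∞ f₂ e.target ∧
        ContDiffOn ℝ ∞ f₃ e.target ∧
        ∀ x ∈ e.target, gram g e x = walkerMatrix (f₁ x) (f₂ x) (f₃ x)) ∧
      ∀ x ∈ e.target, D (e.symm x) = Submodule.span ℝ {coordField e 0 x, coordField e 1 x}

/-- `(M, g, X, β₁, λ, β₂)` is a Ricci-Yamabe soliton: the tensor equation
`2 β₁ Ric + L_X g = (β₂ R - 2 λ) g` holds, in all local coordinates. -/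
def IsRicciYamabeSoliton (g : PseudoMetric M) (X : ∀ p : M, TangentSpace (𝓡 4) p)
    (β₁ lam β₂ : ℝ) : Prop :=
  ∀ e ∈ IsManifold.maximalAtlas (𝓡 4) ∞ M, ∀ x ∈ e.target, ∀ i j : Fin 4,
    2 * β₁ * ricci (gram g e) i j x + lieMetric (gram g e) (components X e) i j x
      = (β₂ * scalar (gram g e) x - 2 * lam) * gram g e x i j

end Manifold

end WalkerSoliton

end

/-! Write `a, b, c` for `f₁, f₂, f₃`, `φ = β₂ R - 2 λ` for the conformal factor, and `w₁ = a_x +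
b_y`, `w₂ = b_x + c_y` for the connection form of the null distribution. For a Walker metric `R = ∂ₓ
w₁ + ∂_y w₂`; the second invariant of the leafwise derivative of `w` is its determinant `δ`.

Local part. The leafwise components of the soliton equation contain neither Ricci nor `g`; they
leave only one leafwise derivative of the transverse components of `X`, the twist `s = ∂_y X²`.
Cross-differentiating the mixed components expresses `∂ₓ φ` and `∂_y φ` through `s`, and equality of
mixed derivatives gives `s R = 0`. Hence `φ` is constant along the leaves (basic) and `s`
annihilates the leafwise derivative of `w` (`IsSolD.basic`). The transverse components then give
`X(R) = -φ R + β₁ (R² - 2 δ) + β₁ ΔR` (`IsSolD.dirD_scalD`, `WalkerChart.dirD_scalS`); the trace of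
the mixed ones gives `div X = 2 φ - β₁ R`.

Global part. Changes of Walker coordinates have Jacobian `±1`, so Lebesgue measure in the charts
defines an integral with a divergence theorem. Under such changes `w` behaves as a connection form,
so `R` and `δ` are functions on `M`. A global density corrects `w` to a global 1-form without
changing `dw`; as `dw ∧ dw` is a multiple of `δ`, Stokes gives `∫ δ = 0` (`int_det_eq_zero`). For
basic `h`, the field dual to `dw ∧ dh`, multiplied by the trace of `X` on the normal bundle, has
divergence `-δ X(h)`; thus `∫ δ X(h) = 0` (`int_det_mul_dirF`).

Conclusion. For `β₂ = 0`, integrating `div X`, `div (R X)` and `ΔR` gives `λ = 0`. For `β₁ = 0 ≠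
β₂`, integration gives `∫ φ² = 0`, so `φ = 0`, which is the second alternative. If neither constant
vanishes, then `R` and `δ` are basic; testing with `X(δ) + δ div X` gives `X(δ) = -δ div X`, testing
with `R (R⁴ + (R² - 4 δ)² + ε)^(-1/4)` as `ε → 0` gives `δ (R² - 4 δ) = 0`, whence `δ ≥ 0` and, by
`∫ δ = 0`, `δ = 0`. Integrals of powers of `R` then force `λ = 0`.

All local computations take place in the ring of smooth functions on an open set, with its four
commuting derivations, and are polynomial identities there. -/

noncomputable section

namespace WalkerSoliton

open TopologicalSpace

/-! ### The differential ring of smooth functions on an open set -/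

/-- The ring of smooth real functions on an open subset of the coordinate space. -/
def SmoothFun (U : Opens E4) : Subalgebra ℝ (U → ℝ) where
  carrier := {φ | ∃ ψ : E4 → ℝ, ContDiffOn ℝ ∞ ψ U ∧ ∀ x : U, ψ x = φ x}
  mul_mem' := by
    rintro _ _ ⟨a, ha, ha'⟩ ⟨b, hb, hb'⟩
    exact ⟨fun x => a x * b x, ha.mul hb, fun x => by simp [ha', hb']⟩
  add_mem' := by
    rintro _ _ ⟨a, ha, ha'⟩ ⟨b, hb, hb'⟩
    exact ⟨fun x => a x + b x, ha.add hb, fun x => by simp [ha', hb']⟩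
  algebraMap_mem' r := ⟨fun _ => r, contDiffOn_const, fun _ => rfl⟩

/-- The element of `SmoothFun U` given by a function that is smooth on `U`. -/
def mkS {U : Opens E4} (φ : E4 → ℝ) (h : ContDiffOn ℝ ∞ φ U) : SmoothFun U :=
  ⟨fun x => φ x, φ, h, fun _ => rfl⟩

/-- An extension of a smooth function on `U` to the whole space. -/
def extS {U : Opens E4} (φ : SmoothFun U) : E4 → ℝ := φ.2.choose

theorem extS_contDiffOn {U : Opens E4} (φ : SmoothFun U) : ContDiffOn ℝ ∞ (extS φ) U :=
  φ.2.choose_spec.1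

@[simp] theorem extS_apply {U : Opens E4} (φ : SmoothFun U) (x : U) : extS φ x = φ.1 x :=
  φ.2.choose_spec.2 x

@[simp] theorem mkS_apply {U : Opens E4} (φ : E4 → ℝ) (h : ContDiffOn ℝ ∞ φ U) (x : U) :
    (mkS φ h).1 x = φ x := rfl

theorem SmoothFun.ext_apply {U : Opens E4} {a b : SmoothFun U} (h : ∀ x, a.1 x = b.1 x) : a = b :=
  Subtype.ext (funext h)

theorem pderiv_congr_on {U : Opens E4} {φ ψ : E4 → ℝ} (h : ∀ x ∈ U, φ x = ψ x) (i : Fin 4)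
    {x : E4} (hx : x ∈ U) : pderiv i φ x = pderiv i ψ x := by
  have : φ =ᶠ[nhds x] ψ := by
    filter_upwards [U.isOpen.mem_nhds hx] with y hy using h y hy
  simp [pderiv, this.fderiv_eq]

theorem _root_.ContDiffOn.differentiableAt_open {U : Opens E4} {F : Type*} [NormedAddCommGroup F]
    [NormedSpace ℝ F] {φ : E4 → F}
    (h : ContDiffOn ℝ ∞ φ U) {x : E4} (hx : x ∈ U) : DifferentiableAt ℝ φ x :=
  ((h.contDiffAt (U.isOpen.mem_nhds hx)).differentiableAt (by simp))

theorem _root_.ContDiffOn.pderiv_open {U : Opens E4} {φ : E4 → ℝ} (h : ContDiffOn ℝ ∞ φ U) (i : Fin 4) :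
    ContDiffOn ℝ ∞ (pderiv i φ) U :=
  (h.fderiv_of_isOpen U.isOpen (m := ∞) (by simp)).clm_apply contDiffOn_const

theorem pderiv_comm_on {U : Opens E4} {φ : E4 → ℝ} (h : ContDiffOn ℝ ∞ φ U) (i j : Fin 4)
    {x : E4} (hx : x ∈ U) : pderiv i (pderiv j φ) x = pderiv j (pderiv i φ) x := by
  have hc : ContDiffAt ℝ ∞ φ x := h.contDiffAt (U.isOpen.mem_nhds hx)
  have hs : IsSymmSndFDerivAt ℝ φ x := hc.isSymmSndFDerivAt (by
    simpa using (WithTop.coe_le_coe.2 le_top : ((2 : ℕ∞) : WithTop ℕ∞) ≤ ∞))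
  have hd : DifferentiableAt ℝ (fderiv ℝ φ) x :=
    (h.fderiv_of_isOpen U.isOpen (m := ∞) (by simp)).differentiableAt_open hx
  have key : ∀ k l : Fin 4, pderiv k (pderiv l φ) x
      = fderiv ℝ (fderiv ℝ φ) x (stdBasis k) (stdBasis l) := by
    intro k l
    have : HasFDerivAt (fun y => fderiv ℝ φ y (stdBasis l))
        ((ContinuousLinearMap.apply ℝ ℝ (stdBasis l)).comp (fderiv ℝ (fderiv ℝ φ) x)) x :=
      (ContinuousLinearMap.apply ℝ ℝ (stdBasis l)).hasFDerivAt.comp x hd.hasFDerivAt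
    unfold pderiv
    rw [this.fderiv]; rfl
  rw [key, key]; exact hs _ _

/-- The partial derivatives as derivations of the ring of smooth functions. -/
def dS {U : Opens E4} (i : Fin 4) : Derivation ℝ (SmoothFun U) (SmoothFun U) :=
  Derivation.mk'
    { toFun := fun φ => mkS (pderiv i (extS φ)) ((extS_contDiffOn φ).pderiv_open i)
      map_add' := fun a b => by
        refine SmoothFun.ext_apply fun x => ?_
        have h : pderiv i (extS (a + b)) x = pderiv i (fun y => extS a y + extS b y) x :=
          pderiv_congr_on (fun y hy => by
            rw [extS_apply _ ⟨y, hy⟩, extS_apply a ⟨y, hy⟩, extS_apply b ⟨y, hy⟩]; rfl) i x.2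
        rw [mkS_apply, h]
        unfold pderiv
        rw [fderiv_fun_add ((extS_contDiffOn a).differentiableAt_open x.2)
          ((extS_contDiffOn b).differentiableAt_open x.2)]
        rfl
      map_smul' := fun r a => by
        refine SmoothFun.ext_apply fun x => ?_
        have h : pderiv i (extS (r • a)) x = pderiv i (fun y => r • extS a y) x :=
          pderiv_congr_on (fun y hy => by
            rw [extS_apply _ ⟨y, hy⟩, extS_apply a ⟨y, hy⟩]; rfl) i x.2
        rw [mkS_apply, h]
        unfold pderiv
        rw [fderiv_fun_const_smul ((extS_contDiffOn a).differentiableAt_open x.2)]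
        rfl }
    fun a b => by
      refine SmoothFun.ext_apply fun x => ?_
      have h : pderiv i (extS (a * b)) x = pderiv i (fun y => extS a y * extS b y) x :=
        pderiv_congr_on (fun y hy => by
          rw [extS_apply _ ⟨y, hy⟩, extS_apply a ⟨y, hy⟩, extS_apply b ⟨y, hy⟩]; rfl) i x.2
      change pderiv i (extS (a * b)) x = _
      rw [h]
      unfold pderiv
      rw [fderiv_fun_mul ((extS_contDiffOn a).differentiableAt_open x.2)
          ((extS_contDiffOn b).differentiableAt_open x.2)]
      change extS a x * pderiv i (extS b) x + extS b x * pderiv i (extS a) x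
        = a.1 x * pderiv i (extS b) x + b.1 x * pderiv i (extS a) x
      simp

/-- The derivation is built from a chosen extension. Since `U` is open, the derivative only sees
values on `U`, so any representative may be differentiated instead. -/
theorem dS_mkS {U : Opens E4} (i : Fin 4) (φ : E4 → ℝ) (h : ContDiffOn ℝ ∞ φ U) :
    dS i (mkS φ h) = mkS (pderiv i φ) (h.pderiv_open i) :=
  SmoothFun.ext_apply fun x =>
    pderiv_congr_on (fun y hy => extS_apply (mkS φ h) ⟨y, hy⟩) i x.2

theorem mkS_congr {U : Opens E4} {φ ψ : E4 → ℝ} {h : ContDiffOn ℝ ∞ φ U}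
    {h' : ContDiffOn ℝ ∞ ψ U} : mkS φ h = mkS ψ h' ↔ ∀ x ∈ U, φ x = ψ x :=
  ⟨fun H x hx => congrFun (congrArg Subtype.val H) ⟨x, hx⟩,
    fun H => SmoothFun.ext_apply fun x => H x x.2⟩

theorem mkS_extS {U : Opens E4} (a : SmoothFun U) : mkS (extS a) (extS_contDiffOn a) = a :=
  SmoothFun.ext_apply fun x => extS_apply a x

/-- Evaluation at a point. -/
def evS {U : Opens E4} (x : U) : SmoothFun U →ₐ[ℝ] ℝ :=
  (Pi.evalAlgHom ℝ (fun _ : U => ℝ) x).comp (SmoothFun U).val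

theorem evS_apply {U : Opens E4} (x : U) (a : SmoothFun U) : evS x a = a.1 x := rfl

@[simp] theorem evS_mkS {U : Opens E4} (x : U) (φ : E4 → ℝ) (h : ContDiffOn ℝ ∞ φ U) :
    evS x (mkS φ h) = φ x := rfl

theorem evS_dS {U : Opens E4} (x : U) (i : Fin 4) (a : SmoothFun U) :
    evS x (dS i a) = pderiv i (extS a) x := rfl

theorem SmoothFun.ext_ev {U : Opens E4} {a b : SmoothFun U} (h : ∀ x, evS x a = evS x b) :
    a = b := SmoothFun.ext_apply h

theorem dS_comm {U : Opens E4} (i j : Fin 4) (a : SmoothFun U) :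
    dS i (dS j a) = dS j (dS i a) := by
  rw [← mkS_extS a, dS_mkS, dS_mkS, dS_mkS, dS_mkS, mkS_congr]
  exact fun x hx => pderiv_comm_on (extS_contDiffOn a) i j hx

/-- Reducedness replaces pointwise case distinctions: a function is shown to vanish by showing that
one of its powers does. -/
instance {U : Opens E4} : IsReduced (SmoothFun U) where
  eq_zero a := by
    rintro ⟨n, hn⟩
    refine SmoothFun.ext_ev fun x => ?_
    have := congrArg (evS x) hn
    rw [map_pow, map_zero] at this
    rw [map_zero]
    exact pow_eq_zero_iff (n := n) (by rintro rfl; simp at this) |>.1 this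

/-- The pullback of smooth functions along a smooth map. -/
def pullS {U V : Opens E4} (τ : E4 → E4) (hτ : ContDiffOn ℝ ∞ τ U) (hm : ∀ x ∈ U, τ x ∈ V) :
    SmoothFun V →+* SmoothFun U where
  toFun a := mkS (fun x => extS a (τ x)) ((extS_contDiffOn a).comp hτ hm)
  map_one' := SmoothFun.ext_apply fun x => by
    rw [mkS_apply, extS_apply _ ⟨τ x, hm x x.2⟩]; rfl
  map_zero' := SmoothFun.ext_apply fun x => by
    rw [mkS_apply, extS_apply _ ⟨τ x, hm x x.2⟩]; rfl
  map_mul' a b := SmoothFun.ext_apply fun x => by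
    rw [mkS_apply, extS_apply _ ⟨τ x, hm x x.2⟩]
    change _ = extS a (τ x) * extS b (τ x)
    rw [extS_apply a ⟨τ x, hm x x.2⟩, extS_apply b ⟨τ x, hm x x.2⟩]; rfl
  map_add' a b := SmoothFun.ext_apply fun x => by
    rw [mkS_apply, extS_apply _ ⟨τ x, hm x x.2⟩]
    change _ = extS a (τ x) + extS b (τ x)
    rw [extS_apply a ⟨τ x, hm x x.2⟩, extS_apply b ⟨τ x, hm x x.2⟩]; rfl

theorem evS_pullS {U V : Opens E4} (τ : E4 → E4) (hτ : ContDiffOn ℝ ∞ τ U)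
    (hm : ∀ x ∈ U, τ x ∈ V) (a : SmoothFun V) (x : U) :
    evS x (pullS τ hτ hm a) = evS ⟨τ x, hm x x.2⟩ a :=
  extS_apply a ⟨τ x, hm x x.2⟩
theorem sum_stdBasis (v : E4) : v = ∑ l, v l • stdBasis l := by
  ext k
  simp [stdBasis, Finset.sum_apply, Pi.single_apply]

theorem pderiv_comp {φ : E4 → ℝ} {τ : E4 → E4} {x : E4} (hφ : DifferentiableAt ℝ φ (τ x))
    (hτ : DifferentiableAt ℝ τ x) (k : Fin 4) :
    pderiv k (fun y => φ (τ y)) x = ∑ l, pderiv l φ (τ x) * pderiv k (fun y => τ y l) x := by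
  have h1 : HasFDerivAt (fun y => φ (τ y)) ((fderiv ℝ φ (τ x)).comp (fderiv ℝ τ x)) x :=
    hφ.hasFDerivAt.comp x hτ.hasFDerivAt
  have h2 : ∀ l, pderiv k (fun y => τ y l) x = fderiv ℝ τ x (stdBasis k) l := by
    intro l
    have : HasFDerivAt (fun y => τ y l)
        ((EuclideanSpace.proj (𝕜 := ℝ) l).comp (fderiv ℝ τ x)) x :=
      (EuclideanSpace.proj (𝕜 := ℝ) l).hasFDerivAt.comp x hτ.hasFDerivAt
    unfold pderiv; rw [this.fderiv]; rfl
  simp only [h2]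
  unfold pderiv
  rw [h1.fderiv, ContinuousLinearMap.comp_apply]
  conv_lhs => rw [sum_stdBasis (fderiv ℝ τ x (stdBasis k)), map_sum]
  simp [mul_comm]

theorem contDiffOn_coord {U : Set E4} {τ : E4 → E4} (hτ : ContDiffOn ℝ ∞ τ U) (l : Fin 4) :
    ContDiffOn ℝ ∞ (fun y => τ y l) U :=
  (EuclideanSpace.proj (𝕜 := ℝ) l).contDiff.comp_contDiffOn hτ

theorem dS_pullS {U V : Opens E4} (τ : E4 → E4) (hτ : ContDiffOn ℝ ∞ τ U)
    (hm : ∀ x ∈ U, τ x ∈ V) (k : Fin 4) (a : SmoothFun V) :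
    dS k (pullS τ hτ hm a)
      = ∑ l, pullS τ hτ hm (dS l a) * dS k (mkS (fun y => τ y l) (contDiffOn_coord hτ l)) := by
  refine SmoothFun.ext_ev fun x => ?_
  rw [map_sum]
  simp only [map_mul, dS_mkS, evS_pullS, evS_dS, evS_mkS]
  rw [← pderiv_comp ((extS_contDiffOn a).differentiableAt_open (hm x x.2))
    (hτ.differentiableAt_open x.2) k]
  exact pderiv_congr_on (fun y hy => extS_apply (pullS τ hτ hm a) ⟨y, hy⟩) k x.2

/-! ### Curvature in a commutative ring with derivations -/

section Algebra

variable {A : Type*} [CommRing A] [Algebra ℝ A] (d : Fin 4 → Derivation ℝ A A)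

/-- Christoffel symbols over a ring with derivations. -/
def chrD (g gi : Fin 4 → Fin 4 → A) (k i j : Fin 4) : A :=
  (1 / 2 : ℝ) • ∑ l, gi k l * (d j (g i l) + d i (g j l) - d l (g i j))

/-- Ricci tensor over a ring with derivations. -/
def ricD (g gi : Fin 4 → Fin 4 → A) (i j : Fin 4) : A :=
  (∑ k, d k (chrD d g gi k i j)) - (∑ k, d j (chrD d g gi k i k))
    + (∑ k, ∑ l, chrD d g gi k i j * chrD d g gi l k l)
    - (∑ k, ∑ l, chrD d g gi l i k * chrD d g gi k j l)

/-- Lie derivative of a metric over a ring with derivations. -/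
def lieD (g : Fin 4 → Fin 4 → A) (X : Fin 4 → A) (i j : Fin 4) : A :=
  ∑ k, (X k * d k (g i j) + g k j * d i (X k) + g i k * d j (X k))

/-- The matrix of a Walker metric over a ring. -/
def walkerD (a b c : A) : Fin 4 → Fin 4 → A :=
  ![![0, 0, 1, 0], ![0, 0, 0, 1], ![1, 0, a, b], ![0, 1, b, c]]

/-- The inverse of the matrix of a Walker metric over a ring. -/
def walkerInvD (a b c : A) : Fin 4 → Fin 4 → A :=
  ![![-a, -b, 1, 0], ![-b, -c, 0, 1], ![1, 0, 0, 0], ![0, 1, 0, 0]]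

/-- The Walker matrix has determinant 1 and a polynomial inverse, so the symbols stay in the ring
and no division beyond `1/2` occurs. -/
theorem chrD_walker (a b c : A) :
    chrD d (walkerD a b c) (walkerInvD a b c) = fun k i j =>
      (1 / 2 : ℝ) • (![
        ![![0, 0, d 0 a, d 0 b], ![0, 0, d 1 a, d 1 b],
          ![d 0 a, d 1 a, d 2 a + a * d 0 a + b * d 1 a, d 3 a + a * d 0 b + b * d 1 b],
          ![d 0 b, d 1 b, d 3 a + a * d 0 b + b * d 1 b,
            2 * d 3 b - d 2 c + a * d 0 c + b * d 1 c]],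
        ![![0, 0, d 0 b, d 0 c], ![0, 0, d 1 b, d 1 c],
          ![d 0 b, d 1 b, 2 * d 2 b - d 3 a + b * d 0 a + c * d 1 a,
            d 2 c + b * d 0 b + c * d 1 b],
          ![d 0 c, d 1 c, d 2 c + b * d 0 b + c * d 1 b,
            d 3 c + b * d 0 c + c * d 1 c]],
        ![![0, 0, 0, 0], ![0, 0, 0, 0], ![0, 0, -d 0 a, -d 0 b], ![0, 0, -d 0 b, -d 0 c]],
        ![![0, 0, 0, 0], ![0, 0, 0, 0], ![0, 0, -d 1 a, -d 1 b], ![0, 0, -d 1 b, -d 1 c]]]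
          : Fin 4 → Fin 4 → Fin 4 → A) k i j := by
  funext k i j
  unfold chrD
  congr 1
  fin_cases k <;> fin_cases i <;> fin_cases j <;>
    simp [walkerD, walkerInvD, Fin.sum_univ_four] <;> ring

theorem ricD_walker_leaf (a b c : A) :
    ricD d (walkerD a b c) (walkerInvD a b c) 0 0 = 0 ∧
    ricD d (walkerD a b c) (walkerInvD a b c) 0 1 = 0 ∧
    ricD d (walkerD a b c) (walkerInvD a b c) 1 0 = 0 ∧
    ricD d (walkerD a b c) (walkerInvD a b c) 1 1 = 0 := by
  refine ⟨?_, ?_, ?_, ?_⟩ <;> simp only [ricD, chrD_walker] <;>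
    simp [Fin.sum_univ_four]

theorem ricD_walker_mixed (hd : ∀ i j a, d i (d j a) = d j (d i a)) (a b c : A) :
    ricD d (walkerD a b c) (walkerInvD a b c) 0 2 = (1 / 2 : ℝ) • d 0 (d 0 a + d 1 b) ∧
    ricD d (walkerD a b c) (walkerInvD a b c) 0 3 = (1 / 2 : ℝ) • d 0 (d 0 b + d 1 c) ∧
    ricD d (walkerD a b c) (walkerInvD a b c) 1 2 = (1 / 2 : ℝ) • d 1 (d 0 a + d 1 b) ∧
    ricD d (walkerD a b c) (walkerInvD a b c) 1 3 = (1 / 2 : ℝ) • d 1 (d 0 b + d 1 c) := by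
  refine ⟨?_, ?_, ?_, ?_⟩ <;> simp only [ricD, chrD_walker] <;>
    simp [Fin.sum_univ_four, hd 1 0]

/-- Symmetry of the Ricci tensor is not visible in its coordinate formula; the transposed components
are needed for the trace that gives `R`. -/
theorem ricD_walker_mixed' (hd : ∀ i j a, d i (d j a) = d j (d i a)) (a b c : A) :
    ricD d (walkerD a b c) (walkerInvD a b c) 2 0 = (1 / 2 : ℝ) • d 0 (d 0 a + d 1 b) ∧
    ricD d (walkerD a b c) (walkerInvD a b c) 3 0 = (1 / 2 : ℝ) • d 0 (d 0 b + d 1 c) ∧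
    ricD d (walkerD a b c) (walkerInvD a b c) 2 1 = (1 / 2 : ℝ) • d 1 (d 0 a + d 1 b) ∧
    ricD d (walkerD a b c) (walkerInvD a b c) 3 1 = (1 / 2 : ℝ) • d 1 (d 0 b + d 1 c) := by
  refine ⟨?_, ?_, ?_, ?_⟩ <;> simp only [ricD, chrD_walker] <;>
    simp [Fin.sum_univ_four, hd 1 0]

/-- The algebra in which `2` is invertible lets one clear the factor `1/2`. -/
theorem two_smul_half (a : A) : (2 : A) * ((1 / 2 : ℝ) • a) = a := by
  rw [mul_smul_comm, two_mul, ← two_smul ℝ, smul_smul]; norm_num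

theorem two_mul_cancel {a b : A} (h : (2 : A) * a = 2 * b) : a = b := by
  rw [← two_smul_half a, ← two_smul_half b, mul_smul_comm, mul_smul_comm, h]

theorem ricD_walker_transverse (hd : ∀ i j a, d i (d j a) = d j (d i a)) (a b c : A) :
    2 * ricD d (walkerD a b c) (walkerInvD a b c) 2 2
      = 2 * d 2 (d 0 a + d 1 b) - 2 * (d 2 (d 0 a) + d 3 (d 1 a))
        + (d 0 a + d 1 b) * d 0 a + (d 0 b + d 1 c) * d 1 a
        + a * d 0 (d 0 a) + 2 * b * d 0 (d 1 a) + c * d 1 (d 1 a)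
        - (d 0 a * d 0 a + 2 * d 1 a * d 0 b + d 1 b * d 1 b) ∧
    2 * ricD d (walkerD a b c) (walkerInvD a b c) 2 3
      = d 2 (d 0 b + d 1 c) + d 3 (d 0 a + d 1 b) - 2 * (d 2 (d 0 b) + d 3 (d 1 b))
        + (d 0 a + d 1 b) * d 0 b + (d 0 b + d 1 c) * d 1 b
        + a * d 0 (d 0 b) + 2 * b * d 0 (d 1 b) + c * d 1 (d 1 b)
        - (d 0 a * d 0 b + d 1 a * d 0 c + d 0 b * d 1 b + d 1 b * d 1 c) ∧
    2 * ricD d (walkerD a b c) (walkerInvD a b c) 3 3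
      = 2 * d 3 (d 0 b + d 1 c) - 2 * (d 2 (d 0 c) + d 3 (d 1 c))
        + (d 0 a + d 1 b) * d 0 c + (d 0 b + d 1 c) * d 1 c
        + a * d 0 (d 0 c) + 2 * b * d 0 (d 1 c) + c * d 1 (d 1 c)
        - (d 0 b * d 0 b + 2 * d 1 b * d 0 c + d 1 c * d 1 c) := by
  have h2 : (2 : A) * algebraMap ℝ A 2⁻¹ = 1 := by
    rw [← map_ofNat (algebraMap ℝ A) 2, ← map_mul]; norm_num
  have hn : ∀ i, d i 2 = 0 := fun i => by exact_mod_cast (d i).map_natCast 2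
  refine ⟨?_, ?_, ?_⟩
  · rw [ricD, chrD_walker]
    simp [Fin.sum_univ_four, hd 1 0, hd 2 0, hd 2 1, hd 3 0, hd 3 1, hn, Algebra.smul_def]
    generalize algebraMap ℝ A 2⁻¹ = h at h2 ⊢
    -- Terms with one factor `h` (one half) are cleared by `2h - 1`. The remaining products of two
    -- Christoffel symbols carry `h²` and need `4h² - 1 = (2h + 1)(2h - 1)`.
    linear_combination (2 * (d 0 (d 2 a) + d 1 (d 2 b)) - 2 * (d 0 (d 2 a) + d 1 (d 3 a))
        + (d 0 a + d 1 b) * d 0 a + (d 0 b + d 1 c) * d 1 a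
        + a * d 0 (d 0 a) + 2 * b * d 0 (d 1 a) + c * d 1 (d 1 a)
        - (d 0 a * d 0 a + 2 * d 1 a * d 0 b + d 1 b * d 1 b) * (2 * h + 1)) * h2
  · rw [ricD, chrD_walker]
    simp [Fin.sum_univ_four, hd 1 0, hd 2 0, hd 2 1, hd 3 0, hd 3 1, hn, Algebra.smul_def]
    generalize algebraMap ℝ A 2⁻¹ = h at h2 ⊢
    linear_combination (d 0 (d 2 b) + d 1 (d 2 c) + d 0 (d 3 a) + d 1 (d 3 b) - 2 * (d 0 (d 2 b) + d 1 (d 3 b))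
        + (d 0 a + d 1 b) * d 0 b + (d 0 b + d 1 c) * d 1 b
        + a * d 0 (d 0 b) + 2 * b * d 0 (d 1 b) + c * d 1 (d 1 b)
        - (d 0 a * d 0 b + d 1 a * d 0 c + d 0 b * d 1 b + d 1 b * d 1 c) * (2 * h + 1)) * h2
  · rw [ricD, chrD_walker]
    simp [Fin.sum_univ_four, hd 1 0, hd 2 0, hd 2 1, hd 3 0, hd 3 1, hn, Algebra.smul_def]
    generalize algebraMap ℝ A 2⁻¹ = h at h2 ⊢
    linear_combination (2 * (d 0 (d 3 b) + d 1 (d 3 c)) - 2 * (d 0 (d 2 c) + d 1 (d 3 c))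
        + (d 0 a + d 1 b) * d 0 c + (d 0 b + d 1 c) * d 1 c
        + a * d 0 (d 0 c) + 2 * b * d 0 (d 1 c) + c * d 1 (d 1 c)
        - (d 0 b * d 0 b + 2 * d 1 b * d 0 c + d 1 c * d 1 c) * (2 * h + 1)) * h2

end Algebra

/-! ### The soliton equation: twist, divergence and conformal factor -/

section Algebra

variable {A : Type*} [CommRing A] [Algebra ℝ A] (d : Fin 4 → Derivation ℝ A A)

/-- First transverse component of the connection form of the null distribution. -/
def conn₁ (a b : A) : A := d 0 a + d 1 b

/-- Second transverse component of the connection form of the null distribution. -/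
def conn₂ (b c : A) : A := d 0 b + d 1 c

/-- The scalar curvature of a Walker metric. -/
def scalD (a b c : A) : A := d 0 (conn₁ d a b) + d 1 (conn₂ d b c)

/-- The determinant of the leafwise derivative of the connection form. -/
def detD (a b c : A) : A :=
  d 0 (conn₁ d a b) * d 1 (conn₂ d b c) - d 0 (conn₂ d b c) * d 1 (conn₁ d a b)

/-- The soliton equation over a ring with derivations, for a Walker metric. -/
def IsSolD (a b c : A) (X : Fin 4 → A) (β φ : A) : Prop :=
  ∀ i j, 2 * β * ricD d (walkerD a b c) (walkerInvD a b c) i j + lieD d (walkerD a b c) X i j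
    = φ * walkerD a b c i j

/-- The derivative of a function along a vector field. -/
def dirD (X : Fin 4 → A) (h : A) : A := ∑ k, X k * d k h

/-- The coordinate divergence of a vector field. -/
def divD (X : Fin 4 → A) : A := ∑ k, d k (X k)

/-- The Laplacian of a Walker metric. -/
def lapD (a b c h : A) : A :=
  2 * (d 2 (d 0 h) + d 3 (d 1 h)) - d 0 (a * d 0 h + b * d 1 h) - d 1 (b * d 0 h + c * d 1 h)

variable {d} {a b c β φ : A} {X : Fin 4 → A}

/-- Both Ricci and the metric vanish on pairs of vectors tangent to the leaves, so only the Lie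
derivative survives: the pair `(X 2, X 3)` satisfies a Killing-type equation along each leaf. The
one free derivative `d 1 (X 2)` is the twist. -/
theorem IsSolD.leaf (h : IsSolD d a b c X β φ) :
    d 0 (X 2) = 0 ∧ d 0 (X 3) = - d 1 (X 2) ∧ d 1 (X 3) = 0 := by
  obtain ⟨r00, r01, -, r11⟩ := ricD_walker_leaf d a b c
  have h00 := h 0 0
  have h01 := h 0 1
  have h11 := h 1 1
  rw [r00] at h00; rw [r01] at h01; rw [r11] at h11
  simp [lieD, walkerD, Fin.sum_univ_four] at h00 h01 h11
  refine ⟨two_mul_cancel ?_, ?_, two_mul_cancel ?_⟩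
  · linear_combination h00
  · linear_combination h01
  · linear_combination h11

theorem IsSolD.mixed (hd : ∀ i j a, d i (d j a) = d j (d i a)) (h : IsSolD d a b c X β φ) :
    β * d 0 (conn₁ d a b) + d 0 (X 0) - b * d 1 (X 2) + d 2 (X 2) = φ ∧
    β * d 0 (conn₂ d b c) + d 0 (X 1) - c * d 1 (X 2) + d 3 (X 2) = 0 ∧
    β * d 1 (conn₁ d a b) + d 1 (X 0) + a * d 1 (X 2) + d 2 (X 3) = 0 ∧
    β * d 1 (conn₂ d b c) + d 1 (X 1) + b * d 1 (X 2) + d 3 (X 3) = φ := by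
  obtain ⟨h1, h2, h3⟩ := h.leaf
  obtain ⟨r02, r03, r12, r13⟩ := ricD_walker_mixed d hd a b c
  have t : ∀ u : A, 2 * β * ((1 / 2 : ℝ) • u) = β * u := fun u => by
    linear_combination β * two_smul_half u
  have h02 := h 0 2
  have h03 := h 0 3
  have h12 := h 1 2
  have h13 := h 1 3
  rw [r02, t] at h02; rw [r03, t] at h03; rw [r12, t] at h12; rw [r13, t] at h13
  simp only [conn₁, conn₂]
  simp [lieD, walkerD, Fin.sum_univ_four, h1, h2, h3] at h02 h03 h12 h13 ⊢
  refine ⟨?_, ?_, ?_, ?_⟩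
  · linear_combination h02
  · linear_combination h03
  · linear_combination h12
  · linear_combination h13

/-- Half the metric trace of the soliton equation; the volume density is 1 in Walker coordinates, so
`divD` is the true divergence. -/
theorem IsSolD.divD_eq (hd : ∀ i j a, d i (d j a) = d j (d i a)) (h : IsSolD d a b c X β φ) :
    divD d X = 2 * φ - β * scalD d a b c := by
  obtain ⟨h1, h2, h3, h4⟩ := h.mixed hd
  simp only [divD, scalD, Fin.sum_univ_four]
  linear_combination h1 + h4

/-- The leafwise derivatives of the conformal factor. -/
theorem IsSolD.factor (hd : ∀ i j a, d i (d j a) = d j (d i a)) (hβ : ∀ i, d i β = 0)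
    (h : IsSolD d a b c X β φ) :
    d 1 φ = - d 1 (X 2) * conn₁ d a b + 2 * d 2 (d 1 (X 2)) ∧
    d 0 φ = d 1 (X 2) * conn₂ d b c - 2 * d 3 (d 1 (X 2)) := by
  obtain ⟨h1, h2, h3⟩ := h.leaf
  obtain ⟨m1, m2, m3, m4⟩ := h.mixed hd
  -- Differentiated crosswise, the equations containing `d 0 (X 0)` and `d 1 (X 0)` share their
  -- second derivatives of `X 0` and of the connection form; the difference leaves `φ` and the twist
  -- only. Likewise for `X 1`.
  have a1 := congrArg (d 1) m1
  have a2 := congrArg (d 1) m2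
  have a3 := congrArg (d 0) m3
  have a4 := congrArg (d 0) m4
  have e1 : d 0 (d 1 (X 2)) = 0 := by rw [hd, h1, map_zero]
  have e2 : d 1 (d 1 (X 2)) = 0 := by
    rw [← neg_neg (d 1 (X 2)), ← h2, map_neg, hd, h3]; simp
  have e3 : d 0 (d 2 (X 3)) = - d 2 (d 1 (X 2)) := by rw [hd, h2, map_neg]
  have e4 : d 0 (d 3 (X 3)) = - d 3 (d 1 (X 2)) := by rw [hd, h2, map_neg]
  simp only [conn₁, conn₂] at *
  simp [hd 1 0, hd 2 0, hd 2 1, hd 3 0, hd 3 1, hβ] at a1 a2 a3 a4 e1 e2 e3 e4 ⊢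
  simp only [e1, e2, e3, e4] at a1 a2 a3 a4
  constructor
  · linear_combination a3 - a1
  · linear_combination a2 - a4

/-- The integrability condition for `φ`: the two expressions for its leafwise derivatives must have
equal mixed derivatives, and the twist is constant along the leaves. -/
theorem IsSolD.twist_mul_scalD (hd : ∀ i j a, d i (d j a) = d j (d i a)) (hβ : ∀ i, d i β = 0)
    (h : IsSolD d a b c X β φ) : d 1 (X 2) * scalD d a b c = 0 := by
  obtain ⟨h1, h2, h3⟩ := h.leaf
  obtain ⟨f1, f2⟩ := h.factor hd hβ
  have e1 : d 0 (d 1 (X 2)) = 0 := by rw [hd, h1, map_zero]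
  have e2 : d 1 (d 1 (X 2)) = 0 := by
    rw [← neg_neg (d 1 (X 2)), ← h2, map_neg, hd, h3]; simp
  have g1 := congrArg (d 0) f1
  have g2 := congrArg (d 1) f2
  have e3 : d 0 (d 2 (d 1 (X 2))) = 0 := by rw [hd, e1, map_zero]
  have e4 : d 1 (d 3 (d 1 (X 2))) = 0 := by rw [hd, e2, map_zero]
  have n2 : ∀ i, d i 2 = 0 := fun i => by exact_mod_cast (d i).map_natCast 2
  rw [hd 0 1] at g1
  simp only [map_add, map_sub, map_neg, Derivation.leibniz, smul_eq_mul, e1, e2, e3, e4, n2]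
    at g1 g2
  rw [scalD]
  linear_combination g1 - g2

variable [IsReduced A]

theorem eq_zero_of_sq {x : A} (h : x * x = 0) : x = 0 :=
  pow_eq_zero_iff (two_ne_zero) |>.1 (by rw [sq, h])

/-- In a reduced ring annihilators are stable under derivations. -/
theorem mul_deriv_eq_zero {s x : A} (h : s * x = 0) (D : Derivation ℝ A A) : s * D x = 0 := by
  have h1 := congrArg D h
  simp only [Derivation.leibniz, smul_eq_mul, map_zero] at h1
  refine eq_zero_of_sq ?_
  linear_combination (s * D x) * h1 - D x * D s * h

/-- For a soliton with conformal factor `β₂ R - 2 λ` the conformal factor is constant along the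
leaves, and the curvature of the null distribution vanishes where the field twists. -/
theorem IsSolD.basic (hd : ∀ i j a, d i (d j a) = d j (d i a)) (hβ : ∀ i, d i β = 0)
    {β₂ lam : A} (hβ₂ : ∀ i, d i β₂ = 0) (hl : ∀ i, d i lam = 0)
    (h : IsSolD d a b c X β φ) (hφ : φ = β₂ * scalD d a b c - 2 * lam) :
    (d 0 φ = 0 ∧ d 1 φ = 0) ∧
    (d 1 (X 2) * d 0 (conn₁ d a b) = 0 ∧ d 1 (X 2) * d 0 (conn₂ d b c) = 0 ∧
      d 1 (X 2) * d 1 (conn₁ d a b) = 0 ∧ d 1 (X 2) * d 1 (conn₂ d b c) = 0) := by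
  obtain ⟨h1, h2, h3⟩ := h.leaf
  obtain ⟨f1, f2⟩ := h.factor hd hβ
  have n2 : ∀ i, d i 2 = 0 := fun i => by exact_mod_cast (d i).map_natCast 2
  have sR := h.twist_mul_scalD hd hβ
  have sφ : ∀ i, d 1 (X 2) * d i φ = 0 := fun i => by
    have := mul_deriv_eq_zero sR (d i)
    rw [hφ]
    simp only [map_sub, Derivation.leibniz, smul_eq_mul, hβ₂, hl, n2]
    linear_combination β₂ * this
  -- From `s · d i φ = 0`, differentiation in direction `j` followed by multiplication with `d i φ`
  -- gives `d j s · (d i φ)² = 0`. Multiplying the formula for `d i φ` by its square therefore shows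
  -- that its cube vanishes.
  have key : ∀ i j w, d i φ = d 1 (X 2) * w + 2 * d j (d 1 (X 2)) → d i φ = 0 := by
    intro i j w hw
    have t := sφ i
    have t' : d j (d 1 (X 2)) * (d i φ * d i φ) = 0 := by
      have := congrArg (d j) t
      simp only [Derivation.leibniz, smul_eq_mul, map_zero] at this
      linear_combination (d i φ) * this - d j (d i φ) * t
    refine pow_eq_zero_iff (three_ne_zero) |>.1 ?_
    linear_combination (d i φ) ^ 2 * hw + w * d i φ * t + 2 * t'
  have p1 : d 1 φ = 0 := key 1 2 (-conn₁ d a b) (by rw [f1]; ring)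
  have p0 : d 0 φ = 0 := by
    have t := sφ 0
    have t' : d 3 (d 1 (X 2)) * (d 0 φ * d 0 φ) = 0 := by
      have := congrArg (d 3) t
      simp only [Derivation.leibniz, smul_eq_mul, map_zero] at this
      linear_combination (d 0 φ) * this - d 3 (d 0 φ) * t
    refine pow_eq_zero_iff (three_ne_zero) |>.1 ?_
    linear_combination (d 0 φ) ^ 2 * f2 + conn₂ d b c * d 0 φ * t - 2 * t'
  refine ⟨⟨p0, p1⟩, ?_⟩
  have e1 : d 0 (d 1 (X 2)) = 0 := by rw [hd, h1, map_zero]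
  have e2 : d 1 (d 1 (X 2)) = 0 := by
    rw [← neg_neg (d 1 (X 2)), ← h2, map_neg, hd, h3]; simp
  have e3 : ∀ k, d 0 (d k (d 1 (X 2))) = 0 := fun k => by rw [hd, e1, map_zero]
  have e4 : ∀ k, d 1 (d k (d 1 (X 2))) = 0 := fun k => by rw [hd, e2, map_zero]
  -- Once `φ` is basic, `s w₁ = 2 d 2 s` and `s w₂ = 2 d 3 s` with `s` constant along the leaves;
  -- leafwise derivatives give `s · d i w = 0`.
  rw [p1] at f1
  rw [p0] at f2
  have g1 := congrArg (d 0) f1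
  have g2 := congrArg (d 1) f1
  have g3 := congrArg (d 0) f2
  have g4 := congrArg (d 1) f2
  simp only [map_add, map_sub, map_neg, map_zero, Derivation.leibniz, smul_eq_mul, e1, e2, e3, e4,
    n2] at g1 g2 g3 g4
  refine ⟨?_, ?_, ?_, ?_⟩
  · linear_combination g1
  · linear_combination -g3
  · linear_combination g2
  · linear_combination -g4

end Algebra

/-! ### Variation of the connection form and of the scalar curvature -/

section Algebra

variable {A : Type*} [CommRing A] [Algebra ℝ A] {d : Fin 4 → Derivation ℝ A A}
variable {a b c β φ : A} {X : Fin 4 → A}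

theorem IsSolD.transverse (hd : ∀ i j a, d i (d j a) = d j (d i a)) (h : IsSolD d a b c X β φ) :
    β * (2 * d 2 (d 0 a + d 1 b) - 2 * (d 2 (d 0 a) + d 3 (d 1 a))
        + (d 0 a + d 1 b) * d 0 a + (d 0 b + d 1 c) * d 1 a
        + a * d 0 (d 0 a) + 2 * b * d 0 (d 1 a) + c * d 1 (d 1 a)
        - (d 0 a * d 0 a + 2 * d 1 a * d 0 b + d 1 b * d 1 b))
      + dirD d X a + 2 * (d 2 (X 0) + a * d 2 (X 2) + b * d 2 (X 3)) = φ * a ∧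
    β * (d 2 (d 0 b + d 1 c) + d 3 (d 0 a + d 1 b) - 2 * (d 2 (d 0 b) + d 3 (d 1 b))
        + (d 0 a + d 1 b) * d 0 b + (d 0 b + d 1 c) * d 1 b
        + a * d 0 (d 0 b) + 2 * b * d 0 (d 1 b) + c * d 1 (d 1 b)
        - (d 0 a * d 0 b + d 1 a * d 0 c + d 0 b * d 1 b + d 1 b * d 1 c))
      + dirD d X b + (d 2 (X 1) + b * d 2 (X 2) + c * d 2 (X 3))
      + (d 3 (X 0) + a * d 3 (X 2) + b * d 3 (X 3)) = φ * b ∧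
    β * (2 * d 3 (d 0 b + d 1 c) - 2 * (d 2 (d 0 c) + d 3 (d 1 c))
        + (d 0 a + d 1 b) * d 0 c + (d 0 b + d 1 c) * d 1 c
        + a * d 0 (d 0 c) + 2 * b * d 0 (d 1 c) + c * d 1 (d 1 c)
        - (d 0 b * d 0 b + 2 * d 1 b * d 0 c + d 1 c * d 1 c))
      + dirD d X c + 2 * (d 3 (X 1) + b * d 3 (X 2) + c * d 3 (X 3)) = φ * c := by
  obtain ⟨r1, r2, r3⟩ := ricD_walker_transverse d hd a b c
  have h1 := h 2 2
  have h2 := h 2 3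
  have h3 := h 3 3
  simp [lieD, walkerD, Fin.sum_univ_four] at h1 h2 h3
  change _ + _ = φ * a at h1
  refine ⟨?_, ?_, ?_⟩
  · rw [← r1]; simp only [dirD, Fin.sum_univ_four]
    refine Eq.trans ?_ h1
    simp only [walkerD]; ring_nf
  · rw [← r2]; simp only [dirD, Fin.sum_univ_four]
    refine Eq.trans ?_ h2
    simp only [walkerD]; ring_nf
  · rw [← r3]; simp only [dirD, Fin.sum_univ_four]
    refine Eq.trans ?_ h3
    simp only [walkerD]; ring_nf

/-- The variation of the connection form along a soliton field that does not twist. -/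
theorem IsSolD.lie_conn₁ (hd : ∀ i j a, d i (d j a) = d j (d i a)) (hβ : ∀ i, d i β = 0)
    (h : IsSolD d a b c X β φ) (hs : d 1 (X 2) = 0) (hφ : d 0 φ = 0 ∧ d 1 φ = 0) :
    dirD d X (conn₁ d a b) + conn₁ d a b * d 2 (X 2) + conn₂ d b c * d 2 (X 3)
      = - 3 * d 2 φ + 2 * d 2 (d 2 (X 2) + d 3 (X 3))
      + β * (2 * (d 2 (d 0 (conn₁ d a b)) + d 3 (d 1 (conn₁ d a b)))
        + d 0 (conn₁ d a b) * d 0 a + d 0 (conn₂ d b c) * d 1 a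
        + d 1 (conn₁ d a b) * d 0 b + d 1 (conn₂ d b c) * d 1 b
        - conn₁ d a b * d 0 (conn₁ d a b) - conn₂ d b c * d 1 (conn₁ d a b)
        - a * d 0 (d 0 (conn₁ d a b)) - 2 * b * d 0 (d 1 (conn₁ d a b))
        - c * d 1 (d 1 (conn₁ d a b))) := by
  obtain ⟨l1, l2, l3⟩ := h.leaf
  obtain ⟨m1, m2, m3, m4⟩ := h.mixed hd
  obtain ⟨t1, t2, -⟩ := h.transverse hd
  -- The connection component is `d 0 a + d 1 b`, so the transverse equations for `a` and `b` are
  -- differentiated by `d 0` and `d 1` and added; the derivatives of `X 0` and `X 1` that appear are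
  -- eliminated with the mixed equations.
  have e1 := congrArg (d 0) t1
  have e2 := congrArg (d 1) t2
  have n1 := congrArg (d 2) m1
  have n3 := congrArg (d 3) m3
  have n4 := congrArg (d 2) m4
  have n2 : ∀ i, d i 2 = 0 := fun i => by exact_mod_cast (d i).map_natCast 2
  have l2' : d 0 (X 3) = 0 := by rw [l2, hs, neg_zero]
  have k0 : ∀ k, d 0 (d k (X 2)) = 0 := fun k => by rw [hd, l1, map_zero]
  have k1 : ∀ k, d 1 (d k (X 2)) = 0 := fun k => by rw [hd, hs, map_zero]
  have k2 : ∀ k, d 0 (d k (X 3)) = 0 := fun k => by rw [hd, l2', map_zero]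
  have k3 : ∀ k, d 1 (d k (X 3)) = 0 := fun k => by rw [hd, l3, map_zero]
  simp only [conn₁, conn₂, dirD, Fin.sum_univ_four, map_add, map_sub, map_zero,
    Derivation.leibniz, smul_eq_mul, hβ, hs, l1, l2', l3, k0, k1, k2, k3, n2, hφ.1, hφ.2,
    hd 1 0, hd 2 0, hd 2 1, hd 3 0, hd 3 1, hd 3 2] at *
  linear_combination e1 + e2 - d 0 a * m1 - d 1 a * m2 - d 0 b * m3 - d 1 b * m4
    - 2 * n1 - n4 - n3

theorem IsSolD.lie_conn₂ (hd : ∀ i j a, d i (d j a) = d j (d i a)) (hβ : ∀ i, d i β = 0)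
    (h : IsSolD d a b c X β φ) (hs : d 1 (X 2) = 0) (hφ : d 0 φ = 0 ∧ d 1 φ = 0) :
    dirD d X (conn₂ d b c) + conn₁ d a b * d 3 (X 2) + conn₂ d b c * d 3 (X 3)
      = - 3 * d 3 φ + 2 * d 3 (d 2 (X 2) + d 3 (X 3))
      + β * (2 * (d 2 (d 0 (conn₂ d b c)) + d 3 (d 1 (conn₂ d b c)))
        + d 0 (conn₁ d a b) * d 0 b + d 0 (conn₂ d b c) * d 1 b
        + d 1 (conn₁ d a b) * d 0 c + d 1 (conn₂ d b c) * d 1 c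
        - conn₁ d a b * d 0 (conn₂ d b c) - conn₂ d b c * d 1 (conn₂ d b c)
        - a * d 0 (d 0 (conn₂ d b c)) - 2 * b * d 0 (d 1 (conn₂ d b c))
        - c * d 1 (d 1 (conn₂ d b c))) := by
  obtain ⟨l1, l2, l3⟩ := h.leaf
  obtain ⟨m1, m2, m3, m4⟩ := h.mixed hd
  obtain ⟨-, t1, t2⟩ := h.transverse hd
  have e1 := congrArg (d 0) t1
  have e2 := congrArg (d 1) t2
  have n1 := congrArg (d 3) m1
  have n3 := congrArg (d 2) m2
  have n4 := congrArg (d 3) m4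
  have n2 : ∀ i, d i 2 = 0 := fun i => by exact_mod_cast (d i).map_natCast 2
  have l2' : d 0 (X 3) = 0 := by rw [l2, hs, neg_zero]
  have k0 : ∀ k, d 0 (d k (X 2)) = 0 := fun k => by rw [hd, l1, map_zero]
  have k1 : ∀ k, d 1 (d k (X 2)) = 0 := fun k => by rw [hd, hs, map_zero]
  have k2 : ∀ k, d 0 (d k (X 3)) = 0 := fun k => by rw [hd, l2', map_zero]
  have k3 : ∀ k, d 1 (d k (X 3)) = 0 := fun k => by rw [hd, l3, map_zero]
  simp only [conn₁, conn₂, dirD, Fin.sum_univ_four, map_add, map_sub, map_zero,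
    Derivation.leibniz, smul_eq_mul, hβ, hs, l1, l2', l3, k0, k1, k2, k3, n2, hφ.1, hφ.2,
    hd 1 0, hd 2 0, hd 2 1, hd 3 0, hd 3 1, hd 3 2] at *
  linear_combination e1 + e2 - d 0 b * m1 - d 1 b * m2 - d 0 c * m3 - d 1 c * m4
    - n1 - 2 * n4 - n3

/-- The variation of the scalar curvature along a soliton field that does not twist. -/
theorem IsSolD.dirD_scalD (hd : ∀ i j a, d i (d j a) = d j (d i a)) (hβ : ∀ i, d i β = 0)
    (h : IsSolD d a b c X β φ) (hs : d 1 (X 2) = 0) (hφ : d 0 φ = 0 ∧ d 1 φ = 0) :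
    dirD d X (scalD d a b c) = - φ * scalD d a b c
      + β * (scalD d a b c * scalD d a b c - 2 * detD d a b c)
      + β * lapD d a b c (scalD d a b c) := by
  obtain ⟨l1, l2, l3⟩ := h.leaf
  obtain ⟨m1, m2, m3, m4⟩ := h.mixed hd
  -- The scalar curvature is the leafwise divergence of the connection form, so its variation is the
  -- leafwise divergence of the two variations just found.
  have e1 := congrArg (d 0) (h.lie_conn₁ hd hβ hs hφ)
  have e2 := congrArg (d 1) (h.lie_conn₂ hd hβ hs hφ)
  have n2 : ∀ i, d i 2 = 0 := fun i => by exact_mod_cast (d i).map_natCast 2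
  have n3 : ∀ i, d i 3 = 0 := fun i => by exact_mod_cast (d i).map_natCast 3
  have l2' : d 0 (X 3) = 0 := by rw [l2, hs, neg_zero]
  have k0 : ∀ k, d 0 (d k (X 2)) = 0 := fun k => by rw [hd, l1, map_zero]
  have k1 : ∀ k, d 1 (d k (X 2)) = 0 := fun k => by rw [hd, hs, map_zero]
  have k2 : ∀ k, d 0 (d k (X 3)) = 0 := fun k => by rw [hd, l2', map_zero]
  have k3 : ∀ k, d 1 (d k (X 3)) = 0 := fun k => by rw [hd, l3, map_zero]
  have k4 : ∀ k l, d 0 (d k (d l (X 2))) = 0 := fun k l => by rw [hd, k0, map_zero]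
  have k5 : ∀ k l, d 1 (d k (d l (X 2))) = 0 := fun k l => by rw [hd, k1, map_zero]
  have k6 : ∀ k l, d 0 (d k (d l (X 3))) = 0 := fun k l => by rw [hd, k2, map_zero]
  have k7 : ∀ k l, d 1 (d k (d l (X 3))) = 0 := fun k l => by rw [hd, k3, map_zero]
  have kφ0 : ∀ k, d 0 (d k φ) = 0 := fun k => by rw [hd, hφ.1, map_zero]
  have kφ1 : ∀ k, d 1 (d k φ) = 0 := fun k => by rw [hd, hφ.2, map_zero]
  have w1 : d 0 a + d 1 b = conn₁ d a b := rfl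
  have w2 : d 0 b + d 1 c = conn₂ d b c := rfl
  -- Eliminating `d 1 b` and `d 1 c` lets the connection components be treated as independent
  -- symbols `p`, `q`, while the first derivatives of `a`, `b`, `c` that remain still obey their
  -- definitions.
  have w1'' : d 1 b = conn₁ d a b - d 0 a := by rw [← w1]; ring
  have w2'' : d 1 c = conn₂ d b c - d 0 b := by rw [← w2]; ring
  simp only [scalD, detD, lapD] at *
  generalize conn₁ d a b = p at *
  generalize conn₂ d b c = q at *
  simp only [dirD, Fin.sum_univ_four, map_add, map_sub, map_neg, map_zero, neg_mul,
    Derivation.leibniz, smul_eq_mul, hβ, hs, l1, l2', l3, k0, k1, k2, k3, n2, n3,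
    kφ0, kφ1, k4, k5, k6, k7,
    hd 1 0, hd 2 0, hd 2 1, hd 3 0, hd 3 1, hd 3 2] at e1 e2 m1 m2 m3 m4 ⊢
  simp only [w1'', w2'', map_sub, hd 1 0] at e1 e2 ⊢
  linear_combination e1 + e2 - d 0 p * m1 - d 1 p * m2 - d 0 q * m3 - d 1 q * m4

end Algebra

section Algebra

variable {A : Type*} [CommRing A] [Algebra ℝ A] (d : Fin 4 → Derivation ℝ A A)

/-! ### Divergence identities -/

/-- The Hamiltonian vector field of a function for the bivector that is dual to the curvature of
the connection form `w₁ du + w₂ dv`. -/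
def hamD (w₁ w₂ h : A) : Fin 4 → A :=
  ![d 1 w₂ * d 2 h - d 1 w₁ * d 3 h - (d 2 w₂ - d 3 w₁) * d 1 h,
    d 0 w₁ * d 3 h - d 0 w₂ * d 2 h + (d 2 w₂ - d 3 w₁) * d 0 h,
    d 0 w₂ * d 1 h - d 1 w₂ * d 0 h,
    d 1 w₁ * d 0 h - d 0 w₁ * d 1 h]

/-- The field obtained from the connection form with the same bivector. -/
def connField (w₁ w₂ : A) : Fin 4 → A :=
  ![d 1 w₂ * w₁ - d 1 w₁ * w₂, d 0 w₁ * w₂ - d 0 w₂ * w₁, 0, 0]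

/-- The gradient of a function for a Walker metric. -/
def gradD (a b c h : A) : Fin 4 → A :=
  ![d 2 h - a * d 0 h - b * d 1 h, d 3 h - b * d 0 h - c * d 1 h, d 0 h, d 1 h]

variable {d}

theorem divD_mul (X : Fin 4 → A) (h : A) :
    divD d (fun k => h * X k) = dirD d X h + h * divD d X := by
  simp only [divD, dirD, Fin.sum_univ_four, Derivation.leibniz, smul_eq_mul]; ring

/-- Up to sign the field is dual, by the coordinate volume form, to `dw ∧ dh` with `w = w₁ du + w₂
dv`, and this 3-form is closed. -/
theorem divD_hamD (hd : ∀ i j a, d i (d j a) = d j (d i a)) (w₁ w₂ h : A) :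
    divD d (hamD d w₁ w₂ h) = 0 := by
  simp [divD, hamD, Fin.sum_univ_four, hd 1 0, hd 2 0, hd 2 1, hd 3 0, hd 3 1, hd 3 2]
  ring

/-- The form behind it is `dw ∧ dh ∧ dh = 0`. -/
theorem dirD_hamD_self (w₁ w₂ h : A) : dirD d (hamD d w₁ w₂ h) h = 0 := by
  simp [dirD, hamD, Fin.sum_univ_four]
  ring

theorem divD_gradD (hd : ∀ i j a, d i (d j a) = d j (d i a)) (a b c h : A) :
    divD d (gradD d a b c h) = lapD d a b c h := by
  simp [divD, gradD, lapD, Fin.sum_univ_four, hd 2 0, hd 3 1]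
  ring

/-- Up to sign the field is dual to `w ∧ dw`, whose differential is `dw ∧ dw`, that is, `-2 δ` times
the volume form. -/
theorem divD_connField (hd : ∀ i j a, d i (d j a) = d j (d i a)) (a b c : A) :
    divD d (connField d (conn₁ d a b) (conn₂ d b c)) = 2 * detD d a b c := by
  simp only [divD, connField, detD, Fin.sum_univ_four]
  generalize conn₁ d a b = p
  generalize conn₂ d b c = q
  simp [hd 1 0]
  ring

/-- The connection field corrected by a density of the null distribution. -/
theorem divD_connField_add (hd : ∀ i j a, d i (d j a) = d j (d i a)) {a b c S σ : A}
    (hS : S * σ = 1) :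
    divD d (fun k => connField d (conn₁ d a b) (conn₂ d b c) k
      + σ * hamD d (conn₁ d a b) (conn₂ d b c) S k) = 2 * detD d a b c := by
  have h1 : ∀ k, d k σ = - (σ * σ) * d k S := fun k => by
    have := congrArg (d k) hS
    simp only [Derivation.leibniz, smul_eq_mul, Derivation.map_one_eq_zero] at this
    linear_combination σ * this - d k σ * hS
  have h2 : divD d (fun k => connField d (conn₁ d a b) (conn₂ d b c) k
      + σ * hamD d (conn₁ d a b) (conn₂ d b c) S k)
      = divD d (connField d (conn₁ d a b) (conn₂ d b c))
        + divD d (fun k => σ * hamD d (conn₁ d a b) (conn₂ d b c) S k) := by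
    simp only [divD, map_add, Finset.sum_add_distrib]
  rw [h2, divD_connField hd, divD_mul, divD_hamD hd]
  have h3 : dirD d (hamD d (conn₁ d a b) (conn₂ d b c) S) σ
      = - (σ * σ) * dirD d (hamD d (conn₁ d a b) (conn₂ d b c) S) S := by
    simp only [dirD, h1, Finset.mul_sum]
    exact Finset.sum_congr rfl fun k _ => by ring
  rw [h3, dirD_hamD_self]; ring

/-- Twice the trace of the covariant derivative of a field on the normal bundle of the null
distribution. -/
def normalTrace (d : Fin 4 → Derivation ℝ A A) (w₁ w₂ : A) (X : Fin 4 → A) : A :=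
  2 * (d 2 (X 2) + d 3 (X 3)) - w₁ * X 2 - w₂ * X 3

/-- As the Hamiltonian field has no divergence, only its derivative of the normal trace remains. For
a basic `h` the field is tangent to the leaves with coefficients built from the leafwise derivative
of `w`; these kill all twist terms, and the surviving terms `-d i w₁ · X 2 - d i w₂ · X 3` assemble
to the determinant. -/
theorem divD_normalTrace_hamD (hd : ∀ i j a, d i (d j a) = d j (d i a)) {a b c h : A}
    {X : Fin 4 → A} (l1 : d 0 (X 2) = 0) (l2 : d 0 (X 3) = - d 1 (X 2)) (l3 : d 1 (X 3) = 0)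
    (s1 : ∀ j, d j (d 1 (X 2)) * d 0 (conn₁ d a b) = 0)
    (s2 : ∀ j, d j (d 1 (X 2)) * d 0 (conn₂ d b c) = 0)
    (s3 : ∀ j, d j (d 1 (X 2)) * d 1 (conn₁ d a b) = 0)
    (s4 : ∀ j, d j (d 1 (X 2)) * d 1 (conn₂ d b c) = 0)
    (t1 : d 1 (X 2) * d 0 (conn₁ d a b) = 0) (t2 : d 1 (X 2) * d 0 (conn₂ d b c) = 0)
    (t3 : d 1 (X 2) * d 1 (conn₁ d a b) = 0) (t4 : d 1 (X 2) * d 1 (conn₂ d b c) = 0)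
    (h0 : d 0 h = 0) (h1 : d 1 h = 0) :
    divD d (fun k => normalTrace d (conn₁ d a b) (conn₂ d b c) X
        * hamD d (conn₁ d a b) (conn₂ d b c) h k)
      = - (detD d a b c * dirD d X h) := by
  rw [divD_mul, divD_hamD hd, mul_zero, add_zero]
  have n2 : ∀ i, d i 2 = 0 := fun i => by exact_mod_cast (d i).map_natCast 2
  have e1 : d 0 (d 2 (X 2)) = 0 := by rw [hd, l1, map_zero]
  have e2 : d 1 (d 3 (X 3)) = 0 := by rw [hd, l3, map_zero]
  have e3 : d 0 (d 3 (X 3)) = - d 3 (d 1 (X 2)) := by rw [hd, l2, map_neg]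
  have e4 : d 1 (d 2 (X 2)) = d 2 (d 1 (X 2)) := by rw [hd]
  simp only [detD]
  generalize conn₁ d a b = p at *
  generalize conn₂ d b c = q at *
  simp [dirD, hamD, normalTrace, Fin.sum_univ_four, h0, h1, l1, l2, l3, n2, e1, e2, e3, e4]
  linear_combination (-2 * d 2 h) * s4 3 + 2 * d 3 h * s3 3 + (2 * d 3 h) * s1 2
    - 2 * d 2 h * s2 2
    + (q * d 2 h) * t4 - q * d 3 h * t3 - p * d 3 h * t1 + p * d 2 h * t2

/-! ### Changes of Walker coordinates -/

variable {A' : Type*} [CommRing A'] [Algebra ℝ A'] {d' : Fin 4 → Derivation ℝ A' A'}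

variable (d d') in
/-- A change of Walker coordinates `y`, with pullback `t`, between two Walker metrics. -/
structure WalkerTrans (t : A' →+* A) (y : Fin 4 → A) (a b c : A) (a' b' c' : A') : Prop where
  comm : ∀ i j x, d i (d j x) = d j (d i x)
  chain : ∀ k h, d k (t h) = ∑ l, t (d' l h) * d k (y l)
  leaf : d 0 (y 2) = 0 ∧ d 0 (y 3) = 0 ∧ d 1 (y 2) = 0 ∧ d 1 (y 3) = 0
  metric : ∀ i j, walkerD a b c i j
    = ∑ k, ∑ l, d i (y k) * d j (y l) * t (walkerD a' b' c' k l)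

variable (d) in
/-- The Jacobian determinant of the transverse coordinate change. -/
def normalJac (y : Fin 4 → A) : A := d 2 (y 2) * d 3 (y 3) - d 3 (y 2) * d 2 (y 3)

variable (d) in
/-- The Jacobian determinant of the leafwise coordinate change. -/
def leafJac (y : Fin 4 → A) : A := d 0 (y 0) * d 1 (y 1) - d 1 (y 0) * d 0 (y 1)

variable {t : A' →+* A} {y : Fin 4 → A} {a b c : A} {a' b' c' : A'}

namespace WalkerTrans

/-- The constant off-diagonal block of the metric pairs leaf and transverse directions, so the
leafwise Jacobian block is inverse transpose to the transverse one. -/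
theorem dual (H : WalkerTrans d d' t y a b c a' b' c') :
    d 0 (y 0) * d 2 (y 2) + d 0 (y 1) * d 2 (y 3) = 1 ∧
    d 0 (y 0) * d 3 (y 2) + d 0 (y 1) * d 3 (y 3) = 0 ∧
    d 1 (y 0) * d 2 (y 2) + d 1 (y 1) * d 2 (y 3) = 0 ∧
    d 1 (y 0) * d 3 (y 2) + d 1 (y 1) * d 3 (y 3) = 1 := by
  obtain ⟨l1, l2, l3, l4⟩ := H.leaf
  have h02 := H.metric 0 2
  have h03 := H.metric 0 3
  have h12 := H.metric 1 2
  have h13 := H.metric 1 3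
  simp [walkerD, Fin.sum_univ_four, l1, l2, l3, l4] at h02 h03 h12 h13
  exact ⟨h02.symm, h03.symm, h12.symm, h13.symm⟩

theorem jac_mul (H : WalkerTrans d d' t y a b c a' b' c') : normalJac d y * leafJac d y = 1 := by
  obtain ⟨h1, h2, h3, h4⟩ := H.dual
  simp only [normalJac, leafJac]
  linear_combination (d 1 (y 0) * d 3 (y 2) + d 1 (y 1) * d 3 (y 3)) * h1 + h4
    - (d 1 (y 0) * d 2 (y 2) + d 1 (y 1) * d 2 (y 3)) * h2

theorem leaf_eq (H : WalkerTrans d d' t y a b c a' b' c') :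
    d 0 (y 0) = leafJac d y * d 3 (y 3) ∧ d 0 (y 1) = - leafJac d y * d 3 (y 2) ∧
    d 1 (y 0) = - leafJac d y * d 2 (y 3) ∧ d 1 (y 1) = leafJac d y * d 2 (y 2) := by
  obtain ⟨h1, h2, h3, h4⟩ := H.dual
  simp only [leafJac]
  refine ⟨?_, ?_, ?_, ?_⟩
  · linear_combination -d 0 (y 0) * h4 + d 1 (y 0) * h2
  · linear_combination d 1 (y 1) * h2 - d 0 (y 1) * h4
  · linear_combination -d 1 (y 0) * h1 + d 0 (y 0) * h3
  · linear_combination -d 1 (y 1) * h1 + d 0 (y 1) * h3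

theorem dual' (H : WalkerTrans d d' t y a b c a' b' c') :
    d 2 (y 2) * d 0 (y 0) + d 3 (y 2) * d 1 (y 0) = 1 ∧
    d 2 (y 2) * d 0 (y 1) + d 3 (y 2) * d 1 (y 1) = 0 ∧
    d 2 (y 3) * d 0 (y 0) + d 3 (y 3) * d 1 (y 0) = 0 ∧
    d 2 (y 3) * d 0 (y 1) + d 3 (y 3) * d 1 (y 1) = 1 := by
  obtain ⟨h1, h2, h3, h4⟩ := H.leaf_eq
  have := H.jac_mul
  rw [normalJac] at this
  rw [h1, h2, h3, h4]
  refine ⟨?_, ?_, ?_, ?_⟩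
  · linear_combination this
  · ring
  · ring
  · linear_combination this

theorem metric_transverse (H : WalkerTrans d d' t y a b c a' b' c') :
    a = 2 * (d 2 (y 0) * d 2 (y 2) + d 2 (y 1) * d 2 (y 3)) + d 2 (y 2) ^ 2 * t a'
      + 2 * (d 2 (y 2) * d 2 (y 3)) * t b' + d 2 (y 3) ^ 2 * t c' ∧
    b = d 2 (y 0) * d 3 (y 2) + d 2 (y 1) * d 3 (y 3) + d 2 (y 2) * d 3 (y 0)
      + d 2 (y 3) * d 3 (y 1) + d 2 (y 2) * d 3 (y 2) * t a'
      + (d 2 (y 2) * d 3 (y 3) + d 2 (y 3) * d 3 (y 2)) * t b' + d 2 (y 3) * d 3 (y 3) * t c' ∧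
    c = 2 * (d 3 (y 0) * d 3 (y 2) + d 3 (y 1) * d 3 (y 3)) + d 3 (y 2) ^ 2 * t a'
      + 2 * (d 3 (y 2) * d 3 (y 3)) * t b' + d 3 (y 3) ^ 2 * t c' := by
  have h22 := H.metric 2 2
  have h23 := H.metric 2 3
  have h33 := H.metric 3 3
  simp [walkerD, Fin.sum_univ_four] at h22 h23 h33
  refine ⟨h22.trans (by ring), h23.trans (by ring), h33.trans (by ring)⟩

theorem leaf_transverse (H : WalkerTrans d d' t y a b c a' b' c') :
    (∀ k, d 0 (d k (y 2)) = 0) ∧ (∀ k, d 0 (d k (y 3)) = 0) ∧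
    (∀ k, d 1 (d k (y 2)) = 0) ∧ (∀ k, d 1 (d k (y 3)) = 0) := by
  obtain ⟨l1, l2, l3, l4⟩ := H.leaf
  refine ⟨fun k => ?_, fun k => ?_, fun k => ?_, fun k => ?_⟩
  · rw [H.comm, l1, map_zero]
  · rw [H.comm, l2, map_zero]
  · rw [H.comm, l3, map_zero]
  · rw [H.comm, l4, map_zero]

theorem chain_leaf (H : WalkerTrans d d' t y a b c a' b' c') (h : A') :
    d 0 (t h) = t (d' 0 h) * d 0 (y 0) + t (d' 1 h) * d 0 (y 1) ∧
    d 1 (t h) = t (d' 0 h) * d 1 (y 0) + t (d' 1 h) * d 1 (y 1) := by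
  obtain ⟨l1, l2, l3, l4⟩ := H.leaf
  constructor <;> rw [H.chain] <;> simp [Fin.sum_univ_four, l1, l2, l3, l4]

/-- A gauge transformation law: with `Δ` the transverse Jacobian determinant, the form `w₁ du + w₂
dv` changes by `-2 d log Δ`. It is obtained by leafwise differentiation of the transformation law of
`a`, `b`, `c`, the second derivatives being removed by differentiating the duality relations. -/
theorem conn₁_eq (H : WalkerTrans d d' t y a b c a' b' c') :
    conn₁ d a b = d 2 (y 2) * t (conn₁ d' a' b') + d 2 (y 3) * t (conn₂ d' b' c')
      - 2 * (leafJac d y * d 2 (normalJac d y)) := by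
  obtain ⟨k1, k2, k3, k4⟩ := H.leaf_transverse
  obtain ⟨p1, p2, p3, p4⟩ := H.leaf_eq
  obtain ⟨ma, mb, mc⟩ := H.metric_transverse
  obtain ⟨h1, h2, h3, h4⟩ := H.dual
  obtain ⟨q1, q2, q3, q4⟩ := H.dual'
  have e1 := congrArg (d 2) h1
  have e3 := congrArg (d 3) h3
  have e4 := congrArg (d 2) h4
  obtain ⟨a0, a1⟩ := H.chain_leaf a'
  obtain ⟨b0, b1⟩ := H.chain_leaf b'
  obtain ⟨c0, c1⟩ := H.chain_leaf c'
  have n2 : ∀ i, d i 2 = 0 := fun i => by exact_mod_cast (d i).map_natCast 2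
  have ma' := congrArg (d 0) ma
  have mb' := congrArg (d 1) mb
  have hd := H.comm
  simp only [conn₁, conn₂, normalJac]
  simp only [map_add, map_sub, Derivation.leibniz, Derivation.leibniz_pow, smul_eq_mul, n2,
    k1, k2, k3, k4, Derivation.map_one_eq_zero, map_zero, a0, a1, b0, b1, c0, c1,
    hd 2 0, hd 2 1, hd 3 0, hd 3 1, hd 3 2] at ma' mb' e1 e3 e4 ⊢
  generalize leafJac d y = E at *
  rw [ma', mb']
  linear_combination 2 * e1 + e3 + e4
    - 2 * d 2 (d 2 (y 2)) * p1 - 2 * d 2 (d 2 (y 3)) * p2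
    - 2 * d 2 (d 3 (y 2)) * p3 - 2 * d 2 (d 3 (y 3)) * p4
    + d 2 (y 2) * (t (d' 0 a') * q1 + t (d' 1 a') * q2)
    + t (d' 0 b') * (d 2 (y 2) * q3 + d 2 (y 3) * q1)
    + t (d' 1 b') * (d 2 (y 2) * q4 + d 2 (y 3) * q2)
    + d 2 (y 3) * (t (d' 0 c') * q3 + t (d' 1 c') * q4)

theorem conn₂_eq (H : WalkerTrans d d' t y a b c a' b' c') :
    conn₂ d b c = d 3 (y 2) * t (conn₁ d' a' b') + d 3 (y 3) * t (conn₂ d' b' c')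
      - 2 * (leafJac d y * d 3 (normalJac d y)) := by
  obtain ⟨k1, k2, k3, k4⟩ := H.leaf_transverse
  obtain ⟨p1, p2, p3, p4⟩ := H.leaf_eq
  obtain ⟨ma, mb, mc⟩ := H.metric_transverse
  obtain ⟨h1, h2, h3, h4⟩ := H.dual
  obtain ⟨q1, q2, q3, q4⟩ := H.dual'
  have e1 := congrArg (d 3) h1
  have e3 := congrArg (d 2) h2
  have e4 := congrArg (d 3) h4
  obtain ⟨a0, a1⟩ := H.chain_leaf a'
  obtain ⟨b0, b1⟩ := H.chain_leaf b'
  obtain ⟨c0, c1⟩ := H.chain_leaf c'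
  have n2 : ∀ i, d i 2 = 0 := fun i => by exact_mod_cast (d i).map_natCast 2
  have mb' := congrArg (d 0) mb
  have mc' := congrArg (d 1) mc
  have hd := H.comm
  simp only [conn₁, conn₂, normalJac]
  simp only [map_add, map_sub, Derivation.leibniz, Derivation.leibniz_pow, smul_eq_mul, n2,
    k1, k2, k3, k4, Derivation.map_one_eq_zero, map_zero, a0, a1, b0, b1, c0, c1,
    hd 2 0, hd 2 1, hd 3 0, hd 3 1, hd 3 2] at mb' mc' e1 e3 e4 ⊢
  generalize leafJac d y = E at *
  rw [mb', mc']
  linear_combination e1 + e3 + 2 * e4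
    - 2 * d 2 (d 3 (y 2)) * p1 - 2 * d 2 (d 3 (y 3)) * p2
    - 2 * d 3 (d 3 (y 2)) * p3 - 2 * d 3 (d 3 (y 3)) * p4
    + d 3 (y 2) * (t (d' 0 a') * q1 + t (d' 1 a') * q2)
    + t (d' 0 b') * (d 3 (y 2) * q3 + d 3 (y 3) * q1)
    + t (d' 1 b') * (d 3 (y 2) * q4 + d 3 (y 3) * q2)
    + d 3 (y 3) * (t (d' 0 c') * q3 + t (d' 1 c') * q4)

end WalkerTrans

end Algebra

/-! ### Invariants and natural fields under changes of Walker coordinates -/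

section Algebra

variable {A : Type*} [CommRing A] [Algebra ℝ A] {d : Fin 4 → Derivation ℝ A A}
variable {A' : Type*} [CommRing A'] [Algebra ℝ A'] {d' : Fin 4 → Derivation ℝ A' A'}
variable {t : A' →+* A} {y : Fin 4 → A} {a b c : A} {a' b' c' : A'}

variable (d) in
/-- `V'` is the expression of the vector field `V` in the coordinates `y`. -/
def IsPush (t : A' →+* A) (y : Fin 4 → A) (V : Fin 4 → A) (V' : Fin 4 → A') : Prop :=
  ∀ k, t (V' k) = ∑ l, V l * d l (y k)
theorem IsPush.dirD {V : Fin 4 → A} {V' : Fin 4 → A'} (h : IsPush d t y V V')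
    (hc : ∀ k h, d k (t h) = ∑ l, t (d' l h) * d k (y l)) (f : A') :
    dirD d V (t f) = t (dirD d' V' f) := by
  simp only [WalkerSoliton.dirD, map_sum, map_mul, h _, hc, Finset.mul_sum, Finset.sum_mul]
  rw [Finset.sum_comm]
  exact Finset.sum_congr rfl fun l _ => Finset.sum_congr rfl fun k _ => by ring

namespace WalkerTrans

theorem jac_leaf (H : WalkerTrans d d' t y a b c a' b' c') :
    d 0 (normalJac d y) = 0 ∧ d 1 (normalJac d y) = 0 := by
  obtain ⟨k1, k2, k3, k4⟩ := H.leaf_transverse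
  constructor <;>
    simp only [normalJac, map_sub, Derivation.leibniz, smul_eq_mul, k1, k2, k3, k4] <;> ring

theorem deriv_leafJac (H : WalkerTrans d d' t y a b c a' b' c') (k : Fin 4) :
    d k (leafJac d y) = - leafJac d y ^ 2 * d k (normalJac d y) := by
  have h := H.jac_mul
  have := congrArg (d k) h
  simp only [Derivation.leibniz, smul_eq_mul, Derivation.map_one_eq_zero] at this
  linear_combination leafJac d y * this - d k (leafJac d y) * h

/-- The gauge term `2 d log Δ` is constant along the leaves, so the leafwise derivative of the
connection form transforms as a tensor. By duality of the Jacobian blocks it is conjugated, so that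
its trace and determinant are invariant. -/
theorem curv_eq (H : WalkerTrans d d' t y a b c a' b' c') (k : Fin 4) (hk : k = 0 ∨ k = 1) :
    d k (conn₁ d a b) = d 2 (y 2) * (t (d' 0 (conn₁ d' a' b')) * d k (y 0)
        + t (d' 1 (conn₁ d' a' b')) * d k (y 1))
      + d 2 (y 3) * (t (d' 0 (conn₂ d' b' c')) * d k (y 0)
        + t (d' 1 (conn₂ d' b' c')) * d k (y 1)) ∧
    d k (conn₂ d b c) = d 3 (y 2) * (t (d' 0 (conn₁ d' a' b')) * d k (y 0)
        + t (d' 1 (conn₁ d' a' b')) * d k (y 1))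
      + d 3 (y 3) * (t (d' 0 (conn₂ d' b' c')) * d k (y 0)
        + t (d' 1 (conn₂ d' b' c')) * d k (y 1)) := by
  obtain ⟨k1, k2, k3, k4⟩ := H.leaf_transverse
  obtain ⟨j0, j1⟩ := H.jac_leaf
  have hd := H.comm
  have n2 : ∀ i, d i 2 = 0 := fun i => by exact_mod_cast (d i).map_natCast 2
  obtain ⟨x0, x1⟩ := H.chain_leaf (conn₁ d' a' b')
  obtain ⟨z0, z1⟩ := H.chain_leaf (conn₂ d' b' c')
  have r : ∀ l, d k (d l (normalJac d y)) = 0 := fun l => by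
    rcases hk with rfl | rfl <;> rw [hd]
    · rw [j0, map_zero]
    · rw [j1, map_zero]
  have r' : d k (leafJac d y) = 0 := by
    rw [H.deriv_leafJac]; rcases hk with rfl | rfl <;> simp [j0, j1]
  have s : d k (d 2 (y 2)) = 0 ∧ d k (d 2 (y 3)) = 0 ∧ d k (d 3 (y 2)) = 0
      ∧ d k (d 3 (y 3)) = 0 := by
    rcases hk with rfl | rfl <;> simp [k1, k2, k3, k4]
  have x : d k (t (conn₁ d' a' b')) = t (d' 0 (conn₁ d' a' b')) * d k (y 0)
        + t (d' 1 (conn₁ d' a' b')) * d k (y 1) := by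
    rcases hk with rfl | rfl <;> assumption
  have z : d k (t (conn₂ d' b' c')) = t (d' 0 (conn₂ d' b' c')) * d k (y 0)
        + t (d' 1 (conn₂ d' b' c')) * d k (y 1) := by
    rcases hk with rfl | rfl <;> assumption
  obtain ⟨s1, s2, s3, s4⟩ := s
  rw [H.conn₁_eq, H.conn₂_eq]
  constructor <;> simp only [map_add, map_sub, Derivation.leibniz, smul_eq_mul, n2, r, r', s1, s2,
    s3, s4, x, z] <;> ring

theorem scalD_eq (H : WalkerTrans d d' t y a b c a' b' c') :
    scalD d a b c = t (scalD d' a' b' c') := by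
  obtain ⟨q1, q2, q3, q4⟩ := H.dual'
  obtain ⟨x0, z0⟩ := H.curv_eq 0 (Or.inl rfl)
  obtain ⟨x1, z1⟩ := H.curv_eq 1 (Or.inr rfl)
  simp only [scalD, x0, z1, map_add]
  linear_combination t (d' 0 (conn₁ d' a' b')) * q1 + t (d' 1 (conn₁ d' a' b')) * q2
    + t (d' 0 (conn₂ d' b' c')) * q3 + t (d' 1 (conn₂ d' b' c')) * q4

theorem detD_eq (H : WalkerTrans d d' t y a b c a' b' c') :
    detD d a b c = t (detD d' a' b' c') := by
  have h := H.jac_mul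
  obtain ⟨x0, z0⟩ := H.curv_eq 0 (Or.inl rfl)
  obtain ⟨x1, z1⟩ := H.curv_eq 1 (Or.inr rfl)
  simp only [detD, x0, z1, x1, z0, map_sub, map_mul]
  simp only [normalJac, leafJac] at h
  linear_combination (t (d' 0 (conn₁ d' a' b')) * t (d' 1 (conn₂ d' b' c'))
    - t (d' 0 (conn₂ d' b' c')) * t (d' 1 (conn₁ d' a' b'))) * h

/-- The gauge term drops out because it is closed. -/
theorem curl_eq (H : WalkerTrans d d' t y a b c a' b' c') :
    d 2 (conn₂ d b c) - d 3 (conn₁ d a b)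
      = d 3 (y 2) * d 2 (t (conn₁ d' a' b')) + d 3 (y 3) * d 2 (t (conn₂ d' b' c'))
        - d 2 (y 2) * d 3 (t (conn₁ d' a' b')) - d 2 (y 3) * d 3 (t (conn₂ d' b' c')) := by
  have hd := H.comm
  have n2 : ∀ i, d i 2 = 0 := fun i => by exact_mod_cast (d i).map_natCast 2
  rw [H.conn₁_eq, H.conn₂_eq]
  simp only [map_add, map_sub, Derivation.leibniz, smul_eq_mul, n2, H.deriv_leafJac, hd 3 2]
  ring

theorem isPush_hamD (H : WalkerTrans d d' t y a b c a' b' c') (h : A') :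
    IsPush d t y (hamD d (conn₁ d a b) (conn₂ d b c) (t h))
      (hamD d' (conn₁ d' a' b') (conn₂ d' b' c') h) := by
  have hΔ := H.jac_mul
  obtain ⟨x0, z0⟩ := H.curv_eq 0 (Or.inl rfl)
  obtain ⟨x1, z1⟩ := H.curv_eq 1 (Or.inr rfl)
  obtain ⟨l1, l2, l3, l4⟩ := H.leaf
  obtain ⟨p1, p2, p3, p4⟩ := H.leaf_eq
  have hk := H.curl_eq
  have c1 := H.chain 2 (conn₁ d' a' b')
  have c2 := H.chain 3 (conn₁ d' a' b')
  have c3 := H.chain 2 (conn₂ d' b' c')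
  have c4 := H.chain 3 (conn₂ d' b' c')
  have h2 := H.chain 2 h
  have h3 := H.chain 3 h
  obtain ⟨h0, h1⟩ := H.chain_leaf h
  simp only [Fin.sum_univ_four] at c1 c2 c3 c4 h2 h3
  rw [c1, c2, c3, c4] at hk
  simp only [normalJac] at hΔ
  generalize leafJac d y = E at *
  intro k
  simp only [Fin.sum_univ_four, hamD]
  -- Substituting the cofactor formulas for the leafwise Jacobian raises the degree of one side by
  -- `(E Δ)²`; since `E Δ = 1` the other side may be multiplied by the same factor, and the claim
  -- becomes a polynomial identity.
  have key : ∀ L N : A, N = E ^ 2 * (d 2 (y 2) * d 3 (y 3) - d 3 (y 2) * d 2 (y 3)) ^ 2 * L →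
      L = N := fun L N hN => by
    rw [hN]
    linear_combination - L * (E * (d 2 (y 2) * d 3 (y 3) - d 3 (y 2) * d 2 (y 3)) + 1) * hΔ
  refine key _ _ ?_
  fin_cases k <;>
    simp [hk, x0, z0, x1, z1, h0, h1, h2, h3, p1, p2, p3, p4, l1, l2, l3, l4] <;> ring

/-- The transformation of a density of the null distribution. -/
theorem isPush_connField_add (H : WalkerTrans d d' t y a b c a' b' c') {S σ : A} {S' σ' : A'}
    (hS : S = normalJac d y ^ 2 * t S') (hσ : σ = leafJac d y ^ 2 * t σ') (h1 : S' * σ' = 1) :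
    IsPush d t y
      (fun k => connField d (conn₁ d a b) (conn₂ d b c) k
        + σ * hamD d (conn₁ d a b) (conn₂ d b c) S k)
      (fun k => connField d' (conn₁ d' a' b') (conn₂ d' b' c') k
        + σ' * hamD d' (conn₁ d' a' b') (conn₂ d' b' c') S' k) := by
  have hΔ := H.jac_mul
  obtain ⟨j0, j1⟩ := H.jac_leaf
  have e1 : ∀ k, hamD d (conn₁ d a b) (conn₂ d b c) S k
      = normalJac d y ^ 2 * hamD d (conn₁ d a b) (conn₂ d b c) (t S') k
        + 2 * normalJac d y * t S' * hamD d (conn₁ d a b) (conn₂ d b c) (normalJac d y) k := by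
    intro k
    rw [hS]
    fin_cases k <;> simp [hamD, Derivation.leibniz_pow] <;> ring
  have h1' := congrArg t h1
  rw [map_mul, map_one] at h1'
  have e2 : ∀ k, connField d (conn₁ d a b) (conn₂ d b c) k
        + σ * hamD d (conn₁ d a b) (conn₂ d b c) S k
      = (connField d (conn₁ d a b) (conn₂ d b c) k
        + 2 * leafJac d y * hamD d (conn₁ d a b) (conn₂ d b c) (normalJac d y) k)
        + t σ' * hamD d (conn₁ d a b) (conn₂ d b c) (t S') k := by
    intro k
    rw [e1, hσ]
    linear_combination (t σ' * hamD d (conn₁ d a b) (conn₂ d b c) (t S') k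
        * (leafJac d y * normalJac d y + 1)
        + 2 * leafJac d y * hamD d (conn₁ d a b) (conn₂ d b c) (normalJac d y) k
          * (t S' * t σ')) * hΔ
      + 2 * leafJac d y * hamD d (conn₁ d a b) (conn₂ d b c) (normalJac d y) k * h1'
  -- The extra term that `S = Δ² S'` contributes, a Hamiltonian field of `Δ`, exactly absorbs the
  -- gauge term `-2 d log Δ` of the connection form.
  have e3 : IsPush d t y
      (fun k => connField d (conn₁ d a b) (conn₂ d b c) k
        + 2 * leafJac d y * hamD d (conn₁ d a b) (conn₂ d b c) (normalJac d y) k)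
      (connField d' (conn₁ d' a' b') (conn₂ d' b' c')) := by
    obtain ⟨x0, z0⟩ := H.curv_eq 0 (Or.inl rfl)
    obtain ⟨x1, z1⟩ := H.curv_eq 1 (Or.inr rfl)
    obtain ⟨l1, l2, l3, l4⟩ := H.leaf
    obtain ⟨p1, p2, p3, p4⟩ := H.leaf_eq
    have w1 := H.conn₁_eq
    have w2 := H.conn₂_eq
    intro k
    have key : ∀ L N : A, N = leafJac d y ^ 2 * normalJac d y ^ 2 * L → L = N := fun L N hN => by
      rw [hN]
      linear_combination - L * (leafJac d y * normalJac d y + 1) * hΔ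
    refine key _ _ ?_
    simp only [Fin.sum_univ_four, hamD, connField, j0, j1]
    generalize ha : d 2 (normalJac d y) = Δ₂ at *
    generalize hb : d 3 (normalJac d y) = Δ₃ at *
    generalize leafJac d y = E at *
    simp only [x0, z0, x1, z1]
    rw [w1, w2]
    simp only [normalJac]
    fin_cases k <;> simp [p1, p2, p3, p4, l1, l2, l3, l4] <;> ring
  intro k
  rw [map_add, e3 k, map_mul, H.isPush_hamD S' k, Finset.mul_sum, ← Finset.sum_add_distrib]
  refine Finset.sum_congr rfl fun l _ => ?_
  simp only [e2]; ring
/-- Invariance of the normal trace where the field does not twist. -/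
theorem normalTrace_eq (H : WalkerTrans d d' t y a b c a' b' c') {X : Fin 4 → A}
    {X' : Fin 4 → A'} (hX : IsPush d t y X X') {r : A}
    (l1 : d 0 (X 2) = 0) (l2 : d 0 (X 3) = - d 1 (X 2)) (l3 : d 1 (X 3) = 0)
    (hr : d 1 (X 2) * r = 0) :
    t (normalTrace d' (conn₁ d' a' b') (conn₂ d' b' c') X') * r
      = normalTrace d (conn₁ d a b) (conn₂ d b c) X * r := by
  obtain ⟨k1, k2, k3, k4⟩ := H.leaf
  obtain ⟨m1, m2, m3, m4⟩ := H.leaf_transverse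
  obtain ⟨q1, q2, q3, q4⟩ := H.dual'
  obtain ⟨h1, h2, h3, h4⟩ := H.dual
  obtain ⟨p1, p2, p3, p4⟩ := H.leaf_eq
  have x2 := hX 2
  have x3 := hX 3
  simp only [Fin.sum_univ_four, k1, k2, k3, k4, mul_zero, zero_add] at x2 x3
  -- The new transverse components are combinations of the old ones with coefficients that are
  -- constant along the leaves; their leafwise derivatives are multiples of the twist, hence killed
  -- by `r`.
  have leafwise : ∀ (z : A') (u v : A), t z = X 2 * u + X 3 * v →
      (d 0 u = 0 ∧ d 1 u = 0) → (d 0 v = 0 ∧ d 1 v = 0) →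
      t (d' 0 z) * r = 0 ∧ t (d' 1 z) * r = 0 := by
    intro z u v hz hu hv
    obtain ⟨c0, c1⟩ := H.chain_leaf z
    rw [hz] at c0 c1
    simp only [map_add, Derivation.leibniz, smul_eq_mul, hu.1, hu.2, hv.1, hv.2, l1, l2, l3]
      at c0 c1
    have c0' : (t (d' 0 z) * r) * d 0 (y 0) + (t (d' 1 z) * r) * d 0 (y 1) = 0 := by
      linear_combination -r * c0 - v * hr
    have c1' : (t (d' 0 z) * r) * d 1 (y 0) + (t (d' 1 z) * r) * d 1 (y 1) = 0 := by
      linear_combination -r * c1 + u * hr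
    constructor
    · linear_combination d 2 (y 2) * c0' + d 3 (y 2) * c1' - t (d' 0 z) * r * q1
        - t (d' 1 z) * r * q2
    · linear_combination d 2 (y 3) * c0' + d 3 (y 3) * c1' - t (d' 0 z) * r * q3
        - t (d' 1 z) * r * q4
  obtain ⟨u0, u1⟩ := leafwise _ _ _ x2 ⟨m1 2, m3 2⟩ ⟨m1 3, m3 3⟩
  obtain ⟨v0, v1⟩ := leafwise _ _ _ x3 ⟨m2 2, m4 2⟩ ⟨m2 3, m4 3⟩
  have c1 := H.chain 2 (X' 2)
  have c2 := H.chain 3 (X' 2)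
  have c3 := H.chain 2 (X' 3)
  have c4 := H.chain 3 (X' 3)
  rw [x2] at c1 c2
  rw [x3] at c3 c4
  have w1 := H.conn₁_eq
  have w2 := H.conn₂_eq
  simp only [Fin.sum_univ_four, map_add, Derivation.leibniz, smul_eq_mul] at c1 c2 c3 c4
  simp only [normalTrace, map_sub, map_mul, map_add, map_ofNat]
  rw [w1, w2, x2, x3]
  simp only [normalJac, map_sub, Derivation.leibniz, smul_eq_mul, H.comm 3 2] at c2 c4 ⊢
  linear_combination 2 * r * (- (d 0 (y 0) * c1 + d 1 (y 0) * c2 + d 0 (y 1) * c3 + d 1 (y 1) * c4)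
      - t (d' 2 (X' 2)) * q1 - t (d' 3 (X' 2)) * q3 - t (d' 2 (X' 3)) * q2 - t (d' 3 (X' 3)) * q4
      + d 2 (X 2) * h1 + d 2 (X 3) * h2 + d 3 (X 2) * h3 + d 3 (X 3) * h4
      + X 2 * (d 2 (d 2 (y 2)) * p1 + d 2 (d 3 (y 2)) * p3 + d 2 (d 2 (y 3)) * p2
        + d 2 (d 3 (y 3)) * p4)
      + X 3 * (d 2 (d 3 (y 2)) * p1 + d 3 (d 3 (y 2)) * p3 + d 2 (d 3 (y 3)) * p2
        + d 3 (d 3 (y 3)) * p4))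
    - 2 * (u0 * (d 2 (y 0) * d 0 (y 0) + d 3 (y 0) * d 1 (y 0))
      + u1 * (d 2 (y 1) * d 0 (y 0) + d 3 (y 1) * d 1 (y 0))
      + v0 * (d 2 (y 0) * d 0 (y 1) + d 3 (y 0) * d 1 (y 1))
      + v1 * (d 2 (y 1) * d 0 (y 1) + d 3 (y 1) * d 1 (y 1)))

end WalkerTrans

end Algebra

/-! ### Charts: transformation of vector fields and of the metric -/

section Charts

variable {M : Type*} [TopologicalSpace M] [ChartedSpace E4 M]

/-- The domain of the coordinates of a chart. -/
def tgt (e : OpenPartialHomeomorph M E4) : Opens E4 := ⟨e.target, e.open_target⟩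

/-- The part of the coordinate domain of `e` where also `e'` is defined. -/
def ovl (e e' : OpenPartialHomeomorph M E4) : Opens E4 :=
  ⟨(e.symm.trans e').source, (e.symm.trans e').open_source⟩

/-- The coordinate change from `e` to `e'`. -/
def coordChange (e e' : OpenPartialHomeomorph M E4) (x : E4) : E4 := e' (e.symm x)

theorem mem_ovl {e e' : OpenPartialHomeomorph M E4} {x : E4} :
    x ∈ ovl e e' ↔ x ∈ e.target ∧ e.symm x ∈ e'.source := by
  change x ∈ (e.symm.trans e').source ↔ _
  simp
variable {e e' : OpenPartialHomeomorph M E4}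

theorem ovl_le {x : E4} (hx : x ∈ ovl e e') : x ∈ tgt e := (mem_ovl.1 hx).1

theorem coordChange_mem {x : E4} (hx : x ∈ ovl e e') : coordChange e e' x ∈ tgt e' :=
  e'.map_source (mem_ovl.1 hx).2

theorem symm_coordChange {x : E4} (hx : x ∈ ovl e e') :
    e'.symm (coordChange e e' x) = e.symm x :=
  e'.left_inv (mem_ovl.1 hx).2

theorem coordChange_mem_ovl {x : E4} (hx : x ∈ ovl e e') : coordChange e e' x ∈ ovl e' e := by
  refine mem_ovl.2 ⟨coordChange_mem hx, ?_⟩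
  rw [symm_coordChange hx]
  exact e.map_target (mem_ovl.1 hx).1

theorem coordChange_coordChange {x : E4} (hx : x ∈ ovl e e') :
    coordChange e' e (coordChange e e' x) = x := by
  rw [coordChange, symm_coordChange hx, e.right_inv (mem_ovl.1 hx).1]

/-- The derivative of a chart, with all tangent spaces identified with the model space. -/
def chartD (e : OpenPartialHomeomorph M E4) (p : M) : E4 →L[ℝ] E4 :=
  mfderiv (𝓡 4) (𝓡 4) e p

/-- The derivative of the inverse of a chart. -/
def symmD (e : OpenPartialHomeomorph M E4) (x : E4) : E4 →L[ℝ] E4 :=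
  mfderiv (𝓡 4) (𝓡 4) e.symm x

theorem components_eq (X : ∀ p : M, TangentSpace (𝓡 4) p) (x : E4) :
    components X e x = chartD e (e.symm x) (X (e.symm x)) := rfl

variable [IsManifold (𝓡 4) ∞ M]

theorem mdiff_chart (he : e ∈ IsManifold.maximalAtlas (𝓡 4) ∞ M) {p : M} (hp : p ∈ e.source) :
    MDifferentiableAt (𝓡 4) (𝓡 4) e p :=
  (contMDiffAt_of_mem_maximalAtlas he hp).mdifferentiableAt (by simp)

theorem mdiff_symm (he : e ∈ IsManifold.maximalAtlas (𝓡 4) ∞ M) {x : E4} (hx : x ∈ e.target) :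
    MDifferentiableAt (𝓡 4) (𝓡 4) e.symm x :=
  (contMDiffAt_symm_of_mem_maximalAtlas he hx).mdifferentiableAt (by simp)

theorem contDiffOn_coordChange (he : e ∈ IsManifold.maximalAtlas (𝓡 4) ∞ M)
    (he' : e' ∈ IsManifold.maximalAtlas (𝓡 4) ∞ M) :
    ContDiffOn ℝ ∞ (coordChange e e') (ovl e e') := by
  rw [← contMDiffOn_iff_contDiffOn]
  exact (contMDiffOn_of_mem_maximalAtlas he').comp
    ((contMDiffOn_symm_of_mem_maximalAtlas he).mono fun x hx => ovl_le hx)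
    fun x hx => (mem_ovl.1 hx).2

theorem symmD_comp (he : e ∈ IsManifold.maximalAtlas (𝓡 4) ∞ M)
    (he' : e' ∈ IsManifold.maximalAtlas (𝓡 4) ∞ M) {x : E4} (hx : x ∈ ovl e e') :
    symmD e x = (symmD e' (coordChange e e' x)).comp (fderiv ℝ (coordChange e e') x) := by
  have h1 : (fun z => e.symm z) =ᶠ[nhds x] fun z => e'.symm (coordChange e e' z) := by
    filter_upwards [(ovl e e').isOpen.mem_nhds hx] with z hz
    rw [symm_coordChange hz]
  have h2 : MDifferentiableAt (𝓡 4) (𝓡 4) (coordChange e e') x :=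
    ((contDiffOn_coordChange he he').differentiableAt_open hx).mdifferentiableAt
  have h3 := mfderiv_comp x (I := 𝓡 4) (I' := 𝓡 4) (I'' := 𝓡 4) (f := coordChange e e')
    (g := e'.symm) (mdiff_symm he' (coordChange_mem hx)) h2
  unfold symmD
  rw [Filter.EventuallyEq.mfderiv_eq h1]
  refine h3.trans ?_
  rw [mfderiv_eq_fderiv]
  rfl

theorem chartD_comp (he : e ∈ IsManifold.maximalAtlas (𝓡 4) ∞ M)
    (he' : e' ∈ IsManifold.maximalAtlas (𝓡 4) ∞ M) {x : E4} (hx : x ∈ ovl e e') :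
    chartD e' (e.symm x) = (fderiv ℝ (coordChange e e') x).comp (chartD e (e.symm x)) := by
  have hs : e.symm x ∈ e.source := e.map_target (ovl_le hx)
  have h1 : (fun p => e' p) =ᶠ[nhds (e.symm x)] fun p => coordChange e e' (e p) := by
    filter_upwards [e.open_source.mem_nhds hs] with p hp
    rw [coordChange, e.left_inv hp]
  have hex : e (e.symm x) = x := e.right_inv (ovl_le hx)
  have h2 : MDifferentiableAt (𝓡 4) (𝓡 4) (coordChange e e') (e (e.symm x)) := by
    rw [hex]
    exact ((contDiffOn_coordChange he he').differentiableAt_open hx).mdifferentiableAt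
  have h3 := mfderiv_comp (e.symm x) (I := 𝓡 4) (I' := 𝓡 4) (I'' := 𝓡 4) (f := e)
    (g := coordChange e e') h2 (mdiff_chart he hs)
  unfold chartD
  rw [Filter.EventuallyEq.mfderiv_eq h1]
  refine h3.trans ?_
  rw [mfderiv_eq_fderiv, hex]
  rfl

theorem symmD_chartD (he : e ∈ IsManifold.maximalAtlas (𝓡 4) ∞ M) {x : E4} (hx : x ∈ e.target)
    (v : E4) : symmD e x (chartD e (e.symm x) v) = v := by
  have hs : e.symm x ∈ e.source := e.map_target hx
  have h1 : (fun p => e.symm (e p)) =ᶠ[nhds (e.symm x)] id := by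
    filter_upwards [e.open_source.mem_nhds hs] with p hp
    exact e.left_inv hp
  have hex : e (e.symm x) = x := e.right_inv hx
  have h3 := mfderiv_comp (e.symm x) (I := 𝓡 4) (I' := 𝓡 4) (I'' := 𝓡 4) (f := e)
    (g := e.symm) (by rw [hex]; exact mdiff_symm he hx) (mdiff_chart he hs)
  have h4 : (mfderiv (𝓡 4) (𝓡 4) (fun p => e.symm (e p)) (e.symm x) v : E4) = v :=
    DFunLike.congr_fun (h1.mfderiv_eq.trans mfderiv_id) v
  have h5 : symmD e (e (e.symm x)) (chartD e (e.symm x) v) = v :=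
    (DFunLike.congr_fun h3 v).symm.trans h4
  rwa [hex] at h5

/-- The transformation of the components of a vector field. -/
theorem components_coordChange (he : e ∈ IsManifold.maximalAtlas (𝓡 4) ∞ M)
    (he' : e' ∈ IsManifold.maximalAtlas (𝓡 4) ∞ M) (X : ∀ p : M, TangentSpace (𝓡 4) p)
    {x : E4} (hx : x ∈ ovl e e') :
    components X e' (coordChange e e' x) = fderiv ℝ (coordChange e e') x (components X e x) := by
  have : components X e' (coordChange e e' x) = chartD e' (e.symm x) (X (e.symm x)) := by
    rw [components_eq]
    have h := symm_coordChange hx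
    exact congrArg (fun p => chartD e' p (X p)) h
  rw [this, chartD_comp he he' hx]; rfl

/-- The metric with all tangent spaces identified with the model space. -/
def valE (g : PseudoMetric M) (p : M) : E4 →L[ℝ] E4 →L[ℝ] ℝ := g.val p

theorem gram_eq (g : PseudoMetric M) (x : E4) (i j : Fin 4) :
    gram g e x i j = valE g (e.symm x) (symmD e x (stdBasis i)) (symmD e x (stdBasis j)) := rfl

theorem fderiv_stdBasis {τ : E4 → E4} {x : E4} (hτ : DifferentiableAt ℝ τ x) (k l : Fin 4) :
    fderiv ℝ τ x (stdBasis k) l = pderiv k (fun y => τ y l) x := by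
  have : HasFDerivAt (fun y => τ y l)
      ((EuclideanSpace.proj (𝕜 := ℝ) l).comp (fderiv ℝ τ x)) x :=
    (EuclideanSpace.proj (𝕜 := ℝ) l).hasFDerivAt.comp x hτ.hasFDerivAt
  unfold pderiv; rw [this.fderiv]; rfl

theorem clm_apply_eq_sum (L : E4 →L[ℝ] E4) (v : E4) : L v = ∑ l, v l • L (stdBasis l) := by
  conv_lhs => rw [sum_stdBasis v, map_sum]
  simp

/-- The transformation of the components of the metric. -/
theorem gram_coordChange (he : e ∈ IsManifold.maximalAtlas (𝓡 4) ∞ M)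
    (he' : e' ∈ IsManifold.maximalAtlas (𝓡 4) ∞ M) (g : PseudoMetric M) {x : E4}
    (hx : x ∈ ovl e e') (i j : Fin 4) :
    gram g e x i j = ∑ k, ∑ l, pderiv i (fun y => coordChange e e' y k) x
      * pderiv j (fun y => coordChange e e' y l) x * gram g e' (coordChange e e' x) k l := by
  have hd := (contDiffOn_coordChange he he').differentiableAt_open hx
  simp only [gram_eq, symm_coordChange hx]
  rw [symmD_comp he he' hx, ContinuousLinearMap.comp_apply, ContinuousLinearMap.comp_apply,
    clm_apply_eq_sum (symmD e' _) (fderiv ℝ _ x (stdBasis i)),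
    clm_apply_eq_sum (symmD e' _) (fderiv ℝ _ x (stdBasis j))]
  simp only [map_sum, sum_apply, map_smul, smul_apply,
    smul_eq_mul, fderiv_stdBasis hd, Finset.mul_sum]
  rw [Finset.sum_comm]
  exact Finset.sum_congr rfl fun k _ => Finset.sum_congr rfl fun l _ => by ring

theorem contDiffOn_components {Y : ∀ p : M, TangentSpace (𝓡 4) p} (hY : IsSmoothField Y)
    (he : e ∈ IsManifold.maximalAtlas (𝓡 4) ∞ M) :
    ContDiffOn ℝ ∞ (components Y e) e.target := by
  rw [← contMDiffOn_iff_contDiffOn]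
  have h1 : ContMDiffOn (𝓡 4).tangent (𝓡 4).tangent ∞ (tangentMapWithin (𝓡 4) (𝓡 4) e e.source)
      (Bundle.TotalSpace.proj ⁻¹' e.source) :=
    (contMDiffOn_of_mem_maximalAtlas he).contMDiffOn_tangentMapWithin (by simp)
      e.open_source.uniqueMDiffOn
  have h2 : ContMDiffOn (𝓡 4) (𝓡 4).tangent ∞
      (fun x => (⟨e.symm x, Y (e.symm x)⟩ : TangentBundle (𝓡 4) M)) e.target :=
    hY.comp_contMDiffOn (contMDiffOn_symm_of_mem_maximalAtlas he)
  have h3 := h1.comp h2 fun x hx => e.map_target hx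
  have h4 := (contMDiff_snd_tangentBundle_modelSpace (n := ∞) E4 (𝓡 4)).comp_contMDiffOn h3
  refine h4.congr fun x hx => ?_
  simp only [Function.comp, tangentMapWithin, components]
  rw [mfderivWithin_of_isOpen e.open_source (e.map_target hx)]

/-- The components of the gradient solve the linear system given by the metric. -/
theorem gram_components_gradient (g : PseudoMetric M) {f : M → ℝ}
    (hf : ContMDiff (𝓡 4) 𝓘(ℝ, ℝ) ∞ f) (he : e ∈ IsManifold.maximalAtlas (𝓡 4) ∞ M) {x : E4}
    (hx : x ∈ e.target) (i : Fin 4) :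
    ∑ k, gram g e x k i * components (gradient g f) e x k = pderiv i (fun z => f (e.symm z)) x := by
  have h1 := val_gradient g f (e.symm x) (coordField e i x)
  have h2 : (mfderiv (𝓡 4) 𝓘(ℝ, ℝ) f (e.symm x) (coordField e i x) : ℝ)
      = pderiv i (fun z => f (e.symm z)) x := by
    have h3 := mfderiv_comp x (I := 𝓡 4) (I' := 𝓡 4) (I'' := 𝓘(ℝ, ℝ)) (f := e.symm)
      (g := f) (hf.mdifferentiableAt (by simp)) (mdiff_symm he hx)
    have h4 := DFunLike.congr_fun h3 (stdBasis i)
    rw [mfderiv_eq_fderiv] at h4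
    exact h4.symm
  rw [← h2, ← h1]
  have h5 : gradient g f (e.symm x) = symmD e x (components (gradient g f) e x) := by
    exact (symmD_chartD he hx _).symm
  have h6 : g.val (e.symm x) (gradient g f (e.symm x)) (coordField e i x)
      = valE g (e.symm x) (symmD e x (components (gradient g f) e x))
        (symmD e x (stdBasis i)) := by
    rw [← h5]; rfl
  rw [h6, clm_apply_eq_sum]
  simp only [map_sum, sum_apply, map_smul, smul_apply,
    smul_eq_mul, gram_eq]
  exact Finset.sum_congr rfl fun k _ => by ring

end Charts

/-! ### Restriction -/

theorem evS_dS_of_eq {U : Opens E4} {φ : E4 → ℝ} {a : SmoothFun U}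
    (h : ∀ x (hx : x ∈ U), φ x = evS ⟨x, hx⟩ a) (k : Fin 4) (x : U) :
    pderiv k φ x = evS x (dS k a) := by
  rw [evS_dS]
  exact pderiv_congr_on (fun y hy => (h y hy).trans (extS_apply a ⟨y, hy⟩).symm) k x.2

/-- Restriction of smooth functions to a smaller open set. -/
def resS {U V : Opens E4} (h : ∀ x ∈ U, x ∈ V) : SmoothFun V →+* SmoothFun U :=
  pullS id contDiffOn_id h

theorem evS_resS {U V : Opens E4} (h : ∀ x ∈ U, x ∈ V) (a : SmoothFun V) (x : U) :
    evS x (resS h a) = evS ⟨x, h x x.2⟩ a :=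
  evS_pullS id contDiffOn_id h a x

theorem resS_mkS {U V : Opens E4} (h : ∀ x ∈ U, x ∈ V) (φ : E4 → ℝ) (hφ : ContDiffOn ℝ ∞ φ V) :
    resS h (mkS φ hφ) = mkS φ (hφ.mono h) :=
  SmoothFun.ext_ev fun x => by rw [evS_resS]; rfl

theorem resS_dS {U V : Opens E4} (h : ∀ x ∈ U, x ∈ V) (k : Fin 4) (a : SmoothFun V) :
    resS h (dS k a) = dS k (resS h a) :=
  SmoothFun.ext_ev fun x => by
    rw [evS_resS, evS_dS]
    refine evS_dS_of_eq (fun y hy => ?_) k x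
    rw [evS_resS, evS_apply, ← extS_apply]

theorem evS_continuous {U : Opens E4} (a : SmoothFun U) : Continuous fun x : U => evS x a := by
  have := (extS_contDiffOn a).continuousOn.restrict
  exact this.congr fun x => extS_apply a x

/-- A constant function. -/
def constS {U : Opens E4} (r : ℝ) : SmoothFun U := algebraMap ℝ (SmoothFun U) r

@[simp] theorem evS_constS {U : Opens E4} (x : U) (r : ℝ) : evS x (constS r) = r := by
  simp [constS]

@[simp] theorem dS_constS {U : Opens E4} (k : Fin 4) (r : ℝ) :
    dS k (constS r : SmoothFun U) = 0 := (dS k).map_algebraMap r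

/-! ### Homomorphisms of differential rings -/

section Hom

variable {A B : Type*} [CommRing A] [Algebra ℝ A] [CommRing B] [Algebra ℝ B]
variable {d : Fin 4 → Derivation ℝ A A} {d' : Fin 4 → Derivation ℝ B B} {r : A →+* B}

theorem map_conn₁ (h : ∀ k x, r (d k x) = d' k (r x)) (a b : A) :
    r (conn₁ d a b) = conn₁ d' (r a) (r b) := by simp [conn₁, h]

theorem map_conn₂ (h : ∀ k x, r (d k x) = d' k (r x)) (b c : A) :
    r (conn₂ d b c) = conn₂ d' (r b) (r c) := by simp [conn₂, h]

theorem map_scalD (h : ∀ k x, r (d k x) = d' k (r x)) (a b c : A) :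
    r (scalD d a b c) = scalD d' (r a) (r b) (r c) := by
  simp [scalD, h, map_conn₁ h, map_conn₂ h]

theorem map_detD (h : ∀ k x, r (d k x) = d' k (r x)) (a b c : A) :
    r (detD d a b c) = detD d' (r a) (r b) (r c) := by
  simp [detD, h, map_conn₁ h, map_conn₂ h]

theorem map_dirD (h : ∀ k x, r (d k x) = d' k (r x)) (X : Fin 4 → A) (f : A) :
    r (dirD d X f) = dirD d' (fun k => r (X k)) (r f) := by
  simp [dirD, h]
theorem map_lapD (h : ∀ k x, r (d k x) = d' k (r x)) (a b c f : A) :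
    r (lapD d a b c f) = lapD d' (r a) (r b) (r c) (r f) := by
  simp only [lapD, h, map_add, map_sub, map_mul, map_ofNat]

theorem map_hamD (h : ∀ k x, r (d k x) = d' k (r x)) (w₁ w₂ f : A) (k : Fin 4) :
    r (hamD d w₁ w₂ f k) = hamD d' (r w₁) (r w₂) (r f) k := by
  fin_cases k <;> simp [hamD, h]

theorem map_connField (h : ∀ k x, r (d k x) = d' k (r x)) (w₁ w₂ : A) (k : Fin 4) :
    r (connField d w₁ w₂ k) = connField d' (r w₁) (r w₂) k := by
  fin_cases k <;> simp [connField, h]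
theorem map_normalTrace (h : ∀ k x, r (d k x) = d' k (r x)) (w₁ w₂ : A) (X : Fin 4 → A) :
    r (normalTrace d w₁ w₂ X) = normalTrace d' (r w₁) (r w₂) (fun k => r (X k)) := by
  simp only [normalTrace, h, map_add, map_sub, map_mul, map_ofNat]

end Hom

/-! ### Coordinate expressions of the curvature as elements of the ring of smooth functions -/

section Coordinates

variable {U : Opens E4} {G : E4 → Matrix (Fin 4) (Fin 4) ℝ} {gS giS : Fin 4 → Fin 4 → SmoothFun U}

theorem christoffel_eq (hg : ∀ i j x (hx : x ∈ U), G x i j = evS ⟨x, hx⟩ (gS i j))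
    (hgi : ∀ i j x (hx : x ∈ U), (G x)⁻¹ i j = evS ⟨x, hx⟩ (giS i j)) (k i j : Fin 4) (x : E4)
    (hx : x ∈ U) : christoffel G k i j x = evS ⟨x, hx⟩ (chrD (dS (U := U)) gS giS k i j) := by
  simp only [christoffel, chrD, map_smul, map_sum, map_mul, map_add, map_sub, smul_eq_mul,
    ← hgi _ _ x hx]
  congr 1
  refine Finset.sum_congr rfl fun l _ => ?_
  rw [evS_dS_of_eq (hg i l) j ⟨x, hx⟩, evS_dS_of_eq (hg j l) i ⟨x, hx⟩,
    evS_dS_of_eq (hg i j) l ⟨x, hx⟩]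

theorem ricci_eq (hg : ∀ i j x (hx : x ∈ U), G x i j = evS ⟨x, hx⟩ (gS i j))
    (hgi : ∀ i j x (hx : x ∈ U), (G x)⁻¹ i j = evS ⟨x, hx⟩ (giS i j)) (i j : Fin 4) (x : U) :
    ricci G i j x = evS x (ricD (dS (U := U)) gS giS i j) := by
  have h1 : ∀ k i j, christoffel G k i j x = evS x (chrD (dS (U := U)) gS giS k i j) := fun k i j =>
    christoffel_eq hg hgi k i j x x.2
  have h2 : ∀ l k i j, pderiv l (christoffel G k i j) x =
      evS x (dS l (chrD (dS (U := U)) gS giS k i j)) :=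
    fun l k i j => evS_dS_of_eq (christoffel_eq hg hgi k i j) l x
  simp only [ricci, ricD, map_sum, map_mul, map_add, map_sub, h1, h2]

theorem lieMetric_eq (hg : ∀ i j x (hx : x ∈ U), G x i j = evS ⟨x, hx⟩ (gS i j))
    {X : E4 → E4} {XS : Fin 4 → SmoothFun U}
    (hX : ∀ k x (hx : x ∈ U), X x k = evS ⟨x, hx⟩ (XS k)) (i j : Fin 4) (x : U) :
    lieMetric G X i j x = evS x (lieD (dS (U := U)) gS XS i j) := by
  have h1 : ∀ l i j, pderiv l (fun z => G z i j) x = evS x (dS l (gS i j)) := fun l i j =>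
    evS_dS_of_eq (hg i j) l x
  have h2 : ∀ l k, pderiv l (fun z => X z k) x = evS x (dS l (XS k)) := fun l k =>
    evS_dS_of_eq (hX k) l x
  simp only [lieMetric, lieD, map_sum, map_mul, map_add, h1, h2, hX _ x x.2, hg _ _ x x.2]

end Coordinates

theorem walkerMatrix_inv (a b c : ℝ) : (walkerMatrix a b c)⁻¹ =
    !![-a, -b, 1, 0; -b, -c, 0, 1; 1, 0, 0, 0; 0, 1, 0, 0] := by
  refine Matrix.inv_eq_right_inv ?_
  ext i j
  fin_cases i <;> fin_cases j <;>
    simp [walkerMatrix, Matrix.mul_apply, Fin.sum_univ_four]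

theorem walkerMatrix_det (a b c : ℝ) : (walkerMatrix a b c).det = 1 := by
  simp [walkerMatrix, Matrix.det_succ_row_zero, Fin.sum_univ_succ, Fin.succAbove]

theorem scalar_walker {A : Type*} [CommRing A] [Algebra ℝ A] (d : Fin 4 → Derivation ℝ A A)
    (hd : ∀ i j a, d i (d j a) = d j (d i a)) (a b c : A) :
    ∑ i, ∑ j, walkerInvD a b c i j * ricD d (walkerD a b c) (walkerInvD a b c) i j
      = scalD d a b c := by
  obtain ⟨r00, r01, r10, r11⟩ := ricD_walker_leaf d a b c
  obtain ⟨r02, r03, r12, r13⟩ := ricD_walker_mixed d hd a b c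
  obtain ⟨r20, r30, r21, r31⟩ := ricD_walker_mixed' d hd a b c
  simp only [Fin.sum_univ_four, r00, r01, r10, r11, r02, r13, r20, r31, scalD, conn₁, conn₂]
  simp only [walkerInvD, Matrix.of_apply, Matrix.cons_val', Matrix.cons_val, mul_zero, zero_mul,
    one_mul, add_zero, zero_add, map_add]
  linear_combination two_smul_half (d 0 (d 0 a) + d 0 (d 1 b))
    + two_smul_half (d 1 (d 0 b) + d 1 (d 1 c))

/-! ### Walker charts -/

section Charts

variable {M : Type*} [TopologicalSpace M] [ChartedSpace E4 M] [IsManifold (𝓡 4) ∞ M]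

/-- A chart in which the metric has the Walker form. -/
structure WalkerChart (g : PseudoMetric M) (D : ∀ p : M, Submodule ℝ (TangentSpace (𝓡 4) p)) where
  e : OpenPartialHomeomorph M E4
  mem : e ∈ IsManifold.maximalAtlas (𝓡 4) ∞ M
  a : E4 → ℝ
  b : E4 → ℝ
  c : E4 → ℝ
  ha : ContDiffOn ℝ ∞ a e.target
  hb : ContDiffOn ℝ ∞ b e.target
  hc : ContDiffOn ℝ ∞ c e.target
  gram_eq : ∀ x ∈ e.target, gram g e x = walkerMatrix (a x) (b x) (c x)
  span_eq : ∀ x ∈ e.target, D (e.symm x) = Submodule.span ℝ {coordField e 0 x, coordField e 1 x}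

variable {g : PseudoMetric M} {D : ∀ p : M, Submodule ℝ (TangentSpace (𝓡 4) p)}

namespace WalkerChart

variable (K : WalkerChart g D) {U : Opens E4} (hU : ∀ x ∈ U, x ∈ tgt K.e)

/-- The function `f₁` of a Walker chart. -/
def aS : SmoothFun U := mkS K.a (K.ha.mono hU)

/-- The function `f₂` of a Walker chart. -/
def bS : SmoothFun U := mkS K.b (K.hb.mono hU)

/-- The function `f₃` of a Walker chart. -/
def cS : SmoothFun U := mkS K.c (K.hc.mono hU)

theorem gram_ev (i j : Fin 4) (x : E4) (hx : x ∈ U) :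
    gram g K.e x i j = evS ⟨x, hx⟩ (walkerD (K.aS hU) (K.bS hU) (K.cS hU) i j) := by
  rw [K.gram_eq x (hU x hx)]
  fin_cases i <;> fin_cases j <;> simp [walkerMatrix, walkerD, aS, bS, cS]

theorem gram_inv_ev (i j : Fin 4) (x : E4) (hx : x ∈ U) :
    (gram g K.e x)⁻¹ i j = evS ⟨x, hx⟩ (walkerInvD (K.aS hU) (K.bS hU) (K.cS hU) i j) := by
  rw [K.gram_eq x (hU x hx), walkerMatrix_inv]
  fin_cases i <;> fin_cases j <;> simp [walkerInvD, aS, bS, cS]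

theorem ricci_ev (i j : Fin 4) (x : U) : ricci (gram g K.e) i j x = evS x (ricD (dS (U := U))
      (walkerD (K.aS hU) (K.bS hU) (K.cS hU)) (walkerInvD (K.aS hU) (K.bS hU) (K.cS hU)) i j) :=
  ricci_eq (U := U) (G := gram g K.e) (gS := walkerD (K.aS hU) (K.bS hU) (K.cS hU))
    (giS := walkerInvD (K.aS hU) (K.bS hU) (K.cS hU)) (fun i j x hx => K.gram_ev hU i j x hx)
    (fun i j x hx => K.gram_inv_ev hU i j x hx) i j x

/-- The scalar curvature in a Walker chart. -/
def scalS : SmoothFun U := scalD (dS (U := U)) (K.aS hU) (K.bS hU) (K.cS hU)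

theorem scalar_ev (x : E4) (hx : x ∈ U) : scalar (gram g K.e) x = evS ⟨x, hx⟩ (K.scalS hU) := by
  have h1 : ∀ i j, ricci (gram g K.e) i j x = evS ⟨x, hx⟩ (ricD (dS (U := U))
      (walkerD (K.aS hU) (K.bS hU) (K.cS hU)) (walkerInvD (K.aS hU) (K.bS hU) (K.cS hU)) i j) :=
    fun i j => K.ricci_ev hU i j ⟨x, hx⟩
  have h2 : scalar (gram g K.e) x = evS ⟨x, hx⟩ (∑ i, ∑ j,
      walkerInvD (K.aS hU) (K.bS hU) (K.cS hU) i j * ricD (dS (U := U))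
      (walkerD (K.aS hU) (K.bS hU) (K.cS hU)) (walkerInvD (K.aS hU) (K.bS hU) (K.cS hU)) i j) := by
    simp only [scalar, h1, K.gram_inv_ev hU _ _ x hx, map_sum, map_mul]
  exact h2.trans (congrArg (evS ⟨x, hx⟩) (scalar_walker (dS (U := U)) dS_comm _ _ _))

/-- The conformal factor of the soliton equation. -/
def factorS (lam β₂ : ℝ) : SmoothFun U := constS β₂ * K.scalS hU - 2 * constS lam

variable {X : ∀ p : M, TangentSpace (𝓡 4) p}

/-- The components of a vector field that is smooth in the chart. -/
def compS (hX : ContDiffOn ℝ ∞ (components X K.e) K.e.target) (k : Fin 4) : SmoothFun U :=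
  mkS (fun x => components X K.e x k) (contDiffOn_coord (hX.mono hU) k)

variable (hX : ContDiffOn ℝ ∞ (components X K.e) K.e.target)

theorem lieMetric_ev (i j : Fin 4) (x : U) : lieMetric (gram g K.e) (components X K.e) i j x =
    evS x (lieD (dS (U := U)) (walkerD (K.aS hU) (K.bS hU) (K.cS hU)) (K.compS hU hX) i j) :=
  lieMetric_eq (U := U) (G := gram g K.e) (gS := walkerD (K.aS hU) (K.bS hU) (K.cS hU))
    (X := components X K.e) (XS := K.compS hU hX) (fun i j x hx => K.gram_ev hU i j x hx)
    (fun _ _ _ => rfl) i j x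

/-- Transfers the pointwise soliton equation in one Walker chart to an identity in the ring of
smooth functions, where the algebraic lemmas apply. -/
theorem isSolD {β₁ lam β₂ : ℝ} (hsol : IsRicciYamabeSoliton g X β₁ lam β₂) :
    IsSolD (dS (U := U)) (K.aS hU) (K.bS hU) (K.cS hU) (K.compS hU hX) (constS β₁)
      (K.factorS hU lam β₂) := by
  intro i j
  refine SmoothFun.ext_ev fun x => ?_
  have h := hsol K.e K.mem x (hU x x.2) i j
  rw [K.ricci_ev hU i j x, K.lieMetric_ev hU hX i j x, K.scalar_ev hU x x.2, K.gram_ev hU i j x x.2] at h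
  simpa only [factorS, map_add, map_mul, map_sub, map_ofNat, evS_constS] using h

theorem divD_compS {β₁ lam β₂ : ℝ} (hsol : IsRicciYamabeSoliton g X β₁ lam β₂) :
    divD (dS (U := U)) (K.compS hU hX) = 2 * K.factorS hU lam β₂ - constS β₁ * K.scalS hU :=
  (K.isSolD hU hX hsol).divD_eq dS_comm

theorem basic {β₁ lam β₂ : ℝ} (hsol : IsRicciYamabeSoliton g X β₁ lam β₂) :
    (dS (U := U) 0 (K.factorS hU lam β₂) = 0 ∧ dS 1 (K.factorS hU lam β₂) = 0) ∧
    (dS (U := U) 1 (K.compS hU hX 2) * dS (U := U) 0 (conn₁ (dS (U := U)) (K.aS hU) (K.bS hU)) = 0 ∧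
      dS (U := U) 1 (K.compS hU hX 2) * dS (U := U) 0 (conn₂ (dS (U := U)) (K.bS hU) (K.cS hU)) = 0 ∧
      dS (U := U) 1 (K.compS hU hX 2) * dS (U := U) 1 (conn₁ (dS (U := U)) (K.aS hU) (K.bS hU)) = 0 ∧
      dS (U := U) 1 (K.compS hU hX 2) * dS (U := U) 1 (conn₂ (dS (U := U)) (K.bS hU) (K.cS hU)) = 0) :=
  IsSolD.basic (d := dS (U := U)) (β := constS β₁) (β₂ := constS β₂) (lam := constS lam)
    dS_comm (fun i => dS_constS i β₁) (fun i => dS_constS i β₂) (fun i => dS_constS i lam)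
    (K.isSolD hU hX hsol) rfl

theorem resS_aS {V : Opens E4} (h : ∀ x ∈ V, x ∈ U) :
    resS h (K.aS hU) = K.aS fun x hx => hU x (h x hx) := resS_mkS h _ _

theorem resS_bS {V : Opens E4} (h : ∀ x ∈ V, x ∈ U) :
    resS h (K.bS hU) = K.bS fun x hx => hU x (h x hx) := resS_mkS h _ _

theorem resS_cS {V : Opens E4} (h : ∀ x ∈ V, x ∈ U) :
    resS h (K.cS hU) = K.cS fun x hx => hU x (h x hx) := resS_mkS h _ _

theorem resS_compS {V : Opens E4} (h : ∀ x ∈ V, x ∈ U) (k : Fin 4) :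
    resS h (K.compS hU hX k) = K.compS (fun x hx => hU x (h x hx)) hX k := resS_mkS h _ _

theorem resS_scalS {V : Opens E4} (h : ∀ x ∈ V, x ∈ U) :
    resS h (K.scalS hU) = K.scalS fun x hx => hU x (h x hx) := by
  rw [scalS, map_scalD (resS_dS h), resS_aS, resS_bS, resS_cS]; rfl

theorem resS_constS {U V : Opens E4} (h : ∀ x ∈ V, x ∈ U) (r : ℝ) :
    resS h (constS r) = constS r :=
  SmoothFun.ext_ev fun x => by rw [evS_resS]; simp

theorem resS_factorS {V : Opens E4} (h : ∀ x ∈ V, x ∈ U) (lam β₂ : ℝ) :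
    resS h (K.factorS hU lam β₂) = K.factorS (fun x hx => hU x (h x hx)) lam β₂ := by
  simp only [factorS, map_sub, map_mul, map_ofNat, resS_constS, resS_scalS]

set_option maxHeartbeats 800000 in
/-- The variation of the scalar curvature along the soliton field. -/
theorem dirD_scalS {β₁ lam β₂ : ℝ} (hsol : IsRicciYamabeSoliton g X β₁ lam β₂) :
    dirD (dS (U := U)) (K.compS hU hX) (K.scalS hU) = - K.factorS hU lam β₂ * K.scalS hU
      + constS β₁ * (K.scalS hU * K.scalS hU - 2 * detD (dS (U := U)) (K.aS hU) (K.bS hU) (K.cS hU))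
      + constS β₁ * lapD (dS (U := U)) (K.aS hU) (K.bS hU) (K.cS hU) (K.scalS hU) := by
  have hs := K.isSolD hU hX hsol
  have sR : dS 1 (K.compS hU hX 2) * K.scalS hU = 0 :=
    hs.twist_mul_scalD dS_comm fun _ => dS_constS _ _
  have sR1 : ∀ k, dS 1 (K.compS hU hX 2) * dS k (K.scalS hU) = 0 := fun k =>
    mul_deriv_eq_zero sR _
  have sR2 : ∀ k l, dS 1 (K.compS hU hX 2) * dS k (dS l (K.scalS hU)) = 0 := fun k l =>
    mul_deriv_eq_zero (sR1 l) _
  obtain ⟨b1, b2, b3, b4⟩ := (K.basic hU hX hsol).2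
  -- The twist annihilates `R`, all its derivatives and `δ`, hence each term of the formula
  -- separately.
  have sE : dS 1 (K.compS hU hX 2) * (dirD (dS (U := U)) (K.compS hU hX) (K.scalS hU)
      - (- K.factorS hU lam β₂ * K.scalS hU
      + constS β₁ * (K.scalS hU * K.scalS hU - 2 * detD (dS (U := U)) (K.aS hU) (K.bS hU) (K.cS hU))
      + constS β₁ * lapD (dS (U := U)) (K.aS hU) (K.bS hU) (K.cS hU) (K.scalS hU))) = 0 := by
    simp only [dirD, detD, lapD, Fin.sum_univ_four, map_add, Derivation.leibniz, smul_eq_mul]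
    generalize K.scalS hU = R at *
    generalize K.aS hU = a at *
    generalize K.bS hU = b at *
    generalize K.cS hU = c at *
    generalize dS 1 (K.compS hU hX 2) = s at *
    linear_combination (K.compS hU hX 0) * sR1 0 + (K.compS hU hX 1) * sR1 1
      + (K.compS hU hX 2) * sR1 2 + (K.compS hU hX 3) * sR1 3
      + (K.factorS hU lam β₂ - constS β₁ * R) * sR
      + 2 * constS β₁ * (dS 1 (conn₂ (dS (U := U)) b c) * b1 - dS 0 (conn₂ (dS (U := U)) b c) * b3)
      - constS β₁ * (2 * (sR2 2 0 + sR2 3 1) - (a * sR2 0 0 + dS 0 a * sR1 0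
        + b * sR2 0 1 + dS 0 b * sR1 1) - (b * sR2 1 0 + dS 1 b * sR1 0
        + c * sR2 1 1 + dS 1 c * sR1 1))
  rw [← sub_eq_zero]
  set E := dirD (dS (U := U)) (K.compS hU hX) (K.scalS hU) - _ with hE
  refine SmoothFun.ext_ev fun x => ?_
  rw [map_zero]
  -- The defect `E` vanishes where the twist is nonzero, hence on the closure of that set. The
  -- complement of the closure is open and free of twist, so there the untwisted formula applies.
  let S : Set U := {z | evS z (dS 1 (K.compS hU hX 2)) ≠ 0}
  have hS : ∀ z ∈ S, evS z E = 0 := fun z hz => by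
    have := congrArg (evS z) sE
    rw [map_mul, map_zero] at this
    exact (mul_eq_zero.1 this).resolve_left hz
  by_cases hx : x ∈ closure S
  · have hcl : IsClosed {z : U | evS z E = 0} :=
      isClosed_eq (evS_continuous E) continuous_const
    exact (closure_minimal hS hcl) hx
  · let V : Opens E4 := ⟨Subtype.val '' (closure S)ᶜ,
      U.isOpen.isOpenMap_subtype_val _ isClosed_closure.isOpen_compl⟩
    have hV : ∀ z ∈ V, z ∈ U := by rintro _ ⟨z, -, rfl⟩; exact z.2
    have hV' : ∀ z ∈ V, z ∈ tgt K.e := fun z hz => hU z (hV z hz)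
    have h0 : dS 1 (K.compS hV' hX 2) = 0 := by
      refine SmoothFun.ext_ev fun z => ?_
      obtain ⟨z, w, hw, rfl⟩ := z
      rw [← K.resS_compS hU hX hV, ← resS_dS, evS_resS, map_zero]
      by_contra hne
      exact hw (subset_closure hne)
    have h1 := IsSolD.dirD_scalD (d := dS (U := V)) (β := constS β₁) dS_comm
      (fun i => dS_constS i β₁) (K.isSolD hV' hX hsol) h0 (K.basic hV' hX hsol).1
    have hd : ∀ k (u : SmoothFun U), resS hV (dS k u) = dS k (resS hV u) := resS_dS hV
    have h2 : resS hV E = 0 := by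
      have e1 := map_dirD (d := dS (U := U)) (d' := dS (U := V)) (r := resS hV) hd (K.compS hU hX) (K.scalS hU)
      have e2 := map_detD (d := dS (U := U)) (d' := dS (U := V)) (r := resS hV) hd (K.aS hU) (K.bS hU) (K.cS hU)
      have e3 := map_lapD (d := dS (U := U)) (d' := dS (U := V)) (r := resS hV) hd (K.aS hU) (K.bS hU) (K.cS hU) (K.scalS hU)
      simp only [resS_aS, resS_bS, resS_cS, resS_scalS, resS_compS] at e1 e2 e3
      rw [hE, map_sub, sub_eq_zero, e1, map_add, map_add, map_mul, map_mul, map_mul, map_sub,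
        map_mul, map_mul, e2, e3, map_neg, map_ofNat, resS_scalS, resS_constS, resS_factorS]
      exact h1
    have h3 := congrArg (evS (⟨x, ⟨x, hx, rfl⟩⟩ : V)) h2
    rwa [evS_resS, map_zero] at h3

end WalkerChart

end Charts

/-! ### Changes between Walker charts -/

section Charts

variable {M : Type*} [TopologicalSpace M] [ChartedSpace E4 M] [IsManifold (𝓡 4) ∞ M]

theorem chartD_symmD {e : OpenPartialHomeomorph M E4}
    (he : e ∈ IsManifold.maximalAtlas (𝓡 4) ∞ M) {x : E4} (hx : x ∈ e.target)
    (v : E4) : chartD e (e.symm x) (symmD e x v) = v := by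
  have h1 : (fun z => e (e.symm z)) =ᶠ[nhds x] id := by
    filter_upwards [e.open_target.mem_nhds hx] with z hz
    exact e.right_inv hz
  have h3 := mfderiv_comp x (I := 𝓡 4) (I' := 𝓡 4) (I'' := 𝓡 4) (f := e.symm)
    (g := e) (mdiff_chart he (e.map_target hx)) (mdiff_symm he hx)
  have h4 : (mfderiv (𝓡 4) (𝓡 4) (fun z => e (e.symm z)) x v : E4) = v :=
    DFunLike.congr_fun (h1.mfderiv_eq.trans mfderiv_id) v
  exact (DFunLike.congr_fun h3 v).symm.trans h4
variable {g : PseudoMetric M} {D : ∀ p : M, Submodule ℝ (TangentSpace (𝓡 4) p)}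

namespace WalkerChart

variable (K K' : WalkerChart g D)

theorem self_le : ∀ x ∈ tgt K.e, x ∈ tgt K.e := fun _ hx => hx

theorem ovl_le : ∀ x ∈ ovl K.e K'.e, x ∈ tgt K.e := fun _ hx => WalkerSoliton.ovl_le hx

/-- Pullback of functions along the coordinate change between two Walker charts. -/
def pull : SmoothFun (tgt K'.e) →+* SmoothFun (ovl K.e K'.e) :=
  pullS (coordChange K.e K'.e) (contDiffOn_coordChange K.mem K'.mem) fun _ hx => coordChange_mem hx

/-- The coordinates of the second chart as functions on the overlap. -/
def newCoord (l : Fin 4) : SmoothFun (ovl K.e K'.e) :=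
  mkS (fun z => coordChange K.e K'.e z l)
    (contDiffOn_coord (contDiffOn_coordChange K.mem K'.mem) l)

theorem evS_pull (a : SmoothFun (tgt K'.e)) (x : ovl K.e K'.e) :
    evS x (K.pull K' a) = evS ⟨coordChange K.e K'.e x, coordChange_mem x.2⟩ a :=
  evS_pullS _ _ _ a x

theorem evS_dS_newCoord (k l : Fin 4) (x : ovl K.e K'.e) :
    evS x (dS k (K.newCoord K' l)) = pderiv k (fun z => coordChange K.e K'.e z l) x := by
  rw [newCoord, dS_mkS, evS_mkS]

/-- Both charts span the same planes `D` by their first two coordinate fields, so leaf directions go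
to leaf directions. This is where the common distribution enters. -/
theorem fderiv_coordChange_leaf {x : E4} (hx : x ∈ ovl K.e K'.e) {k : Fin 4}
    (hk : k = 0 ∨ k = 1) :
    fderiv ℝ (coordChange K.e K'.e) x (stdBasis k) 2 = 0 ∧
      fderiv ℝ (coordChange K.e K'.e) x (stdBasis k) 3 = 0 := by
  have hx' : coordChange K.e K'.e x ∈ K'.e.target := coordChange_mem hx
  let DE : M → Submodule ℝ E4 := fun p => D p
  have h1 : DE (K.e.symm x) = Submodule.span ℝ {symmD K.e x (stdBasis 0), symmD K.e x (stdBasis 1)} :=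
    K.span_eq x (K.ovl_le K' x hx)
  have h2 : DE (K'.e.symm (coordChange K.e K'.e x)) = Submodule.span ℝ
      {symmD K'.e (coordChange K.e K'.e x) (stdBasis 0),
        symmD K'.e (coordChange K.e K'.e x) (stdBasis 1)} := K'.span_eq _ hx'
  rw [symm_coordChange hx] at h2
  have h3 : symmD K.e x (stdBasis k) ∈ DE (K.e.symm x) := by
    rw [h1]
    exact Submodule.subset_span (by rcases hk with rfl | rfl <;> simp)
  rw [h2] at h3
  obtain ⟨α, β, h4⟩ := Submodule.mem_span_pair.1 h3
  rw [symmD_comp K.mem K'.mem hx, ContinuousLinearMap.comp_apply, ← map_smul, ← map_smul,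
    ← map_add] at h4
  have h5 := congrArg (chartD K'.e (K'.e.symm (coordChange K.e K'.e x))) h4
  rw [chartD_symmD K'.mem hx', chartD_symmD K'.mem hx'] at h5
  rw [← h5]
  simp [stdBasis]

/-- The change of coordinates between two Walker charts. -/
theorem trans : WalkerTrans (dS (U := ovl K.e K'.e)) (dS (U := tgt K'.e)) (K.pull K')
    (K.newCoord K') (K.aS (K.ovl_le K')) (K.bS (K.ovl_le K')) (K.cS (K.ovl_le K'))
    (K'.aS K'.self_le) (K'.bS K'.self_le) (K'.cS K'.self_le) where
  comm := dS_comm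
  chain k h := dS_pullS _ _ _ k h
  leaf := by
    have h : ∀ k l : Fin 4, (k = 0 ∨ k = 1) → (l = 2 ∨ l = 3) →
        dS (U := ovl K.e K'.e) k (K.newCoord K' l) = 0 := by
      intro k l hk hl
      refine SmoothFun.ext_ev fun x => ?_
      have hd := (contDiffOn_coordChange K.mem K'.mem).differentiableAt_open x.2
      obtain ⟨h2, h3⟩ := K.fderiv_coordChange_leaf K' x.2 hk
      rw [evS_dS_newCoord, map_zero, ← fderiv_stdBasis hd]
      rcases hl with rfl | rfl
      exacts [h2, h3]
    exact ⟨h _ _ (.inl rfl) (.inl rfl), h _ _ (.inl rfl) (.inr rfl), h _ _ (.inr rfl) (.inl rfl),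
      h _ _ (.inr rfl) (.inr rfl)⟩
  metric i j := by
    refine SmoothFun.ext_ev fun x => ?_
    rw [map_sum, ← K.gram_ev (K.ovl_le K') i j x x.2, gram_coordChange K.mem K'.mem g x.2]
    refine Finset.sum_congr rfl fun k _ => ?_
    rw [map_sum]
    refine Finset.sum_congr rfl fun l _ => ?_
    rw [map_mul, map_mul, evS_dS_newCoord, evS_dS_newCoord, evS_pull,
      ← K'.gram_ev K'.self_le k l _ (coordChange_mem x.2)]

/-- Both Gram determinants equal 1. Hence Lebesgue measure agrees between Walker charts, and
integration on `M` needs neither an orientation nor a density. -/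
theorem abs_det_fderiv_coordChange {x : E4} (hx : x ∈ ovl K.e K'.e) :
    |(fderiv ℝ (coordChange K.e K'.e) x).det| = 1 := by
  let b := (EuclideanSpace.basisFun (Fin 4) ℝ).toBasis
  let P : Matrix (Fin 4) (Fin 4) ℝ :=
    LinearMap.toMatrix b b (fderiv ℝ (coordChange K.e K'.e) x).toLinearMap
  have hP : ∀ k i, P k i = pderiv i (fun y => coordChange K.e K'.e y k) x := fun k i => by
    rw [← fderiv_stdBasis ((contDiffOn_coordChange K.mem K'.mem).differentiableAt_open hx)]
    simp [P, b, LinearMap.toMatrix_apply, stdBasis]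
  have h1 : gram g K.e x = P.transpose * gram g K'.e (coordChange K.e K'.e x) * P := by
    ext i j
    rw [gram_coordChange K.mem K'.mem g hx]
    simp only [Matrix.mul_apply, Matrix.transpose_apply, hP, Finset.sum_mul]
    rw [Finset.sum_comm]
    exact Finset.sum_congr rfl fun k _ => Finset.sum_congr rfl fun l _ => by ring
  have h2 := congrArg Matrix.det h1
  rw [Matrix.det_mul, Matrix.det_mul, Matrix.det_transpose, K.gram_eq x (K.ovl_le K' x hx),
    K'.gram_eq _ (coordChange_mem hx), walkerMatrix_det, walkerMatrix_det, mul_one] at h2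
  have h3 : (fderiv ℝ (coordChange K.e K'.e) x).det = P.det :=
    (LinearMap.det_toMatrix b _).symm
  rw [h3]
  have h4 : |P.det| * |P.det| = 1 := by rw [← abs_mul, ← h2, abs_one]
  nlinarith [abs_nonneg P.det]

/-- The components of a gradient in a Walker chart. -/
theorem components_gradient {f : M → ℝ} (hf : ContMDiff (𝓡 4) 𝓘(ℝ, ℝ) ∞ f) {x : E4}
    (hx : x ∈ K.e.target) :
    components (gradient g f) K.e x 0 = pderiv 2 (fun z => f (K.e.symm z)) x
      - K.a x * pderiv 0 (fun z => f (K.e.symm z)) x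
      - K.b x * pderiv 1 (fun z => f (K.e.symm z)) x ∧
    components (gradient g f) K.e x 1 = pderiv 3 (fun z => f (K.e.symm z)) x
      - K.b x * pderiv 0 (fun z => f (K.e.symm z)) x
      - K.c x * pderiv 1 (fun z => f (K.e.symm z)) x ∧
    components (gradient g f) K.e x 2 = pderiv 0 (fun z => f (K.e.symm z)) x ∧
    components (gradient g f) K.e x 3 = pderiv 1 (fun z => f (K.e.symm z)) x := by
  have h := fun i => gram_components_gradient g hf K.mem hx i
  rw [K.gram_eq x hx] at h
  have h0 := h 0
  have h1 := h 1
  have h2 := h 2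
  have h3 := h 3
  simp [walkerMatrix, Fin.sum_univ_four] at h0 h1 h2 h3
  refine ⟨?_, ?_, h0, h1⟩
  · rw [← h0, ← h1]; linarith
  · rw [← h0, ← h1]; linarith

theorem contDiffOn_comp_symm {f : M → ℝ} (hf : ContMDiff (𝓡 4) 𝓘(ℝ, ℝ) ∞ f) :
    ContDiffOn ℝ ∞ (fun z => f (K.e.symm z)) (tgt K.e) := by
  rw [← contMDiffOn_iff_contDiffOn]
  exact hf.comp_contMDiffOn (contMDiffOn_symm_of_mem_maximalAtlas K.mem)

theorem contDiffOn_of_coord {v : E4 → E4} {s : Set E4}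
    (h : ∀ k, ContDiffOn ℝ ∞ (fun x => v x k) s) : ContDiffOn ℝ ∞ v s :=
  contDiffOn_euclidean.2 h

theorem contDiffOn_components_gradient {f : M → ℝ} (hf : ContMDiff (𝓡 4) 𝓘(ℝ, ℝ) ∞ f) :
    ContDiffOn ℝ ∞ (components (gradient g f) K.e) K.e.target := by
  have hp : ∀ i, ContDiffOn ℝ ∞ (pderiv i (fun z => f (K.e.symm z))) K.e.target := fun i =>
    ContDiffOn.pderiv_open (K.contDiffOn_comp_symm hf) i
  refine contDiffOn_of_coord fun k => ?_
  fin_cases k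
  · exact (((hp 2).sub (K.ha.mul (hp 0))).sub (K.hb.mul (hp 1))).congr fun x hx =>
      (K.components_gradient hf hx).1
  · exact (((hp 3).sub (K.hb.mul (hp 0))).sub (K.hc.mul (hp 1))).congr fun x hx =>
      (K.components_gradient hf hx).2.1
  · exact (hp 0).congr fun x hx => (K.components_gradient hf hx).2.2.1
  · exact (hp 1).congr fun x hx => (K.components_gradient hf hx).2.2.2

theorem contDiffOn_components_of_eq {f : M → ℝ} (hf : ContMDiff (𝓡 4) 𝓘(ℝ, ℝ) ∞ f)
    {X Y : ∀ p : M, TangentSpace (𝓡 4) p} (hY : IsSmoothField Y)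
    (hX : ∀ p, X p = gradient g f p + Y p) :
    ContDiffOn ℝ ∞ (components X K.e) K.e.target := by
  refine ((K.contDiffOn_components_gradient hf).add (contDiffOn_components hY K.mem)).congr
    fun x _ => ?_
  rw [components_eq, hX]
  exact map_add (chartD K.e (K.e.symm x)) (gradient g f _) (Y _)

theorem isPush_of_components {v : Fin 4 → SmoothFun (ovl K.e K'.e)}
    {v' : Fin 4 → SmoothFun (tgt K'.e)} {V : ∀ p : M, TangentSpace (𝓡 4) p}
    (hv : ∀ x k, evS x (v k) = components V K.e x k)
    (hv' : ∀ x k, evS x (v' k) = components V K'.e x k) :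
    IsPush (dS (U := ovl K.e K'.e)) (K.pull K') (K.newCoord K') v v' := by
  intro k
  refine SmoothFun.ext_ev fun x => ?_
  have hd := (contDiffOn_coordChange K.mem K'.mem).differentiableAt_open x.2
  rw [evS_pull, hv', map_sum]
  simp only [map_mul, evS_dS_newCoord, hv]
  rw [components_coordChange K.mem K'.mem V x.2, clm_apply_eq_sum]
  simp [fderiv_stdBasis hd]

end WalkerChart

end Charts

open MeasureTheory

/-! ### Extension by zero of functions supported in a chart -/

section Extension

variable {M : Type*} [TopologicalSpace M] {e : OpenPartialHomeomorph M E4} {C : Set M}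
  {ψ : E4 → ℝ}

theorem isCompact_chart_image (hC : IsCompact C) (hCe : C ⊆ e.source) : IsCompact (e '' C) :=
  hC.image_of_continuousOn (e.continuousOn.mono hCe)

theorem indicator_eq_zero_of_notMem (h0 : ∀ x ∈ e.target, e.symm x ∉ C → ψ x = 0) {x : E4}
    (hx : x ∉ e '' C) : e.target.indicator ψ x = 0 := by
  by_cases ht : x ∈ e.target
  · rw [Set.indicator_of_mem ht]
    exact h0 x ht fun hc => hx ⟨_, hc, e.right_inv ht⟩
  · exact Set.indicator_of_notMem ht _

theorem indicator_eventuallyEq (hC : IsCompact C) (hCe : C ⊆ e.source)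
    (h0 : ∀ x ∈ e.target, e.symm x ∉ C → ψ x = 0) (x : E4) :
    (x ∈ e.target ∧ e.target.indicator ψ =ᶠ[nhds x] ψ) ∨
      e.target.indicator ψ =ᶠ[nhds x] fun _ => 0 := by
  by_cases ht : x ∈ e.target
  · left
    refine ⟨ht, ?_⟩
    filter_upwards [e.open_target.mem_nhds ht] with y hy
    exact Set.indicator_of_mem hy _
  · right
    have hx : x ∉ e '' C := by
      rintro ⟨p, hp, rfl⟩
      exact ht (e.map_source (hCe hp))
    filter_upwards [(isCompact_chart_image hC hCe).isClosed.isOpen_compl.mem_nhds hx] with y hy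
    exact indicator_eq_zero_of_notMem h0 hy

theorem contDiff_indicator (hC : IsCompact C) (hCe : C ⊆ e.source)
    (h0 : ∀ x ∈ e.target, e.symm x ∉ C → ψ x = 0) (hψ : ContDiffOn ℝ ∞ ψ e.target) :
    ContDiff ℝ ∞ (e.target.indicator ψ) := by
  refine contDiff_iff_contDiffAt.2 fun x => ?_
  rcases indicator_eventuallyEq hC hCe h0 x with ⟨ht, h⟩ | h
  · exact (hψ.contDiffAt (e.open_target.mem_nhds ht)).congr_of_eventuallyEq h
  · exact contDiffAt_const.congr_of_eventuallyEq h

theorem continuous_indicator (hC : IsCompact C) (hCe : C ⊆ e.source)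
    (h0 : ∀ x ∈ e.target, e.symm x ∉ C → ψ x = 0) (hψ : ContinuousOn ψ e.target) :
    Continuous (e.target.indicator ψ) := by
  refine continuous_iff_continuousAt.2 fun x => ?_
  rcases indicator_eventuallyEq hC hCe h0 x with ⟨ht, h⟩ | h
  · exact (hψ.continuousAt (e.open_target.mem_nhds ht)).congr h.symm
  · exact continuousAt_const.congr h.symm

theorem hasCompactSupport_indicator (hC : IsCompact C) (hCe : C ⊆ e.source)
    (h0 : ∀ x ∈ e.target, e.symm x ∉ C → ψ x = 0) :
    HasCompactSupport (e.target.indicator ψ) :=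
  HasCompactSupport.intro (isCompact_chart_image hC hCe) fun _ hx =>
    indicator_eq_zero_of_notMem h0 hx

theorem integrableOn_target (hC : IsCompact C) (hCe : C ⊆ e.source)
    (h0 : ∀ x ∈ e.target, e.symm x ∉ C → ψ x = 0) (hψ : ContinuousOn ψ e.target) :
    IntegrableOn ψ e.target := by
  rw [← integrable_indicator_iff e.open_target.measurableSet]
  exact (continuous_indicator hC hCe h0 hψ).integrable_of_hasCompactSupport
    (hasCompactSupport_indicator hC hCe h0)

/-- Integration by parts against the constant function 1. -/
theorem integral_pderiv_eq_zero {u : E4 → ℝ} (hu : ContDiff ℝ ∞ u) (hc : HasCompactSupport u)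
    (k : Fin 4) : ∫ x, pderiv k u x = 0 := by
  have hint : Integrable (fun x => fderiv ℝ u x (stdBasis k)) := by
    refine ((hu.continuous_fderiv (by simp)).clm_apply
      continuous_const).integrable_of_hasCompactSupport ?_
    exact (hc.fderiv ℝ).comp_left (g := fun L : E4 →L[ℝ] ℝ => L (stdBasis k)) rfl
  have h := integral_mul_fderiv_eq_neg_fderiv_mul_of_integrable (μ := (volume : Measure E4))
    (f := fun _ => (1 : ℝ)) (g := u) (v := stdBasis k) (by simp) (by simpa using hint)
    (by simpa using hu.continuous.integrable_of_hasCompactSupport hc)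
    (fun x _ => differentiableAt_const _) (fun x _ => (hu.differentiable (by simp)) x)
  simpa [pderiv] using h

end Extension

/-! ### Directional derivatives and change of variables -/

section Manifold

variable {M : Type*} [TopologicalSpace M] [ChartedSpace E4 M] [IsManifold (𝓡 4) ∞ M]

/-- The derivative of a function along a vector field. -/
def dirF (V : ∀ p : M, TangentSpace (𝓡 4) p) (h : M → ℝ) (p : M) : ℝ :=
  mfderiv (𝓡 4) 𝓘(ℝ, ℝ) h p (V p)

theorem dirF_symm {e : OpenPartialHomeomorph M E4} (he : e ∈ IsManifold.maximalAtlas (𝓡 4) ∞ M)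
    (V : ∀ p : M, TangentSpace (𝓡 4) p) {h : M → ℝ} (hh : ContMDiff (𝓡 4) 𝓘(ℝ, ℝ) ∞ h) {x : E4}
    (hx : x ∈ e.target) :
    dirF V h (e.symm x) = fderiv ℝ (fun z => h (e.symm z)) x (components V e x) := by
  have h3 := mfderiv_comp x (I := 𝓡 4) (I' := 𝓡 4) (I'' := 𝓘(ℝ, ℝ)) (f := e.symm)
    (g := h) (hh.mdifferentiableAt (by simp)) (mdiff_symm he hx)
  have h4 := DFunLike.congr_fun h3 (components V e x)
  rw [mfderiv_eq_fderiv] at h4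
  refine Eq.trans ?_ h4.symm
  have h5 : V (e.symm x) = symmD e x (components V e x) := (symmD_chartD he hx _).symm
  rw [dirF, h5]
  rfl

theorem dirF_symm_sum {e : OpenPartialHomeomorph M E4}
    (he : e ∈ IsManifold.maximalAtlas (𝓡 4) ∞ M)
    (V : ∀ p : M, TangentSpace (𝓡 4) p) {h : M → ℝ} (hh : ContMDiff (𝓡 4) 𝓘(ℝ, ℝ) ∞ h) {x : E4}
    (hx : x ∈ e.target) :
    dirF V h (e.symm x) = ∑ k, components V e x k * pderiv k (fun z => h (e.symm z)) x := by
  rw [dirF_symm he V hh hx]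
  conv_lhs => rw [sum_stdBasis (components V e x), map_sum]
  simp [pderiv]

theorem contDiffOn_chart {e : OpenPartialHomeomorph M E4}
    (he : e ∈ IsManifold.maximalAtlas (𝓡 4) ∞ M) {f : M → ℝ}
    (hf : ContMDiff (𝓡 4) 𝓘(ℝ, ℝ) ∞ f) : ContDiffOn ℝ ∞ (fun z => f (e.symm z)) e.target := by
  rw [← contMDiffOn_iff_contDiffOn]
  exact hf.comp_contMDiffOn (contMDiffOn_symm_of_mem_maximalAtlas he)

theorem contMDiff_of_charts {F : M → ℝ}
    (h : ∀ p, ∃ e ∈ IsManifold.maximalAtlas (𝓡 4) ∞ M, p ∈ e.source ∧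
      ContDiffOn ℝ ∞ (fun z => F (e.symm z)) e.target) : ContMDiff (𝓡 4) 𝓘(ℝ, ℝ) ∞ F := by
  intro p
  obtain ⟨e, he, hp, hF⟩ := h p
  have h1 : ContMDiffOn (𝓡 4) 𝓘(ℝ, ℝ) ∞ (fun q => F (e.symm (e q))) e.source :=
    (contMDiffOn_iff_contDiffOn.2 hF).comp (contMDiffOn_of_mem_maximalAtlas he)
      fun q hq => e.map_source hq
  refine ((h1 p hp).contMDiffAt (e.open_source.mem_nhds hp)).congr_of_eventuallyEq ?_
  filter_upwards [e.open_source.mem_nhds hp] with q hq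
  rw [e.left_inv hq]

theorem contDiffOn_dirF {e : OpenPartialHomeomorph M E4}
    (he : e ∈ IsManifold.maximalAtlas (𝓡 4) ∞ M)
    {V : ∀ p : M, TangentSpace (𝓡 4) p} {h : M → ℝ} (hh : ContMDiff (𝓡 4) 𝓘(ℝ, ℝ) ∞ h)
    (hV : ContDiffOn ℝ ∞ (components V e) e.target) :
    ContDiffOn ℝ ∞ (fun z => dirF V h (e.symm z)) e.target := by
  refine ContDiffOn.congr (f := fun x => ∑ k, components V e x k
    * pderiv k (fun z => h (e.symm z)) x) ?_ fun x hx => dirF_symm_sum he V hh hx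
  exact ContDiffOn.sum fun k _ => (contDiffOn_coord hV k).mul
    (ContDiffOn.pderiv_open (U := tgt e) (contDiffOn_chart he hh) k)

/-- Change of variables between two charts. -/
theorem setIntegral_chart_eq {e e' : OpenPartialHomeomorph M E4}
    (he : e ∈ IsManifold.maximalAtlas (𝓡 4) ∞ M) (he' : e' ∈ IsManifold.maximalAtlas (𝓡 4) ∞ M)
    (hdet : ∀ x ∈ ovl e e', |(fderiv ℝ (coordChange e e') x).det| = 1) {F : M → ℝ}
    (hF : ∀ p, p ∉ e.source → F p = 0) (hF' : ∀ p, p ∉ e'.source → F p = 0) :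
    ∫ x in e.target, F (e.symm x) = ∫ x in e'.target, F (e'.symm x) := by
  have h1 : ∫ x in e.target, F (e.symm x) = ∫ x in (ovl e e' : Set E4), F (e.symm x) :=
    setIntegral_eq_of_subset_of_forall_sdiff_eq_zero (μ := volume) e.open_target.measurableSet
      (fun x hx => ovl_le hx) fun x hx => hF' _ fun h => hx.2 (mem_ovl.2 ⟨hx.1, h⟩)
  have h2 : ∫ x in e'.target, F (e'.symm x) = ∫ x in (ovl e' e : Set E4), F (e'.symm x) :=
    setIntegral_eq_of_subset_of_forall_sdiff_eq_zero (μ := volume) e'.open_target.measurableSet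
      (fun x hx => ovl_le hx) fun x hx => hF _ fun h => hx.2 (mem_ovl.2 ⟨hx.1, h⟩)
  have h3 : (ovl e' e : Set E4) = coordChange e e' '' ovl e e' := by
    ext x
    constructor
    · intro hx
      exact ⟨_, coordChange_mem_ovl hx, coordChange_coordChange hx⟩
    · rintro ⟨y, hy, rfl⟩
      exact coordChange_mem_ovl hy
  rw [h1, h2, h3, integral_image_eq_integral_abs_det_fderiv_smul volume
    (ovl e e').isOpen.measurableSet (f' := fderiv ℝ (coordChange e e'))
    (fun x hx => ((contDiffOn_coordChange he he').differentiableAt_open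
      hx).hasFDerivAt.hasFDerivWithinAt) (fun x hx y hy hxy => by
        rw [← coordChange_coordChange hx, hxy, coordChange_coordChange hy])]
  refine setIntegral_congr_fun (ovl e e').isOpen.measurableSet fun x hx => ?_
  simp only [hdet x hx, symm_coordChange hx, one_smul]

end Manifold

/-! ### Integration and the divergence theorem -/

section Integral

variable {M : Type*} [TopologicalSpace M] [ChartedSpace E4 M] [IsManifold (𝓡 4) ∞ M]
  [T2Space M] [CompactSpace M] {ι : Type*} [Fintype ι]

variable (M ι) in
/-- A finite atlas whose coordinate changes preserve the volume, with a subordinate partition of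
unity. -/
structure UnimodularAtlas where
  e : ι → OpenPartialHomeomorph M E4
  mem : ∀ i, e i ∈ IsManifold.maximalAtlas (𝓡 4) ∞ M
  det : ∀ i j, ∀ x ∈ ovl (e i) (e j), |(fderiv ℝ (coordChange (e i) (e j)) x).det| = 1
  ρ : SmoothPartitionOfUnity ι (𝓡 4) M Set.univ
  sub : ρ.IsSubordinate fun i => (e i).source

namespace UnimodularAtlas

variable (𝒜 : UnimodularAtlas M ι)

/-- The integral of a function. -/
def int (F : M → ℝ) : ℝ :=
  ∑ i, ∫ x in (𝒜.e i).target, 𝒜.ρ i ((𝒜.e i).symm x) * F ((𝒜.e i).symm x)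

theorem sum_eq_one (p : M) : ∑ i, 𝒜.ρ i p = 1 := by
  rw [← finsum_eq_sum_of_fintype]
  exact 𝒜.ρ.sum_eq_one (Set.mem_univ p)

theorem exists_pos (p : M) : ∃ i, 0 < 𝒜.ρ i p := by
  by_contra! h
  have h1 : ∑ i, 𝒜.ρ i p ≤ 0 := Finset.sum_nonpos fun i _ => h i
  rw [𝒜.sum_eq_one] at h1
  linarith

theorem mem_source {i : ι} {p : M} (h : 𝒜.ρ i p ≠ 0) : p ∈ (𝒜.e i).source :=
  𝒜.sub i (subset_closure h)

theorem exists_mem_source (p : M) : ∃ i, p ∈ (𝒜.e i).source := by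
  obtain ⟨i, hi⟩ := 𝒜.exists_pos p
  exact ⟨i, 𝒜.mem_source hi.ne'⟩

theorem isCompact_tsupport (i : ι) : IsCompact (tsupport (𝒜.ρ i)) :=
  (isClosed_tsupport _).isCompact

theorem continuousOn_comp_symm (i : ι) {F : M → ℝ} (hF : Continuous F) :
    ContinuousOn (fun x => F ((𝒜.e i).symm x)) (𝒜.e i).target :=
  hF.comp_continuousOn (𝒜.e i).continuousOn_symm

theorem continuous_ρ (i : ι) : Continuous (𝒜.ρ i) := (𝒜.ρ i).contMDiff.continuous

theorem integrableOn_mul (i : ι) {F : M → ℝ} (hF : Continuous F) :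
    IntegrableOn (fun x => 𝒜.ρ i ((𝒜.e i).symm x) * F ((𝒜.e i).symm x)) (𝒜.e i).target :=
  integrableOn_target (𝒜.isCompact_tsupport i) (𝒜.sub i)
    (fun x _ hx => by rw [image_eq_zero_of_notMem_tsupport hx, zero_mul])
    ((𝒜.continuousOn_comp_symm i (𝒜.continuous_ρ i)).mul (𝒜.continuousOn_comp_symm i hF))

theorem int_add {F G : M → ℝ} (hF : Continuous F) (hG : Continuous G) :
    𝒜.int (fun p => F p + G p) = 𝒜.int F + 𝒜.int G := by
  simp only [int, ← Finset.sum_add_distrib]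
  refine Finset.sum_congr rfl fun i _ => ?_
  rw [← integral_add (𝒜.integrableOn_mul i hF) (𝒜.integrableOn_mul i hG)]
  simp only [mul_add]

theorem int_const_mul (c : ℝ) (F : M → ℝ) : 𝒜.int (fun p => c * F p) = c * 𝒜.int F := by
  simp only [int, Finset.mul_sum]
  refine Finset.sum_congr rfl fun i _ => ?_
  rw [← integral_const_mul]
  exact integral_congr_ae (Filter.Eventually.of_forall fun x => by ring)

theorem int_nonneg {F : M → ℝ} (hF : ∀ p, 0 ≤ F p) : 0 ≤ 𝒜.int F :=
  Finset.sum_nonneg fun i _ => integral_nonneg fun _ => mul_nonneg (𝒜.ρ.nonneg i _) (hF _)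

theorem int_sub {F G : M → ℝ} (hF : Continuous F) (hG : Continuous G) :
    𝒜.int (fun p => F p - G p) = 𝒜.int F - 𝒜.int G := by
  have h := 𝒜.int_add hF (hG.const_mul (-1))
  rw [𝒜.int_const_mul] at h
  calc 𝒜.int (fun p => F p - G p) = 𝒜.int (fun p => F p + -1 * G p) := by
        congr 1; ext p; ring
    _ = _ := by rw [h]; ring

theorem int_mono {F G : M → ℝ} (hF : Continuous F) (hG : Continuous G) (h : ∀ p, F p ≤ G p) :
    𝒜.int F ≤ 𝒜.int G := by
  have := 𝒜.int_nonneg (F := fun p => G p - F p) fun p => sub_nonneg.2 (h p)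
  rw [𝒜.int_sub hG hF] at this
  linarith

/-- A nonnegative continuous function whose integral vanishes is zero. -/
theorem eq_zero_of_int_eq_zero {F : M → ℝ} (hF : Continuous F) (h0 : ∀ p, 0 ≤ F p)
    (h : 𝒜.int F = 0) (p : M) : F p = 0 := by
  have hnn : ∀ i x, 0 ≤ 𝒜.ρ i ((𝒜.e i).symm x) * F ((𝒜.e i).symm x) := fun i x =>
    mul_nonneg (𝒜.ρ.nonneg i _) (h0 _)
  have h1 := (Finset.sum_eq_zero_iff_of_nonneg fun i _ => integral_nonneg (hnn i)).1 h
  obtain ⟨i, hi⟩ := 𝒜.exists_pos p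
  have hp := 𝒜.mem_source hi.ne'
  set ψ : E4 → ℝ := fun x => 𝒜.ρ i ((𝒜.e i).symm x) * F ((𝒜.e i).symm x) with hψ
  have hz : ∀ x ∈ (𝒜.e i).target, (𝒜.e i).symm x ∉ tsupport (𝒜.ρ i) → ψ x = 0 :=
    fun x _ hx => by rw [hψ]; simp only; rw [image_eq_zero_of_notMem_tsupport hx, zero_mul]
  have hc : Continuous ((𝒜.e i).target.indicator ψ) :=
    continuous_indicator (𝒜.isCompact_tsupport i) (𝒜.sub i) hz
      ((𝒜.continuousOn_comp_symm i (𝒜.continuous_ρ i)).mul (𝒜.continuousOn_comp_symm i hF))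
  have hs := hasCompactSupport_indicator (𝒜.isCompact_tsupport i) (𝒜.sub i) hz
  have h2 : ∫ x, (𝒜.e i).target.indicator ψ x = 0 := by
    rw [integral_indicator (𝒜.e i).open_target.measurableSet]
    exact h1 i (Finset.mem_univ i)
  have h3 : (𝒜.e i).target.indicator ψ (𝒜.e i p) = 0 := by
    by_contra hne
    have := hc.integral_pos_of_hasCompactSupport_nonneg_nonzero (μ := volume) hs
      (fun x => Set.indicator_nonneg (fun x _ => hnn i x) x) hne
    exact this.ne' h2
  rw [Set.indicator_of_mem ((𝒜.e i).map_source hp), hψ] at h3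
  simp only [(𝒜.e i).left_inv hp] at h3
  exact (mul_eq_zero.1 h3).resolve_left hi.ne'

/-- A function that is supported in the domain of one chart is integrated in this chart. -/
theorem int_eq_setIntegral (i : ι) {F : M → ℝ} (hF : Continuous F)
    (hs : tsupport F ⊆ (𝒜.e i).source) :
    𝒜.int F = ∫ x in (𝒜.e i).target, F ((𝒜.e i).symm x) := by
  have hF0 : ∀ p, p ∉ (𝒜.e i).source → F p = 0 := fun p hp =>
    image_eq_zero_of_notMem_tsupport fun h => hp (hs h)
  have h1 : ∀ j, ∫ x in (𝒜.e j).target, 𝒜.ρ j ((𝒜.e j).symm x) * F ((𝒜.e j).symm x)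
      = ∫ x in (𝒜.e i).target, 𝒜.ρ j ((𝒜.e i).symm x) * F ((𝒜.e i).symm x) := fun j =>
    setIntegral_chart_eq (𝒜.mem j) (𝒜.mem i) (𝒜.det j i) (F := fun p => 𝒜.ρ j p * F p)
      (fun p hp => by
        rw [image_eq_zero_of_notMem_tsupport (fun h => hp (𝒜.sub j h)), zero_mul])
      (fun p hp => by rw [hF0 p hp, mul_zero])
  rw [int, Finset.sum_congr rfl fun j _ => h1 j, ← integral_finsetSum]
  · simp only [← Finset.sum_mul, 𝒜.sum_eq_one, one_mul]
  · intro j _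
    refine integrableOn_target (isClosed_tsupport F).isCompact hs
      (fun x _ hx => by rw [image_eq_zero_of_notMem_tsupport hx, mul_zero])
      ((𝒜.continuousOn_comp_symm i (𝒜.continuous_ρ j)).mul (𝒜.continuousOn_comp_symm i hF))

theorem contMDiff_of_atlas {F : M → ℝ}
    (h : ∀ i, ContDiffOn ℝ ∞ (fun z => F ((𝒜.e i).symm z)) (𝒜.e i).target) :
    ContMDiff (𝓡 4) 𝓘(ℝ, ℝ) ∞ F :=
  contMDiff_of_charts fun p =>
    let ⟨i, hi⟩ := 𝒜.exists_mem_source p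
    ⟨𝒜.e i, 𝒜.mem i, hi, h i⟩

theorem contMDiff_dirF {V : ∀ p : M, TangentSpace (𝓡 4) p}
    (hV : ∀ i, ContDiffOn ℝ ∞ (components V (𝒜.e i)) (𝒜.e i).target) {h : M → ℝ}
    (hh : ContMDiff (𝓡 4) 𝓘(ℝ, ℝ) ∞ h) : ContMDiff (𝓡 4) 𝓘(ℝ, ℝ) ∞ (dirF V h) :=
  𝒜.contMDiff_of_atlas fun i => contDiffOn_dirF (𝒜.mem i) hh (hV i)

theorem tsupport_dirF_subset (V : ∀ p : M, TangentSpace (𝓡 4) p) (h : M → ℝ) :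
    tsupport (dirF V h) ⊆ tsupport h := by
  refine closure_minimal (fun p hp => ?_) (isClosed_tsupport h)
  by_contra hn
  refine hp ?_
  have h1 : h =ᶠ[nhds p] fun _ => (0 : ℝ) := notMem_tsupport_iff_eventuallyEq.1 hn
  rw [dirF, h1.mfderiv_eq, mfderiv_const]
  rfl

/-- The divergence theorem. -/
theorem int_divergence {V : ∀ p : M, TangentSpace (𝓡 4) p}
    (hV : ∀ i, ContDiffOn ℝ ∞ (components V (𝒜.e i)) (𝒜.e i).target) {dv : M → ℝ}
    (hdv : ∀ i, ∀ x ∈ (𝒜.e i).target,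
      dv ((𝒜.e i).symm x) = ∑ k, pderiv k (fun z => components V (𝒜.e i) z k) x) :
    𝒜.int dv = 0 := by
  have hdc : Continuous dv := by
    refine (𝒜.contMDiff_of_atlas fun i => ?_).continuous
    refine ContDiffOn.congr ?_ fun x hx => hdv i x hx
    exact ContDiffOn.sum fun k _ =>
      ContDiffOn.pderiv_open (U := tgt (𝒜.e i)) (contDiffOn_coord (hV i) k) k
  have hρ : ∀ i, ContMDiff (𝓡 4) 𝓘(ℝ, ℝ) ∞ (𝒜.ρ i) := fun i => (𝒜.ρ i).contMDiff
  have hdρ : ∀ i, Continuous (dirF V (𝒜.ρ i)) := fun i => (𝒜.contMDiff_dirF hV (hρ i)).continuous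
  -- `ρ div V + V(ρ)` is the divergence of `ρ V`, which extends by zero to a compactly supported
  -- field on the coordinate space and so integrates to zero.
  have h1 : ∀ i, ∫ x in (𝒜.e i).target, 𝒜.ρ i ((𝒜.e i).symm x) * dv ((𝒜.e i).symm x)
      = - 𝒜.int (dirF V (𝒜.ρ i)) := by
    intro i
    have hts := (tsupport_dirF_subset V (𝒜.ρ i)).trans (𝒜.sub i)
    rw [𝒜.int_eq_setIntegral i (hdρ i) hts, eq_neg_iff_add_eq_zero,
      ← integral_add (𝒜.integrableOn_mul i hdc) (integrableOn_target
        (isClosed_tsupport (dirF V (𝒜.ρ i))).isCompact hts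
        (fun x _ hx => image_eq_zero_of_notMem_tsupport hx) (𝒜.continuousOn_comp_symm i (hdρ i)))]
    let ψ : Fin 4 → E4 → ℝ := fun k x => 𝒜.ρ i ((𝒜.e i).symm x) * components V (𝒜.e i) x k
    have hψ : ∀ k, ContDiffOn ℝ ∞ (ψ k) (𝒜.e i).target := fun k =>
      (contDiffOn_chart (𝒜.mem i) (hρ i)).mul (contDiffOn_coord (hV i) k)
    have hz : ∀ k, ∀ x ∈ (𝒜.e i).target, (𝒜.e i).symm x ∉ tsupport (𝒜.ρ i) → ψ k x = 0 :=
      fun k x _ hx => by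
        simp only [ψ]
        rw [image_eq_zero_of_notMem_tsupport hx, zero_mul]
    have hu := fun k => contDiff_indicator (𝒜.isCompact_tsupport i) (𝒜.sub i) (hz k) (hψ k)
    have hs := fun k => hasCompactSupport_indicator (𝒜.isCompact_tsupport i) (𝒜.sub i) (hz k)
    have h2 : ∀ k, ∀ x ∈ (𝒜.e i).target, pderiv k ((𝒜.e i).target.indicator (ψ k)) x
        = pderiv k (ψ k) x := fun k x hx =>
      pderiv_congr_on (U := tgt (𝒜.e i)) (fun y hy => Set.indicator_of_mem hy _) k hx
    have h3 : ∀ k, ∀ x ∉ (𝒜.e i).target, pderiv k ((𝒜.e i).target.indicator (ψ k)) x = 0 := by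
      intro k x hx
      rcases indicator_eventuallyEq (𝒜.isCompact_tsupport i) (𝒜.sub i) (hz k) x with ⟨ht, -⟩ | h
      · exact absurd ht hx
      · rw [pderiv, h.fderiv_eq]
        simp
    have hint : ∀ k, Integrable (pderiv k ((𝒜.e i).target.indicator (ψ k))) := by
      intro k
      refine (((hu k).continuous_fderiv (by simp)).clm_apply
        continuous_const).integrable_of_hasCompactSupport ?_
      exact ((hs k).fderiv ℝ).comp_left (g := fun L : E4 →L[ℝ] ℝ => L (stdBasis k)) rfl
    calc _ = ∫ x in (𝒜.e i).target, ∑ k, pderiv k ((𝒜.e i).target.indicator (ψ k)) x := by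
          refine setIntegral_congr_fun (𝒜.e i).open_target.measurableSet fun x hx => ?_
          simp only [h2 _ x hx, hdv i x hx, dirF_symm_sum (𝒜.mem i) V (hρ i) hx, Finset.mul_sum,
            ← Finset.sum_add_distrib]
          refine Finset.sum_congr rfl fun k _ => ?_
          have d1 := (contDiffOn_chart (𝒜.mem i) (hρ i)).differentiableAt_open (U := tgt (𝒜.e i)) hx
          have d2 := (contDiffOn_coord (hV i) k).differentiableAt_open (U := tgt (𝒜.e i)) hx
          simp only [ψ, pderiv]
          rw [fderiv_fun_mul d1 d2]
          simp
      _ = ∫ x, ∑ k, pderiv k ((𝒜.e i).target.indicator (ψ k)) x := by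
          refine setIntegral_eq_integral_of_forall_compl_eq_zero fun x hx => ?_
          exact Finset.sum_eq_zero fun k _ => h3 k x hx
      _ = 0 := by
          rw [integral_finsetSum _ fun k _ => hint k]
          exact Finset.sum_eq_zero fun k _ => integral_pderiv_eq_zero (hu k) (hs k) k
  have h4 : 𝒜.int (fun p => ∑ i, dirF V (𝒜.ρ i) p) = ∑ i, 𝒜.int (dirF V (𝒜.ρ i)) := by
    have : ∀ s : Finset ι, 𝒜.int (fun p => ∑ i ∈ s, dirF V (𝒜.ρ i) p)
        = ∑ i ∈ s, 𝒜.int (dirF V (𝒜.ρ i)) := by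
      intro s
      classical
      induction s using Finset.induction_on with
      | empty =>
        simp only [Finset.sum_empty]
        simpa using 𝒜.int_const_mul 0 (fun _ => 0)
      | insert a s ha ih =>
        simp only [Finset.sum_insert ha]
        rw [𝒜.int_add (hdρ a) (continuous_finsetSum _ fun i _ => hdρ i), ih]
    exact this Finset.univ
  -- The derivatives of the partition of unity sum to the derivative of the constant 1.
  have h5 : ∀ p, ∑ i, dirF V (𝒜.ρ i) p = 0 := by
    intro p
    obtain ⟨j, hj⟩ := 𝒜.exists_mem_source p
    have hx := (𝒜.e j).map_source hj
    rw [← (𝒜.e j).left_inv hj]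
    simp only [dirF_symm (𝒜.mem j) V (hρ _) hx]
    rw [← sum_apply, ← fderiv_fun_sum fun i _ =>
      (contDiffOn_chart (𝒜.mem j) (hρ i)).differentiableAt_open (U := tgt (𝒜.e j)) hx]
    simp [𝒜.sum_eq_one]
  rw [int, Finset.sum_congr rfl fun i _ => h1 i, Finset.sum_neg_distrib, ← h4]
  simp only [h5]
  simpa using 𝒜.int_const_mul 0 (fun _ => 0)

end UnimodularAtlas

end Integral

/-! ### Functions and fields assembled from Walker charts -/

section Gluing

variable {M : Type*} [TopologicalSpace M] [ChartedSpace E4 M] [IsManifold (𝓡 4) ∞ M]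
variable {g : PseudoMetric M} {D : ∀ p : M, Submodule ℝ (TangentSpace (𝓡 4) p)}

/-- A function on the manifold is assembled from its expressions in all Walker charts. -/
theorem exists_function (hcov : ∀ p, ∃ K : WalkerChart g D, p ∈ K.e.source)
    (φ : ∀ K : WalkerChart g D, SmoothFun (tgt K.e))
    (hφ : ∀ K K' : WalkerChart g D, resS (K.ovl_le K') (φ K) = K.pull K' (φ K')) :
    ∃ F : M → ℝ, ContMDiff (𝓡 4) 𝓘(ℝ, ℝ) ∞ F ∧
      ∀ (K : WalkerChart g D) (x : tgt K.e), F (K.e.symm x) = evS x (φ K) := by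
  choose κ hκ using hcov
  let F : M → ℝ := fun p => evS ⟨(κ p).e p, (κ p).e.map_source (hκ p)⟩ (φ (κ p))
  have hF : ∀ (K : WalkerChart g D) (x : tgt K.e), F (K.e.symm x) = evS x (φ K) := by
    intro K x
    have hx : (x : E4) ∈ ovl K.e (κ (K.e.symm x)).e := mem_ovl.2 ⟨x.2, hκ _⟩
    have h := congrArg (evS (⟨x, hx⟩ : ovl K.e (κ (K.e.symm x)).e)) (hφ K (κ (K.e.symm x)))
    rw [evS_resS, WalkerChart.evS_pull] at h
    exact h.symm
  refine ⟨F, contMDiff_of_charts fun p => ⟨(κ p).e, (κ p).mem, hκ p, ?_⟩, hF⟩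
  exact (extS_contDiffOn (φ (κ p))).congr fun x hx =>
    (hF (κ p) ⟨x, hx⟩).trans (extS_apply _ ⟨x, hx⟩).symm

/-- A vector field on the manifold is assembled from its components in all Walker charts. -/
theorem exists_field (hcov : ∀ p, ∃ K : WalkerChart g D, p ∈ K.e.source)
    (v : ∀ K : WalkerChart g D, Fin 4 → SmoothFun (tgt K.e))
    (hv : ∀ K K' : WalkerChart g D, IsPush (dS (U := ovl K.e K'.e)) (K.pull K') (K.newCoord K')
      (fun k => resS (K.ovl_le K') (v K k)) (v K')) :
    ∃ V : ∀ p : M, TangentSpace (𝓡 4) p,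
      ∀ (K : WalkerChart g D) (x : tgt K.e) k, components V K.e x k = evS x (v K k) := by
  choose κ hκ using hcov
  let w : ∀ (K : WalkerChart g D) (_ : tgt K.e), E4 := fun K x =>
    ∑ k, evS x (v K k) • stdBasis k
  have hw : ∀ K x k, w K x k = evS x (v K k) := fun K x k => by
    simp [w, stdBasis, Pi.single_apply]
  let V : ∀ p : M, TangentSpace (𝓡 4) p := fun p =>
    symmD (κ p).e ((κ p).e p) (w (κ p) ⟨(κ p).e p, (κ p).e.map_source (hκ p)⟩)
  refine ⟨V, fun K x k => ?_⟩
  have hx : (x : E4) ∈ ovl K.e (κ (K.e.symm x)).e := mem_ovl.2 ⟨x.2, hκ _⟩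
  set K' := κ (K.e.symm x) with hK'
  have hd := (contDiffOn_coordChange K.mem K'.mem).differentiableAt_open hx
  have h1 : fderiv ℝ (coordChange K.e K'.e) x (w K x)
      = w K' ⟨coordChange K.e K'.e x, coordChange_mem hx⟩ := by
    ext k
    rw [hw, clm_apply_eq_sum, ← K.evS_pull K' (v K' k) ⟨x, hx⟩, hv K K' k, map_sum]
    simp only [map_mul, WalkerChart.evS_dS_newCoord, evS_resS]
    simp [hw, fderiv_stdBasis hd]
  have h2 : V (K.e.symm x) = symmD K.e x (w K x) := by
    rw [symmD_comp K.mem K'.mem hx, ContinuousLinearMap.comp_apply, h1]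
    rfl
  rw [components_eq, h2, ← hw]
  exact congrArg (fun u : E4 => u k) (chartD_symmD K.mem x.2 _)

theorem components_smul (h : M → ℝ) (X : ∀ p : M, TangentSpace (𝓡 4) p)
    (e : OpenPartialHomeomorph M E4) (x : E4) (k : Fin 4) :
    components (fun p => h p • X p) e x k = h (e.symm x) * components X e x k := by
  rw [components_eq, components_eq]
  exact congrArg (fun u : E4 => u k) (map_smul (chartD e (e.symm x)) (h (e.symm x)) _)

theorem contDiffOn_components_of_ev {V : ∀ p : M, TangentSpace (𝓡 4) p} {K : WalkerChart g D}
    {v : Fin 4 → SmoothFun (tgt K.e)}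
    (h : ∀ (x : tgt K.e) k, components V K.e x k = evS x (v k)) :
    ContDiffOn ℝ ∞ (components V K.e) K.e.target :=
  WalkerChart.contDiffOn_of_coord fun k => (extS_contDiffOn (v k)).congr fun x hx =>
    (h ⟨x, hx⟩ k).trans (extS_apply _ ⟨x, hx⟩).symm

theorem sum_pderiv_components {V : ∀ p : M, TangentSpace (𝓡 4) p} {K : WalkerChart g D}
    {v : Fin 4 → SmoothFun (tgt K.e)}
    (h : ∀ (x : tgt K.e) k, components V K.e x k = evS x (v k)) (x : tgt K.e) :
    ∑ k, pderiv k (fun z => components V K.e z k) x = evS x (divD (dS (U := tgt K.e)) v) := by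
  rw [divD, map_sum]
  exact Finset.sum_congr rfl fun k _ => evS_dS_of_eq (fun y hy => h ⟨y, hy⟩ k) k x

/-- The expression of a function in a Walker chart. -/
def WalkerChart.loc (K : WalkerChart g D) {h : M → ℝ} (hh : ContMDiff (𝓡 4) 𝓘(ℝ, ℝ) ∞ h) :
    SmoothFun (tgt K.e) := mkS (fun z => h (K.e.symm z)) (K.contDiffOn_comp_symm hh)

@[simp] theorem WalkerChart.evS_loc (K : WalkerChart g D) {h : M → ℝ}
    (hh : ContMDiff (𝓡 4) 𝓘(ℝ, ℝ) ∞ h) (x : tgt K.e) :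
    evS x (K.loc hh) = h (K.e.symm x) := evS_mkS _ _ _

theorem WalkerChart.resS_loc (K K' : WalkerChart g D) {h : M → ℝ}
    (hh : ContMDiff (𝓡 4) 𝓘(ℝ, ℝ) ∞ h) : resS (K.ovl_le K') (K.loc hh) = K.pull K' (K'.loc hh) :=
  SmoothFun.ext_ev fun x => by
    rw [evS_resS, WalkerChart.evS_pull, evS_loc, evS_loc]
    exact congrArg h (symm_coordChange x.2).symm

theorem dirF_ev {V : ∀ p : M, TangentSpace (𝓡 4) p} {K : WalkerChart g D}
    {v : Fin 4 → SmoothFun (tgt K.e)}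
    (hv : ∀ (x : tgt K.e) k, components V K.e x k = evS x (v k)) {h : M → ℝ}
    (hh : ContMDiff (𝓡 4) 𝓘(ℝ, ℝ) ∞ h) (x : tgt K.e) :
    dirF V h (K.e.symm x) = evS x (dirD (dS (U := tgt K.e)) v (K.loc hh)) := by
  rw [dirF_symm_sum K.mem V hh x.2, dirD, map_sum]
  refine Finset.sum_congr rfl fun k _ => ?_
  rw [map_mul, hv, WalkerChart.loc, dS_mkS, evS_mkS]

/-- The restriction of the data of a Walker chart to an overlap. -/
theorem WalkerChart.resS_conn (K K' : WalkerChart g D) :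
    resS (K.ovl_le K') (conn₁ (dS (U := tgt K.e)) (K.aS K.self_le) (K.bS K.self_le))
      = conn₁ (dS (U := ovl K.e K'.e)) (K.aS (K.ovl_le K')) (K.bS (K.ovl_le K')) ∧
    resS (K.ovl_le K') (conn₂ (dS (U := tgt K.e)) (K.bS K.self_le) (K.cS K.self_le))
      = conn₂ (dS (U := ovl K.e K'.e)) (K.bS (K.ovl_le K')) (K.cS (K.ovl_le K')) := by
  have h1 := map_conn₁ (d := dS (U := tgt K.e)) (d' := dS (U := ovl K.e K'.e))
    (r := resS (K.ovl_le K')) (resS_dS (K.ovl_le K')) (K.aS K.self_le) (K.bS K.self_le)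
  have h2 := map_conn₂ (d := dS (U := tgt K.e)) (d' := dS (U := ovl K.e K'.e))
    (r := resS (K.ovl_le K')) (resS_dS (K.ovl_le K')) (K.bS K.self_le) (K.cS K.self_le)
  rw [resS_aS, resS_bS] at h1
  rw [resS_bS, resS_cS] at h2
  exact ⟨h1, h2⟩

/-- This `R` is read off in Walker charts only; it is related to `scalarCurvature`, which uses the
preferred charts of `M`, only in the conformal case at the end. -/
theorem exists_scalar (hcov : ∀ p, ∃ K : WalkerChart g D, p ∈ K.e.source) :
    ∃ R : M → ℝ, ContMDiff (𝓡 4) 𝓘(ℝ, ℝ) ∞ R ∧ ∀ (K : WalkerChart g D) (x : tgt K.e),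
      R (K.e.symm x) = evS x (K.scalS K.self_le) := by
  refine exists_function hcov (fun K => K.scalS K.self_le) fun K K' => ?_
  rw [K.resS_scalS]
  exact (K.trans K').scalD_eq

/-- The determinant of the curvature of the null distribution in a Walker chart. -/
def WalkerChart.detS (K : WalkerChart g D) : SmoothFun (tgt K.e) :=
  detD (dS (U := tgt K.e)) (K.aS K.self_le) (K.bS K.self_le) (K.cS K.self_le)

theorem exists_det (hcov : ∀ p, ∃ K : WalkerChart g D, p ∈ K.e.source) :
    ∃ δ : M → ℝ, ContMDiff (𝓡 4) 𝓘(ℝ, ℝ) ∞ δ ∧ ∀ (K : WalkerChart g D) (x : tgt K.e),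
      δ (K.e.symm x) = evS x K.detS := by
  refine exists_function hcov (fun K => K.detS) fun K K' => ?_
  have h1 := map_detD (d := dS (U := tgt K.e)) (d' := dS (U := ovl K.e K'.e))
    (r := resS (K.ovl_le K')) (resS_dS (K.ovl_le K')) (K.aS K.self_le) (K.bS K.self_le)
    (K.cS K.self_le)
  rw [K.resS_aS, K.resS_bS, K.resS_cS] at h1
  exact h1.trans (K.trans K').detD_eq

end Gluing

/-! ### Finite Walker atlases -/

section Atlas

variable {M : Type*} [TopologicalSpace M] [ChartedSpace E4 M] [IsManifold (𝓡 4) ∞ M]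
  [T2Space M] [CompactSpace M]
variable (g : PseudoMetric M) (D : ∀ p : M, Submodule ℝ (TangentSpace (𝓡 4) p))

/-- A finite atlas of Walker charts with a subordinate partition of unity. -/
structure WalkerAtlas (ι : Type*) [Fintype ι] where
  K : ι → WalkerChart g D
  ρ : SmoothPartitionOfUnity ι (𝓡 4) M Set.univ
  sub : ρ.IsSubordinate fun i => (K i).e.source

variable {g D}

/-- Walker charts have unimodular coordinate changes. -/
def WalkerAtlas.unimod {ι : Type*} [Fintype ι] (𝒲 : WalkerAtlas g D ι) : UnimodularAtlas M ι where
  e i := (𝒲.K i).e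
  mem i := (𝒲.K i).mem
  det i j _ hx := (𝒲.K i).abs_det_fderiv_coordChange (𝒲.K j) hx
  ρ := 𝒲.ρ
  sub := 𝒲.sub
theorem exists_walkerAtlas (hcov : ∀ p, ∃ K : WalkerChart g D, p ∈ K.e.source) :
    ∃ t : Finset M, Nonempty (WalkerAtlas g D t) := by
  choose κ hκ using hcov
  obtain ⟨t, ht⟩ := isCompact_univ.elim_finite_subcover (fun p => (κ p).e.source)
    (fun p => (κ p).e.open_source) fun p _ => Set.mem_iUnion.2 ⟨p, hκ p⟩
  obtain ⟨ρ, hρ⟩ := SmoothPartitionOfUnity.exists_isSubordinate (𝓡 4) (s := (Set.univ : Set M))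
    isClosed_univ (fun p : t => (κ p).e.source) (fun p => (κ p).e.open_source) fun q hq => by
      obtain ⟨p, hp, hq⟩ := Set.mem_iUnion₂.1 (ht hq)
      exact Set.mem_iUnion.2 ⟨⟨p, hp⟩, hq⟩
  exact ⟨t, ⟨⟨fun p => κ p, ρ, hρ⟩⟩⟩

theorem exists_walkerChart (hg : IsWalker g) :
    ∃ D : ∀ p : M, Submodule ℝ (TangentSpace (𝓡 4) p),
      ∀ p, ∃ K : WalkerChart g D, p ∈ K.e.source := by
  obtain ⟨D, h⟩ := hg
  refine ⟨D, fun p => ?_⟩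
  obtain ⟨e, he, hp, ⟨a, b, c, ha, hb, hc, hG⟩, hD⟩ := h p
  exact ⟨⟨e, he, a, b, c, ha, hb, hc, hG, hD⟩, hp⟩

end Atlas

/-! ### Solitons on the manifold and their integral identities -/

section Soliton

variable {M : Type*} [TopologicalSpace M] [ChartedSpace E4 M] [IsManifold (𝓡 4) ∞ M]

/-- A soliton on a Walker manifold, with its scalar curvature `R` and the determinant `δ` of the
curvature of its null distribution. -/
structure WalkerSolitonData (g : PseudoMetric M) (D : ∀ p : M, Submodule ℝ (TangentSpace (𝓡 4) p))
    (X : ∀ p : M, TangentSpace (𝓡 4) p) (β₁ lam β₂ : ℝ) (R δ : M → ℝ) : Prop where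
  cover : ∀ p, ∃ K : WalkerChart g D, p ∈ K.e.source
  field : ∀ K : WalkerChart g D, ContDiffOn ℝ ∞ (components X K.e) K.e.target
  soliton : IsRicciYamabeSoliton g X β₁ lam β₂
  smooth_R : ContMDiff (𝓡 4) 𝓘(ℝ, ℝ) ∞ R
  R_eq : ∀ (K : WalkerChart g D) (x : tgt K.e), R (K.e.symm x) = evS x (K.scalS K.self_le)
  smooth_δ : ContMDiff (𝓡 4) 𝓘(ℝ, ℝ) ∞ δ
  δ_eq : ∀ (K : WalkerChart g D) (x : tgt K.e), δ (K.e.symm x) = evS x K.detS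

/-- A smooth function is basic if it is constant along the leaves of the null distribution. -/
structure IsBasic (g : PseudoMetric M) (D : ∀ p : M, Submodule ℝ (TangentSpace (𝓡 4) p))
    (h : M → ℝ) : Prop where
  smooth : ContMDiff (𝓡 4) 𝓘(ℝ, ℝ) ∞ h
  leaf : ∀ K : WalkerChart g D, dS 0 (K.loc smooth) = 0 ∧ dS 1 (K.loc smooth) = 0

variable {g : PseudoMetric M} {D : ∀ p : M, Submodule ℝ (TangentSpace (𝓡 4) p)}

theorem WalkerChart.loc_mul (K : WalkerChart g D) {h k : M → ℝ}
    (hh : ContMDiff (𝓡 4) 𝓘(ℝ, ℝ) ∞ h) (hk : ContMDiff (𝓡 4) 𝓘(ℝ, ℝ) ∞ k)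
    (hm : ContMDiff (𝓡 4) 𝓘(ℝ, ℝ) ∞ fun p => h p * k p) :
    K.loc hm = K.loc hh * K.loc hk := SmoothFun.ext_ev fun x => by
  rw [map_mul, evS_loc, evS_loc, evS_loc]

theorem WalkerChart.loc_add (K : WalkerChart g D) {h k : M → ℝ}
    (hh : ContMDiff (𝓡 4) 𝓘(ℝ, ℝ) ∞ h) (hk : ContMDiff (𝓡 4) 𝓘(ℝ, ℝ) ∞ k)
    (hm : ContMDiff (𝓡 4) 𝓘(ℝ, ℝ) ∞ fun p => h p + k p) :
    K.loc hm = K.loc hh + K.loc hk := SmoothFun.ext_ev fun x => by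
  rw [map_add, evS_loc, evS_loc, evS_loc]

theorem IsBasic.mul {h k : M → ℝ} (hh : IsBasic g D h) (hk : IsBasic g D k) :
    IsBasic g D fun p => h p * k p := by
  refine ⟨hh.smooth.mul hk.smooth, fun K => ?_⟩
  rw [K.loc_mul hh.smooth hk.smooth]
  simp [Derivation.leibniz, hh.leaf K, hk.leaf K]

theorem IsBasic.add {h k : M → ℝ} (hh : IsBasic g D h) (hk : IsBasic g D k) :
    IsBasic g D fun p => h p + k p := by
  refine ⟨hh.smooth.add hk.smooth, fun K => ?_⟩
  rw [K.loc_add hh.smooth hk.smooth]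
  simp [hh.leaf K, hk.leaf K]

theorem IsBasic.const (c : ℝ) : IsBasic g D fun _ : M => c := by
  refine ⟨contMDiff_const, fun K => ?_⟩
  have : K.loc (h := fun _ => c) contMDiff_const = constS c :=
    SmoothFun.ext_ev fun x => by rw [WalkerChart.evS_loc, evS_constS]
  rw [this]
  exact ⟨dS_constS _ _, dS_constS _ _⟩

namespace WalkerSolitonData

variable {X : ∀ p : M, TangentSpace (𝓡 4) p} {β₁ lam β₂ : ℝ} {R δ : M → ℝ}

/-- The components of the soliton field in a Walker chart. -/
def comp (H : WalkerSolitonData g D X β₁ lam β₂ R δ) (K : WalkerChart g D) :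
    Fin 4 → SmoothFun (tgt K.e) := K.compS K.self_le (H.field K)

theorem comp_ev (H : WalkerSolitonData g D X β₁ lam β₂ R δ)
    (K : WalkerChart g D) (x : tgt K.e) (k : Fin 4) :
    components X K.e x k = evS x (H.comp K k) := rfl

theorem loc_R (H : WalkerSolitonData g D X β₁ lam β₂ R δ)
    (K : WalkerChart g D) : K.loc H.smooth_R = K.scalS K.self_le :=
  SmoothFun.ext_ev fun x => by rw [K.evS_loc, H.R_eq]

theorem loc_δ (H : WalkerSolitonData g D X β₁ lam β₂ R δ)
    (K : WalkerChart g D) : K.loc H.smooth_δ = K.detS :=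
  SmoothFun.ext_ev fun x => by rw [K.evS_loc, H.δ_eq]

theorem factor_ev (H : WalkerSolitonData g D X β₁ lam β₂ R δ)
    (K : WalkerChart g D) (x : tgt K.e) :
    evS x (K.factorS K.self_le lam β₂) = β₂ * R (K.e.symm x) - 2 * lam := by
  rw [H.R_eq]
  simp only [WalkerChart.factorS, map_sub, map_mul, map_ofNat, evS_constS]

theorem leaf (H : WalkerSolitonData g D X β₁ lam β₂ R δ)
    (K : WalkerChart g D) : dS 0 (H.comp K 2) = 0 ∧
    dS 0 (H.comp K 3) = - dS 1 (H.comp K 2) ∧ dS 1 (H.comp K 3) = 0 :=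
  IsSolD.leaf (d := dS (U := tgt K.e)) (K.isSolD K.self_le (H.field K) H.soliton)

theorem twist (H : WalkerSolitonData g D X β₁ lam β₂ R δ)
    (K : WalkerChart g D) :
    dS 1 (H.comp K 2) * dS 0 (conn₁ (dS (U := tgt K.e)) (K.aS K.self_le) (K.bS K.self_le)) = 0 ∧
    dS 1 (H.comp K 2) * dS 0 (conn₂ (dS (U := tgt K.e)) (K.bS K.self_le) (K.cS K.self_le)) = 0 ∧
    dS 1 (H.comp K 2) * dS 1 (conn₁ (dS (U := tgt K.e)) (K.aS K.self_le) (K.bS K.self_le)) = 0 ∧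
    dS 1 (H.comp K 2) * dS 1 (conn₂ (dS (U := tgt K.e)) (K.bS K.self_le) (K.cS K.self_le)) = 0 :=
  (K.basic K.self_le (H.field K) H.soliton).2

theorem dirF_comp (H : WalkerSolitonData g D X β₁ lam β₂ R δ)
    {h : M → ℝ} (hh : ContMDiff (𝓡 4) 𝓘(ℝ, ℝ) ∞ h) (K : WalkerChart g D)
    (x : tgt K.e) :
    dirF X h (K.e.symm x) = evS x (dirD (dS (U := tgt K.e)) (H.comp K) (K.loc hh)) :=
  dirF_ev (H.comp_ev K) hh x

theorem smooth_dirF (H : WalkerSolitonData g D X β₁ lam β₂ R δ)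
    {h : M → ℝ} (hh : ContMDiff (𝓡 4) 𝓘(ℝ, ℝ) ∞ h) :
    ContMDiff (𝓡 4) 𝓘(ℝ, ℝ) ∞ (dirF X h) :=
  contMDiff_of_charts fun p =>
    let ⟨K, hK⟩ := H.cover p
    ⟨K.e, K.mem, hK, contDiffOn_dirF K.mem hh (H.field K)⟩

theorem loc_dirF (H : WalkerSolitonData g D X β₁ lam β₂ R δ)
    {h : M → ℝ} (hh : ContMDiff (𝓡 4) 𝓘(ℝ, ℝ) ∞ h) (K : WalkerChart g D) :
    K.loc (H.smooth_dirF hh) = dirD (dS (U := tgt K.e)) (H.comp K) (K.loc hh) :=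
  SmoothFun.ext_ev fun x => by rw [K.evS_loc, H.dirF_comp hh]

theorem isPush_comp (H : WalkerSolitonData g D X β₁ lam β₂ R δ)
    (K K' : WalkerChart g D) : IsPush (dS (U := ovl K.e K'.e)) (K.pull K') (K.newCoord K')
    (fun k => resS (K.ovl_le K') (H.comp K k)) (H.comp K') :=
  K.isPush_of_components K' (V := X) (fun x k => by rw [evS_resS, ← H.comp_ev])
    fun x k => (H.comp_ev K' x k).symm

/-- The variation of the scalar curvature along the soliton field. -/
theorem dirF_scalar (H : WalkerSolitonData g D X β₁ lam β₂ R δ)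
    (K : WalkerChart g D) (x : tgt K.e) :
    dirF X R (K.e.symm x) = - (β₂ * R (K.e.symm x) - 2 * lam) * R (K.e.symm x)
      + β₁ * (R (K.e.symm x) ^ 2 - 2 * δ (K.e.symm x))
      + β₁ * evS x (lapD (dS (U := tgt K.e)) (K.aS K.self_le) (K.bS K.self_le) (K.cS K.self_le)
        (K.scalS K.self_le)) := by
  rw [H.dirF_comp H.smooth_R, H.loc_R]
  have h := congrArg (evS x) (K.dirD_scalS K.self_le (H.field K) H.soliton)
  refine h.trans ?_
  simp only [map_add, map_mul, map_sub, map_neg, map_ofNat, evS_constS, H.factor_ev, ← H.R_eq]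
  rw [H.δ_eq K x, WalkerChart.detS, sq]

/-- The conformal factor `β₂ R - 2 λ` is basic, and `β₂ ≠ 0` allows solving for `R`. -/
theorem basic_R (H : WalkerSolitonData g D X β₁ lam β₂ R δ)
    (hβ : β₂ ≠ 0) : IsBasic g D R := by
  refine ⟨H.smooth_R, fun K => ?_⟩
  have h := (K.basic K.self_le (H.field K) H.soliton).1
  rw [H.loc_R]
  have key : ∀ i, dS i (K.factorS K.self_le lam β₂) = 0 → dS i (K.scalS K.self_le) = 0 := by
    intro i hi
    refine SmoothFun.ext_ev fun x => ?_
    have h1 := congrArg (evS x) hi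
    have n2 : dS i (2 : SmoothFun (tgt K.e)) = 0 := by exact_mod_cast (dS i).map_natCast 2
    rw [WalkerChart.factorS, map_sub, Derivation.leibniz, Derivation.leibniz, dS_constS, dS_constS,
      n2] at h1
    simp only [smul_eq_mul, mul_zero, add_zero, sub_zero, map_mul, evS_constS, map_zero] at h1
    rw [map_zero]
    exact (mul_eq_zero.1 h1).resolve_left hβ
  exact ⟨key 0 h.1, key 1 h.2⟩

/-- Every term of the Walker Laplacian contains a leafwise derivative of the function, so the
Laplacian of the basic function `R` vanishes. -/
theorem dirF_R (H : WalkerSolitonData g D X β₁ lam β₂ R δ)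
    (hβ : β₂ ≠ 0) (p : M) :
    dirF X R p = - (β₂ * R p - 2 * lam) * R p + β₁ * (R p ^ 2 - 2 * δ p) := by
  obtain ⟨K, hK⟩ := H.cover p
  obtain ⟨h0, h1⟩ := (H.basic_R hβ).leaf K
  rw [H.loc_R] at h0 h1
  have h := H.dirF_scalar K ⟨K.e p, K.e.map_source hK⟩
  have hl : lapD (dS (U := tgt K.e)) (K.aS K.self_le) (K.bS K.self_le) (K.cS K.self_le)
      (K.scalS K.self_le)
      = 0 := by
    rw [lapD, h0, h1]
    simp
  rw [hl, map_zero, mul_zero, add_zero] at h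
  simpa only [K.e.left_inv hK] using h

/-- The derivative of a basic function along the soliton field is basic if it is supported where
the field does not twist. -/
theorem basic_dirF (H : WalkerSolitonData g D X β₁ lam β₂ R δ)
    {h : M → ℝ} (hh : IsBasic g D h)
    (ht : ∀ K : WalkerChart g D, dS 1 (H.comp K 2) * K.loc hh.smooth = 0) :
    IsBasic g D (dirF X h) := by
  refine ⟨H.smooth_dirF hh.smooth, fun K => ?_⟩
  rw [H.loc_dirF hh.smooth]
  obtain ⟨h0, h1⟩ := hh.leaf K
  obtain ⟨l1, l2, l3⟩ := H.leaf K
  have hs : ∀ k, dS 1 (H.comp K 2) * dS k (K.loc hh.smooth) = 0 := fun k =>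
    mul_deriv_eq_zero (ht K) _
  have c : ∀ i k, dS i (K.loc hh.smooth) = 0 → dS i (dS k (K.loc hh.smooth)) = 0 :=
    fun i k hi => by rw [dS_comm, hi, map_zero]
  have h2 := hs 2
  have h3 := hs 3
  simp only [dirD, Fin.sum_univ_four, map_add, Derivation.leibniz, smul_eq_mul, c 0 _ h0, c 1 _ h1,
    h0, h1, l1, l2, l3, map_zero, mul_zero, zero_add, add_zero]
  exact ⟨by linear_combination -h3, by linear_combination h2⟩

theorem twist_R (H : WalkerSolitonData g D X β₁ lam β₂ R δ)
    (K : WalkerChart g D) : dS 1 (H.comp K 2) * K.loc H.smooth_R = 0 := by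
  rw [H.loc_R]
  exact (IsSolD.twist_mul_scalD (d := dS (U := tgt K.e)) dS_comm (fun i => dS_constS i β₁)
    (K.isSolD K.self_le (H.field K) H.soliton) :)

theorem twist_δ (H : WalkerSolitonData g D X β₁ lam β₂ R δ)
    (K : WalkerChart g D) : dS 1 (H.comp K 2) * K.loc H.smooth_δ = 0 := by
  obtain ⟨t1, t2, t3, t4⟩ := H.twist K
  rw [H.loc_δ, WalkerChart.detS, detD]
  linear_combination dS 1 (conn₂ (dS (U := tgt K.e)) (K.bS K.self_le) (K.cS K.self_le)) * t1
    - dS 1 (conn₁ (dS (U := tgt K.e)) (K.aS K.self_le) (K.bS K.self_le)) * t2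

/-- The variation formula for `R` is solved for `δ`; `X(R)` is again basic because the twist
annihilates `R`. -/
theorem basic_δ (H : WalkerSolitonData g D X β₁ lam β₂ R δ)
    (hβ₁ : β₁ ≠ 0) (hβ : β₂ ≠ 0) : IsBasic g D δ := by
  have hR := H.basic_R hβ
  have h := ((((IsBasic.const (β₂ * (-1))).mul hR).add (IsBasic.const (2 * lam))).mul hR).add
    (((IsBasic.const β₁).mul (hR.mul hR)).add ((IsBasic.const (-1)).mul
      (H.basic_dirF hR H.twist_R)))
  have h2 := (IsBasic.const (2 * β₁)⁻¹).mul h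
  convert h2 using 1
  ext p
  rw [H.dirF_R hβ]
  field_simp
  ring

theorem _root_.WalkerSoliton.WalkerAtlas.int_divD [T2Space M] [CompactSpace M] {ι : Type*}
    [Fintype ι] (𝒲 : WalkerAtlas g D ι) {V : ∀ p : M, TangentSpace (𝓡 4) p}
    {v : ∀ K : WalkerChart g D, Fin 4 → SmoothFun (tgt K.e)}
    (hv : ∀ (K : WalkerChart g D) (x : tgt K.e) k, components V K.e x k = evS x (v K k))
    {dv : M → ℝ} (hdv : ∀ (K : WalkerChart g D) (x : tgt K.e),
      dv (K.e.symm x) = evS x (divD (dS (U := tgt K.e)) (v K))) : 𝒲.unimod.int dv = 0 :=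
  𝒲.unimod.int_divergence (V := V) (fun i => contDiffOn_components_of_ev (hv (𝒲.K i)))
    fun i x hx => (hdv (𝒲.K i) ⟨x, hx⟩).trans (sum_pderiv_components (hv (𝒲.K i)) ⟨x, hx⟩).symm

/-- The divergence theorem for `h X`, with `div X = 2 φ - β₁ R`. -/
theorem int_dirF (H : WalkerSolitonData g D X β₁ lam β₂ R δ)
    [T2Space M] [CompactSpace M] {ι : Type*} [Fintype ι] (𝒲 : WalkerAtlas g D ι)
    {h : M → ℝ} (hh : ContMDiff (𝓡 4) 𝓘(ℝ, ℝ) ∞ h) :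
    𝒲.unimod.int (fun p => dirF X h p + h p * (2 * (β₂ * R p - 2 * lam) - β₁ * R p)) = 0 := by
  refine 𝒲.int_divD (V := fun p => h p • X p) (v := fun K k => K.loc hh * H.comp K k)
    (fun K x k => by rw [components_smul, map_mul, K.evS_loc, H.comp_ev]) fun K x => ?_
  rw [divD_mul, map_add, map_mul, ← H.dirF_comp, K.evS_loc]
  have h1 := K.divD_compS K.self_le (H.field K) H.soliton
  have h2 : evS x (divD (dS (U := tgt K.e)) (H.comp K)) = _ := congrArg (evS x) h1
  rw [h2]
  simp only [map_sub, map_mul, map_ofNat, evS_constS, H.factor_ev, ← H.R_eq]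

/-- By the variation formula the integrand is `β₁ ΔR`, and `ΔR` is the divergence of the gradient of
`R`. Since `R` need not be basic here, this also serves `β₂ = 0`. -/
theorem int_lap (H : WalkerSolitonData g D X β₁ lam β₂ R δ)
    [T2Space M] [CompactSpace M] {ι : Type*} [Fintype ι] (𝒲 : WalkerAtlas g D ι)
    (hβ₁ : β₁ ≠ 0) : 𝒲.unimod.int (fun p => dirF X R p
    + ((β₂ * R p - 2 * lam) * R p - β₁ * (R p ^ 2 - 2 * δ p))) = 0 := by
  have h := 𝒲.int_divD (V := gradient g R)
    (v := fun K => gradD (dS (U := tgt K.e)) (K.aS K.self_le) (K.bS K.self_le) (K.cS K.self_le)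
      (K.loc H.smooth_R))
    (dv := fun p => β₁⁻¹ * (dirF X R p + ((β₂ * R p - 2 * lam) * R p - β₁ * (R p ^ 2 - 2 * δ p))))
    ?_ ?_
  · rw [𝒲.unimod.int_const_mul] at h
    exact (mul_eq_zero.1 h).resolve_left (inv_ne_zero hβ₁)
  · intro K x k
    obtain ⟨h0, h1, h2, h3⟩ := K.components_gradient H.smooth_R x.2
    have hp : ∀ i, pderiv i (fun z => R (K.e.symm z)) x = evS x (dS i (K.loc H.smooth_R)) :=
      fun i => by rw [WalkerChart.loc, dS_mkS, evS_mkS]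
    simp only [hp] at h0 h1 h2 h3
    fin_cases k
    · exact h0.trans (by simp [gradD, WalkerChart.aS, WalkerChart.bS])
    · exact h1.trans (by simp [gradD, WalkerChart.bS, WalkerChart.cS])
    · exact h2
    · exact h3
  · intro K x
    have h := divD_gradD (d := dS (U := tgt K.e)) dS_comm (K.aS K.self_le) (K.bS K.self_le)
      (K.cS K.self_le) (K.loc H.smooth_R)
    rw [h, H.dirF_scalar K x, H.loc_R]
    field_simp
    ring

/-- The Hamiltonian field of a basic function in a Walker chart. -/
def _root_.WalkerSoliton.WalkerChart.hamS (K : WalkerChart g D) {h : M → ℝ}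
    (hh : ContMDiff (𝓡 4) 𝓘(ℝ, ℝ) ∞ h) : Fin 4 → SmoothFun (tgt K.e) :=
  hamD (dS (U := tgt K.e)) (conn₁ (dS (U := tgt K.e)) (K.aS K.self_le) (K.bS K.self_le))
    (conn₂ (dS (U := tgt K.e)) (K.bS K.self_le) (K.cS K.self_le)) (K.loc hh)

/-- The trace of the soliton field on the normal bundle in a Walker chart. -/
def traceS (H : WalkerSolitonData g D X β₁ lam β₂ R δ) (K : WalkerChart g D) :
    SmoothFun (tgt K.e) :=
  normalTrace (dS (U := tgt K.e)) (conn₁ (dS (U := tgt K.e)) (K.aS K.self_le) (K.bS K.self_le))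
    (conn₂ (dS (U := tgt K.e)) (K.bS K.self_le) (K.cS K.self_le)) (H.comp K)

theorem _root_.WalkerSoliton.WalkerChart.resS_hamS (K K' : WalkerChart g D) {h : M → ℝ}
    (hh : ContMDiff (𝓡 4) 𝓘(ℝ, ℝ) ∞ h) (k : Fin 4) :
    resS (K.ovl_le K') (K.hamS hh k) = hamD (dS (U := ovl K.e K'.e))
      (conn₁ (dS (U := ovl K.e K'.e)) (K.aS (K.ovl_le K')) (K.bS (K.ovl_le K')))
      (conn₂ (dS (U := ovl K.e K'.e)) (K.bS (K.ovl_le K')) (K.cS (K.ovl_le K')))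
      (K.pull K' (K'.loc hh)) k := by
  obtain ⟨c1, c2⟩ := K.resS_conn K'
  have := map_hamD (d := dS (U := tgt K.e)) (d' := dS (U := ovl K.e K'.e))
    (r := resS (K.ovl_le K')) (resS_dS (K.ovl_le K'))
    (conn₁ (dS (U := tgt K.e)) (K.aS K.self_le) (K.bS K.self_le))
    (conn₂ (dS (U := tgt K.e)) (K.bS K.self_le) (K.cS K.self_le)) (K.loc hh) k
  rw [c1, c2, K.resS_loc] at this
  exact this

theorem resS_traceS (H : WalkerSolitonData g D X β₁ lam β₂ R δ) (K K' : WalkerChart g D) :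
    resS (K.ovl_le K') (H.traceS K) = normalTrace (dS (U := ovl K.e K'.e))
      (conn₁ (dS (U := ovl K.e K'.e)) (K.aS (K.ovl_le K')) (K.bS (K.ovl_le K')))
      (conn₂ (dS (U := ovl K.e K'.e)) (K.bS (K.ovl_le K')) (K.cS (K.ovl_le K')))
      (fun k => resS (K.ovl_le K') (H.comp K k)) := by
  obtain ⟨c1, c2⟩ := K.resS_conn K'
  have := map_normalTrace (d := dS (U := tgt K.e)) (d' := dS (U := ovl K.e K'.e))
    (r := resS (K.ovl_le K')) (resS_dS (K.ovl_le K'))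
    (conn₁ (dS (U := tgt K.e)) (K.aS K.self_le) (K.bS K.self_le))
    (conn₂ (dS (U := tgt K.e)) (K.bS K.self_le) (K.cS K.self_le)) (H.comp K)
  rw [c1, c2] at this
  exact this

theorem twist_hamS (H : WalkerSolitonData g D X β₁ lam β₂ R δ) (K : WalkerChart g D) {h : M → ℝ}
    (hh : IsBasic g D h) (l : Fin 4) : dS 1 (H.comp K 2) * K.hamS hh.smooth l = 0 := by
  obtain ⟨t1, t2, t3, t4⟩ := H.twist K
  obtain ⟨h0, h1⟩ := hh.leaf K
  fin_cases l
  · simp only [WalkerChart.hamS, hamD, Fin.zero_eta, Matrix.cons_val, h0, h1]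
    linear_combination dS 2 (K.loc hh.smooth) * t4 - dS 3 (K.loc hh.smooth) * t3
  · simp only [WalkerChart.hamS, hamD, Fin.mk_one, Matrix.cons_val, h0, h1]
    linear_combination dS 3 (K.loc hh.smooth) * t1 - dS 2 (K.loc hh.smooth) * t2
  · simp [WalkerChart.hamS, hamD, h0, h1]
  · simp [WalkerChart.hamS, hamD, h0, h1]

/-- The normal trace alone is not invariant where the field twists; the product is, because the
twist annihilates the Hamiltonian field of a basic function. -/
theorem isPush_traceS_mul_hamS (H : WalkerSolitonData g D X β₁ lam β₂ R δ) (K K' : WalkerChart g D)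
    {h : M → ℝ} (hh : IsBasic g D h) : IsPush (dS (U := ovl K.e K'.e)) (K.pull K') (K.newCoord K')
      (fun k => resS (K.ovl_le K') (H.traceS K * K.hamS hh.smooth k))
      (fun k => H.traceS K' * K'.hamS hh.smooth k) := by
  have hd := resS_dS (K.ovl_le K')
  obtain ⟨l1, l2, l3⟩ := H.leaf K
  intro k
  have p1 := (K.trans K').isPush_hamD (K'.loc hh.smooth) k
  rw [map_mul]
  refine (congrArg (K.pull K' (H.traceS K') * ·) p1).trans ?_
  rw [Finset.mul_sum]
  refine Finset.sum_congr rfl fun l _ => ?_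
  have n1 := (K.trans K').normalTrace_eq (H.isPush_comp K K')
    (r := resS (K.ovl_le K') (K.hamS hh.smooth l)) (by rw [← hd, l1, map_zero])
    (by rw [← hd, ← hd, l2, map_neg]) (by rw [← hd, l3, map_zero])
    (by rw [← hd, ← map_mul, H.twist_hamS K hh l, map_zero])
  rw [← H.resS_traceS K K', K.resS_hamS K'] at n1
  beta_reduce
  rw [map_mul, K.resS_hamS K', ← mul_assoc]
  exact congrArg (· * dS l (K.newCoord K' k)) n1

/-- For a basic function `h` the field `traceS · hamS h` has divergence `-δ X(h)`. -/
theorem int_det_mul_dirF (H : WalkerSolitonData g D X β₁ lam β₂ R δ) [T2Space M] [CompactSpace M]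
    {ι : Type*} [Fintype ι] (𝒲 : WalkerAtlas g D ι) {h : M → ℝ} (hh : IsBasic g D h) :
    𝒲.unimod.int (fun p => δ p * dirF X h p) = 0 := by
  obtain ⟨V, hV⟩ := exists_field H.cover (fun K k => H.traceS K * K.hamS hh.smooth k)
    fun K K' => H.isPush_traceS_mul_hamS K K' hh
  have key := 𝒲.int_divD hV (dv := fun p => -1 * (δ p * dirF X h p)) fun K x => ?_
  · rw [𝒲.unimod.int_const_mul] at key
    linarith
  · obtain ⟨l1, l2, l3⟩ := H.leaf K
    obtain ⟨t1, t2, t3, t4⟩ := H.twist K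
    obtain ⟨h0, h1⟩ := hh.leaf K
    have sw : ∀ {r : SmoothFun (tgt K.e)}, dS 1 (H.comp K 2) * r = 0 →
        ∀ j, dS j (dS 1 (H.comp K 2)) * r = 0 := fun {r} hr j => by
      rw [mul_comm] at hr ⊢
      exact mul_deriv_eq_zero hr _
    have := divD_normalTrace_hamD (d := dS (U := tgt K.e)) dS_comm l1 l2 l3 (sw t1) (sw t2)
      (sw t3) (sw t4) t1 t2 t3 t4 h0 h1
    refine Eq.trans ?_ (congrArg (evS x) this).symm
    rw [map_neg, map_mul, ← H.dirF_comp, H.δ_eq K x, WalkerChart.detS]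
    ring

end WalkerSolitonData

end Soliton

/-! ### A global density of the normal bundle and the vanishing of `∫ δ` -/

section Density

variable {M : Type*} [TopologicalSpace M] [ChartedSpace E4 M] [IsManifold (𝓡 4) ∞ M]
variable {g : PseudoMetric M} {D : ∀ p : M, Submodule ℝ (TangentSpace (𝓡 4) p)}

/-- The Jacobian determinant of the transverse coordinate change between two Walker charts. -/
def jacN (e e' : OpenPartialHomeomorph M E4) (x : E4) : ℝ :=
  pderiv 2 (fun z => coordChange e e' z 2) x * pderiv 3 (fun z => coordChange e e' z 3) x
    - pderiv 3 (fun z => coordChange e e' z 2) x * pderiv 2 (fun z => coordChange e e' z 3) x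

namespace WalkerChart

variable (K K' K'' : WalkerChart g D)

theorem jacN_ev (x : ovl K.e K'.e) :
    jacN K.e K'.e x = evS x (normalJac (dS (U := ovl K.e K'.e)) (K.newCoord K')) := by
  simp only [jacN, normalJac, map_sub, map_mul, evS_dS_newCoord]

theorem contDiffOn_jacN : ContDiffOn ℝ ∞ (jacN K.e K'.e) (ovl K.e K'.e) :=
  (extS_contDiffOn (normalJac (dS (U := ovl K.e K'.e)) (K.newCoord K'))).congr fun x hx =>
    (K.jacN_ev K' ⟨x, hx⟩).trans
      (extS_apply (normalJac (dS (U := ovl K.e K'.e)) (K.newCoord K')) ⟨x, hx⟩).symm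

theorem jacN_ne_zero {x : E4} (hx : x ∈ ovl K.e K'.e) : jacN K.e K'.e x ≠ 0 := by
  have h := congrArg (evS ⟨x, hx⟩) (K.trans K').jac_mul
  rw [map_mul, map_one, ← K.jacN_ev K' ⟨x, hx⟩] at h
  exact left_ne_zero_of_mul_eq_one h

/-- Walker coordinate changes are block triangular, so the chain rule closes on the transverse
blocks, and determinants multiply. -/
theorem jacN_cocycle {x : E4} (hx : x ∈ ovl K.e K'.e) (hx' : K.e.symm x ∈ K''.e.source) :
    jacN K.e K''.e x = jacN K.e K'.e x * jacN K'.e K''.e (coordChange K.e K'.e x) := by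
  have h1 : coordChange K.e K'.e x ∈ ovl K'.e K''.e :=
    mem_ovl.2 ⟨coordChange_mem hx, by rwa [symm_coordChange hx]⟩
  have hd := (contDiffOn_coordChange K.mem K'.mem).differentiableAt_open hx
  have hd' := (contDiffOn_coordChange K'.mem K''.mem).differentiableAt_open h1
  have h2 : ∀ m : Fin 4, (fun z => coordChange K.e K''.e z m) =ᶠ[nhds x]
      fun z => coordChange K'.e K''.e (coordChange K.e K'.e z) m := by
    intro m
    filter_upwards [(ovl K.e K'.e).isOpen.mem_nhds hx] with z hz
    rw [coordChange, coordChange, symm_coordChange hz]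
  have h3 : ∀ k m : Fin 4, pderiv k (fun z => coordChange K.e K''.e z m) x
      = ∑ l, pderiv l (fun z => coordChange K'.e K''.e z m) (coordChange K.e K'.e x)
        * pderiv k (fun z => coordChange K.e K'.e z l) x := by
    intro k m
    have hm := ((contDiffOn_coord (contDiffOn_coordChange K'.mem K''.mem) m)).differentiableAt_open
      h1
    rw [← pderiv_comp hm hd k, pderiv, (h2 m).fderiv_eq]
    rfl
  obtain ⟨a2, a3⟩ := K'.fderiv_coordChange_leaf K'' h1 (k := 0) (.inl rfl)
  obtain ⟨b2, b3⟩ := K'.fderiv_coordChange_leaf K'' h1 (k := 1) (.inr rfl)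
  rw [fderiv_stdBasis hd'] at a2 a3 b2 b3
  simp only [jacN, h3, Fin.sum_univ_four, a2, a3, b2, b3]
  ring

end WalkerChart

variable [T2Space M] [CompactSpace M] {ι : Type*} [Fintype ι] (𝒲 : WalkerAtlas g D ι)

namespace WalkerAtlas

/-- A positive density of the normal bundle of the null distribution. -/
def density (K : WalkerChart g D) (x : E4) : ℝ :=
  ∑ i, 𝒲.ρ i (K.e.symm x) * jacN K.e (𝒲.K i).e x ^ 2

/-- The Jacobian of a summand is controlled only on an overlap, but outside the support of `ρ i` the
summand vanishes on a neighbourhood. -/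
theorem contDiffOn_density (K : WalkerChart g D) :
    ContDiffOn ℝ ∞ (𝒲.density K) (tgt K.e) := by
  refine ContDiffOn.sum fun i _ x hx => ?_
  by_cases h : K.e.symm x ∈ tsupport (𝒲.ρ i)
  · have hx' : x ∈ ovl K.e (𝒲.K i).e := mem_ovl.2 ⟨hx, 𝒲.sub i h⟩
    have h1 := (K.contDiffOn_comp_symm (𝒲.ρ i).contMDiff) x hx
    have h2 := ((K.contDiffOn_jacN (𝒲.K i)).contDiffAt
      ((ovl K.e (𝒲.K i).e).isOpen.mem_nhds hx')).contDiffWithinAt (s := tgt K.e)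
    exact h1.mul (h2.pow 2)
  · have h1 : ∀ᶠ z in nhds x, K.e.symm z ∉ tsupport (𝒲.ρ i) :=
      (K.e.continuousAt_symm hx).eventually ((isClosed_tsupport _).isOpen_compl.mem_nhds h)
    refine ContDiffAt.contDiffWithinAt (ContDiffAt.congr_of_eventuallyEq (f := fun _ => (0 : ℝ))
      contDiffAt_const ?_)
    filter_upwards [h1] with z hz
    rw [image_eq_zero_of_notMem_tsupport hz, zero_mul]

theorem density_pos (K : WalkerChart g D) {x : E4} (hx : x ∈ tgt K.e) : 0 < 𝒲.density K x := by
  obtain ⟨i, hi⟩ := 𝒲.unimod.exists_pos (K.e.symm x)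
  have hx' : x ∈ ovl K.e (𝒲.K i).e := mem_ovl.2 ⟨hx, 𝒲.unimod.mem_source hi.ne'⟩
  refine Finset.sum_pos' (fun j _ => mul_nonneg (𝒲.ρ.nonneg j _) (sq_nonneg _))
    ⟨i, Finset.mem_univ i, ?_⟩
  exact mul_pos hi (sq_pos_of_ne_zero (K.jacN_ne_zero (𝒲.K i) hx'))

theorem density_coordChange (K K' : WalkerChart g D) {x : E4} (hx : x ∈ ovl K.e K'.e) :
    𝒲.density K x = jacN K.e K'.e x ^ 2 * 𝒲.density K' (coordChange K.e K'.e x) := by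
  rw [density, density, Finset.mul_sum]
  refine Finset.sum_congr rfl fun i _ => ?_
  rw [symm_coordChange hx]
  by_cases h : 𝒲.ρ i (K.e.symm x) = 0
  · simp [h]
  · rw [K.jacN_cocycle K' (𝒲.K i) hx (𝒲.unimod.mem_source h)]
    ring

/-- The density as an element of the ring of smooth functions. -/
def densS (K : WalkerChart g D) : SmoothFun (tgt K.e) := mkS _ (𝒲.contDiffOn_density K)

/-- The inverse of the density. -/
def densInvS (K : WalkerChart g D) : SmoothFun (tgt K.e) :=
  mkS (fun x => (𝒲.density K x)⁻¹)
    ((𝒲.contDiffOn_density K).inv fun _ hx => (𝒲.density_pos K hx).ne')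

theorem densS_mul_densInvS (K : WalkerChart g D) : 𝒲.densS K * 𝒲.densInvS K = 1 :=
  SmoothFun.ext_ev fun x => by
    rw [map_mul, map_one, densS, densInvS, evS_mkS, evS_mkS]
    exact mul_inv_cancel₀ (𝒲.density_pos K x.2).ne'

theorem resS_densS (K K' : WalkerChart g D) : resS (K.ovl_le K') (𝒲.densS K)
    = normalJac (dS (U := ovl K.e K'.e)) (K.newCoord K') ^ 2 * K.pull K' (𝒲.densS K') :=
  SmoothFun.ext_ev fun x => by
    rw [evS_resS, map_mul, map_pow, ← K.jacN_ev K', K.evS_pull K', densS, densS, evS_mkS, evS_mkS]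
    exact 𝒲.density_coordChange K K' x.2

theorem resS_densInvS (K K' : WalkerChart g D) : resS (K.ovl_le K') (𝒲.densInvS K)
    = leafJac (dS (U := ovl K.e K'.e)) (K.newCoord K') ^ 2 * K.pull K' (𝒲.densInvS K') := by
  have h1 := 𝒲.resS_densS K K'
  have h2 := congrArg (resS (K.ovl_le K')) (𝒲.densS_mul_densInvS K)
  have h3 := congrArg (K.pull K') (𝒲.densS_mul_densInvS K')
  have h4 := (K.trans K').jac_mul
  rw [map_mul, map_one, h1] at h2
  rw [map_mul, map_one] at h3
  generalize resS (K.ovl_le K') (𝒲.densInvS K) = u at *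
  generalize K.pull K' (𝒲.densS K') = s at *
  generalize K.pull K' (𝒲.densInvS K') = t at *
  generalize normalJac (dS (U := ovl K.e K'.e)) (K.newCoord K') = n at *
  generalize leafJac (dS (U := ovl K.e K'.e)) (K.newCoord K') = l at *
  linear_combination l ^ 2 * t * h2 - u * h3 - u * s * t * (n * l + 1) * h4

/-- With a density `S` scaling by `Δ²`, the form `w + d log S` is globally defined and has the same
differential as `w`. The field `v` is dual, up to sign, to `(w + d log S) ∧ dw`, so `2 δ` is a
divergence. -/
theorem int_det_eq_zero (hcov : ∀ p, ∃ K : WalkerChart g D, p ∈ K.e.source) {δ : M → ℝ}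
    (hδ : ∀ (K : WalkerChart g D) (x : tgt K.e), δ (K.e.symm x) = evS x K.detS) :
    𝒲.unimod.int δ = 0 := by
  let v : ∀ K : WalkerChart g D, Fin 4 → SmoothFun (tgt K.e) := fun K k =>
    connField (dS (U := tgt K.e)) (conn₁ (dS (U := tgt K.e)) (K.aS K.self_le) (K.bS K.self_le))
        (conn₂ (dS (U := tgt K.e)) (K.bS K.self_le) (K.cS K.self_le)) k
      + 𝒲.densInvS K * hamD (dS (U := tgt K.e))
        (conn₁ (dS (U := tgt K.e)) (K.aS K.self_le) (K.bS K.self_le))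
        (conn₂ (dS (U := tgt K.e)) (K.bS K.self_le) (K.cS K.self_le)) (𝒲.densS K) k
  obtain ⟨V, hV⟩ := exists_field hcov v fun K K' => by
    have h := (K.trans K').isPush_connField_add (𝒲.resS_densS K K') (𝒲.resS_densInvS K K')
      (𝒲.densS_mul_densInvS K')
    have e : ∀ k, resS (K.ovl_le K') (v K k) = connField (dS (U := ovl K.e K'.e))
          (conn₁ (dS (U := ovl K.e K'.e)) (K.aS (K.ovl_le K')) (K.bS (K.ovl_le K')))
          (conn₂ (dS (U := ovl K.e K'.e)) (K.bS (K.ovl_le K')) (K.cS (K.ovl_le K'))) k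
        + resS (K.ovl_le K') (𝒲.densInvS K) * hamD (dS (U := ovl K.e K'.e))
          (conn₁ (dS (U := ovl K.e K'.e)) (K.aS (K.ovl_le K')) (K.bS (K.ovl_le K')))
          (conn₂ (dS (U := ovl K.e K'.e)) (K.bS (K.ovl_le K')) (K.cS (K.ovl_le K')))
          (resS (K.ovl_le K') (𝒲.densS K)) k := by
      intro k
      obtain ⟨c1, c2⟩ := K.resS_conn K'
      have m1 := map_connField (d := dS (U := tgt K.e)) (d' := dS (U := ovl K.e K'.e))
        (r := resS (K.ovl_le K')) (resS_dS (K.ovl_le K'))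
        (conn₁ (dS (U := tgt K.e)) (K.aS K.self_le) (K.bS K.self_le))
        (conn₂ (dS (U := tgt K.e)) (K.bS K.self_le) (K.cS K.self_le)) k
      have m2 := map_hamD (d := dS (U := tgt K.e)) (d' := dS (U := ovl K.e K'.e))
        (r := resS (K.ovl_le K')) (resS_dS (K.ovl_le K'))
        (conn₁ (dS (U := tgt K.e)) (K.aS K.self_le) (K.bS K.self_le))
        (conn₂ (dS (U := tgt K.e)) (K.bS K.self_le) (K.cS K.self_le)) (𝒲.densS K) k
      rw [c1, c2] at m1 m2
      rw [map_add, map_mul, m1, m2]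
    simp only [e]
    exact h
  have key := 𝒲.int_divD hV (dv := fun p => 2 * δ p) fun K x => ?_
  · rw [𝒲.unimod.int_const_mul] at key
    linarith
  · have h := divD_connField_add (d := dS (U := tgt K.e)) dS_comm (a := K.aS K.self_le)
      (b := K.bS K.self_le) (c := K.cS K.self_le) (𝒲.densS_mul_densInvS K)
    refine Eq.trans ?_ (congrArg (evS x) h).symm
    rw [map_mul, map_ofNat, hδ K x, WalkerChart.detS]

end WalkerAtlas

end Density

/-! ### Calculus of directional derivatives -/

section Calculus

variable {M : Type*} [TopologicalSpace M] [ChartedSpace E4 M] [IsManifold (𝓡 4) ∞ M]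

theorem UnimodularAtlas.int_lin [T2Space M] [CompactSpace M] {ι : Type*} [Fintype ι]
    (𝒜 : UnimodularAtlas M ι) (a b : ℝ) {F G : M → ℝ} (hF : Continuous F) (hG : Continuous G) :
    𝒜.int (fun p => a * F p + b * G p) = a * 𝒜.int F + b * 𝒜.int G := by
  rw [𝒜.int_add (hF.const_mul a) (hG.const_mul b), 𝒜.int_const_mul, 𝒜.int_const_mul]

theorem UnimodularAtlas.int_one_pos [T2Space M] [CompactSpace M] [Nonempty M] {ι : Type*}
    [Fintype ι] (𝒜 : UnimodularAtlas M ι) : 0 < 𝒜.int fun _ => 1 := by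
  refine lt_of_le_of_ne (𝒜.int_nonneg fun _ => zero_le_one) fun h => ?_
  obtain ⟨p⟩ := ‹Nonempty M›
  exact one_ne_zero (𝒜.eq_zero_of_int_eq_zero continuous_const (fun _ => zero_le_one) h.symm p)

/-- A curve with velocity `X p` at `p`, straight in a chart, reduces the rules for `dirF` to
one-variable calculus. -/
theorem exists_curve (X : ∀ p : M, TangentSpace (𝓡 4) p) (p : M) : ∃ γ : ℝ → M, γ 0 = p ∧
    ∀ h : M → ℝ, ContMDiff (𝓡 4) 𝓘(ℝ, ℝ) ∞ h → HasDerivAt (fun t => h (γ t)) (dirF X h p) 0 := by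
  let e := chartAt E4 p
  have he : e ∈ IsManifold.maximalAtlas (𝓡 4) ∞ M := IsManifold.chart_mem_maximalAtlas p
  have hp : p ∈ e.source := mem_chart_source E4 p
  refine ⟨fun t => e.symm (e p + t • components X e (e p)), ?_, fun h hh => ?_⟩
  · simp [e.left_inv hp]
  · have hx : e p ∈ e.target := e.map_source hp
    have h1 := ((contDiffOn_chart he hh).differentiableAt_open (U := tgt e) hx).hasFDerivAt
    have h2 : HasDerivAt (fun t : ℝ => e p + t • components X e (e p)) (components X e (e p)) 0 := by
      simpa using ((hasDerivAt_id (0 : ℝ)).smul_const (components X e (e p))).const_add (e p)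
    have h3 : HasFDerivAt (fun z => h (e.symm z)) (fderiv ℝ (fun z => h (e.symm z)) (e p))
        (e p + (0 : ℝ) • components X e (e p)) := by simpa using h1
    have h4 := h3.comp_hasDerivAt (0 : ℝ) h2
    rw [← dirF_symm he X hh hx, e.left_inv hp] at h4
    exact h4

theorem dirF_mul {X : ∀ p : M, TangentSpace (𝓡 4) p} {h k : M → ℝ}
    (hh : ContMDiff (𝓡 4) 𝓘(ℝ, ℝ) ∞ h) (hk : ContMDiff (𝓡 4) 𝓘(ℝ, ℝ) ∞ k) (p : M) :
    dirF X (fun q => h q * k q) p = dirF X h p * k p + h p * dirF X k p := by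
  obtain ⟨γ, h0, hγ⟩ := exists_curve X p
  have := ((hγ h hh).mul (hγ k hk)).unique (hγ _ (hh.mul hk))
  rw [h0] at this
  exact this.symm

theorem dirF_const {X : ∀ p : M, TangentSpace (𝓡 4) p} (c : ℝ) (p : M) :
    dirF X (fun _ => c) p = 0 := by
  obtain ⟨γ, h0, hγ⟩ := exists_curve X p
  exact (hγ _ contMDiff_const).unique (hasDerivAt_const _ _)

theorem dirF_pow {X : ∀ p : M, TangentSpace (𝓡 4) p} {h : M → ℝ}
    (hh : ContMDiff (𝓡 4) 𝓘(ℝ, ℝ) ∞ h) (n : ℕ) (p : M) :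
    dirF X (fun q => h q ^ n) p = n * h p ^ (n - 1) * dirF X h p := by
  obtain ⟨γ, h0, hγ⟩ := exists_curve X p
  have := ((hγ h hh).pow n).unique (hγ _ (hh.pow n))
  rw [h0] at this
  exact this.symm

variable {g : PseudoMetric M} {D : ∀ p : M, Submodule ℝ (TangentSpace (𝓡 4) p)}

theorem contMDiff_rpow {h : M → ℝ} (hh : ContMDiff (𝓡 4) 𝓘(ℝ, ℝ) ∞ h) (h0 : ∀ p, 0 < h p)
    (s : ℝ) : ContMDiff (𝓡 4) 𝓘(ℝ, ℝ) ∞ fun p => h p ^ s := fun p =>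
  ((Real.contDiffAt_rpow_const_of_ne (h0 p).ne').contMDiffAt).comp p (hh p)

theorem IsBasic.rpow {h : M → ℝ} (hh : IsBasic g D h) (h0 : ∀ p, 0 < h p) (s : ℝ) :
    IsBasic g D fun p => h p ^ s := by
  refine ⟨contMDiff_rpow hh.smooth h0 s, fun K => ?_⟩
  have key : ∀ i, dS i (K.loc hh.smooth) = 0 →
      dS i (K.loc (contMDiff_rpow hh.smooth h0 s)) = 0 := by
    intro i hi
    refine SmoothFun.ext_ev fun x => ?_
    have h1 := congrArg (evS x) hi
    rw [WalkerChart.loc, dS_mkS, evS_mkS, map_zero] at h1 ⊢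
    have h2 := ((K.contDiffOn_comp_symm hh.smooth).differentiableAt_open x.2).hasFDerivAt
    have h3 := (Real.hasDerivAt_rpow_const (p := s)
      (Or.inl (h0 (K.e.symm x)).ne')).comp_hasFDerivAt (x : E4) h2
    rw [pderiv] at h1 ⊢
    erw [h3.fderiv]
    simp [h1]
  exact ⟨key 0 (hh.leaf K).1, key 1 (hh.leaf K).2⟩

end Calculus

/-! ### The integral argument: cases of `β₁` and `β₂` -/

namespace WalkerSolitonData

variable {M : Type*} [TopologicalSpace M] [ChartedSpace E4 M] [IsManifold (𝓡 4) ∞ M]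
variable {g : PseudoMetric M} {D : ∀ p : M, Submodule ℝ (TangentSpace (𝓡 4) p)}
variable {X : ∀ p : M, TangentSpace (𝓡 4) p} {β₁ lam β₂ : ℝ} {R δ : M → ℝ}
variable [T2Space M] [CompactSpace M] {ι : Type*} [Fintype ι]

theorem continuous_R (H : WalkerSolitonData g D X β₁ lam β₂ R δ) : Continuous R :=
  H.smooth_R.continuous

theorem continuous_δ (H : WalkerSolitonData g D X β₁ lam β₂ R δ) : Continuous δ :=
  H.smooth_δ.continuous

theorem continuous_dirF (H : WalkerSolitonData g D X β₁ lam β₂ R δ) {h : M → ℝ}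
    (hh : ContMDiff (𝓡 4) 𝓘(ℝ, ℝ) ∞ h) : Continuous (dirF X h) := (H.smooth_dirF hh).continuous

theorem int_one (H : WalkerSolitonData g D X β₁ lam β₂ R δ) (𝒲 : WalkerAtlas g D ι) :
    (2 * β₂ - β₁) * 𝒲.unimod.int R = 4 * lam * 𝒲.unimod.int fun _ => 1 := by
  have h := H.int_dirF 𝒲 (h := fun _ => 1) contMDiff_const
  have e : (fun p => dirF X (fun _ => 1) p + 1 * (2 * (β₂ * R p - 2 * lam) - β₁ * R p))
      = fun p => (2 * β₂ - β₁) * R p + (-4 * lam) * 1 := by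
    ext p
    rw [dirF_const]
    ring
  rw [e, 𝒲.unimod.int_lin _ _ H.continuous_R continuous_const] at h
  linarith

/-- The case in which the conformal factor is constant. -/
theorem lam_eq_zero_of_right_eq_zero [Nonempty M]
    (H : WalkerSolitonData g D X β₁ lam β₂ R δ) (𝒲 : WalkerAtlas g D ι) (hβ : β₂ = 0) :
    lam = 0 := by
  have hV := 𝒲.unimod.int_one_pos
  have h1 := H.int_one 𝒲
  by_cases hβ₁ : β₁ = 0
  · simp only [hβ, hβ₁, mul_zero, sub_zero, zero_mul] at h1
    have := (mul_eq_zero.1 h1.symm).resolve_right hV.ne'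
    linarith
  · by_contra hl
    have hR := H.continuous_R
    have hδ := H.continuous_δ
    have hX := H.continuous_dirF H.smooth_R
    have h2 := H.int_dirF 𝒲 H.smooth_R
    have h3 := H.int_lap 𝒲 hβ₁
    have h4 := 𝒲.int_det_eq_zero H.cover H.δ_eq
    -- The divergence of `R X` minus `β₁ ΔR`: with `φ = -2 λ` constant, `X(R)` and the `R²` terms
    -- cancel, leaving `-2 λ R - 2 β₁ δ`.
    have h5 := 𝒲.unimod.int_sub (F := fun p => dirF X R p
      + R p * (2 * (β₂ * R p - 2 * lam) - β₁ * R p)) (G := fun p => dirF X R p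
      + ((β₂ * R p - 2 * lam) * R p - β₁ * (R p ^ 2 - 2 * δ p))) (by fun_prop) (by fun_prop)
    have e : (fun p => (dirF X R p + R p * (2 * (β₂ * R p - 2 * lam) - β₁ * R p))
        - (dirF X R p + ((β₂ * R p - 2 * lam) * R p - β₁ * (R p ^ 2 - 2 * δ p))))
        = fun p => (-2 * lam) * R p + (-2 * β₁) * δ p := by
      ext p
      rw [hβ]
      ring
    rw [h2, h3, e, 𝒲.unimod.int_lin _ _ hR hδ, h4] at h5
    have h6 : 𝒲.unimod.int R = 0 := by
      have : lam * 𝒲.unimod.int R = 0 := by linarith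
      exact (mul_eq_zero.1 this).resolve_left hl
    rw [h6, mul_zero] at h1
    have := (mul_eq_zero.1 h1.symm).resolve_right hV.ne'
    exact hl (by linarith)

theorem factor_eq_zero_of_left_eq_zero
    (H : WalkerSolitonData g D X β₁ lam β₂ R δ) (𝒲 : WalkerAtlas g D ι) (hβ₁ : β₁ = 0)
    (hβ : β₂ ≠ 0) (p : M) : β₂ * R p - 2 * lam = 0 := by
  have hR := H.continuous_R
  -- The test function is `φ - 2 λ`. With `X(R) = -φ R` the integrand is `φ² - 3 λ div X`, and the
  -- last term integrates to zero.
  have h1 := H.int_dirF 𝒲 (h := fun p => β₂ * R p + (-4 * lam))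
    ((contMDiff_const.mul H.smooth_R).add contMDiff_const)
  have e : (fun p => dirF X (fun p => β₂ * R p + (-4 * lam)) p
      + (β₂ * R p + (-4 * lam)) * (2 * (β₂ * R p - 2 * lam) - β₁ * R p))
      = fun p => 1 * (β₂ * R p - 2 * lam) ^ 2
        + (-3 * lam) * (2 * (β₂ * R p - 2 * lam) - β₁ * R p) := by
    ext p
    obtain ⟨γ, h0, hγ⟩ := exists_curve X p
    have : β₂ * dirF X R p = dirF X (fun p => β₂ * R p + (-4 * lam)) p :=
      (((hγ R H.smooth_R).const_mul β₂).add_const (-4 * lam)).unique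
        (hγ _ ((contMDiff_const.mul H.smooth_R).add contMDiff_const))
    rw [← this, H.dirF_R hβ, hβ₁]
    ring
  have h2 := H.int_dirF 𝒲 (h := fun _ => 1) contMDiff_const
  simp only [dirF_const, zero_add, one_mul] at h2
  rw [e, 𝒲.unimod.int_lin 1 _ (F := fun p => (β₂ * R p - 2 * lam) ^ 2)
    (G := fun p => 2 * (β₂ * R p - 2 * lam) - β₁ * R p) (by fun_prop) (by fun_prop), h2, mul_zero,
    add_zero, one_mul] at h1
  exact pow_eq_zero_iff two_ne_zero |>.1
    (𝒲.unimod.eq_zero_of_int_eq_zero (by fun_prop) (fun _ => sq_nonneg _) h1 p)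

/-- The variation of the determinant of the curvature of the null distribution. -/
theorem dirF_δ (H : WalkerSolitonData g D X β₁ lam β₂ R δ) (𝒲 : WalkerAtlas g D ι) (hβ₁ : β₁ ≠ 0)
    (hβ : β₂ ≠ 0) (p : M) :
    dirF X δ p = - δ p * (2 * (β₂ * R p - 2 * lam) - β₁ * R p) := by
  have hbR := H.basic_R hβ
  have hbδ := H.basic_δ hβ₁ hβ
  -- `ζ = X(δ) + δ div X` is basic. The divergence theorem applied to `ζ δ X` gives `∫ (δ X(ζ) + ζ²)
  -- = 0`, and the first term already integrates to zero because `ζ` is basic.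
  let ζ : M → ℝ := fun p => dirF X δ p
    + δ p * ((2 * β₂ + (-1) * β₁) * R p + (-4 * lam))
  have hζ : IsBasic g D ζ := (H.basic_dirF hbδ H.twist_δ).add
    (hbδ.mul (((IsBasic.const _).mul hbR).add (IsBasic.const _)))
  have h1 := H.int_det_mul_dirF 𝒲 hζ
  have h2 := H.int_dirF 𝒲 (h := fun p => ζ p * δ p) (hζ.smooth.mul H.smooth_δ)
  have e : (fun p => dirF X (fun p => ζ p * δ p) p
      + (ζ p * δ p) * (2 * (β₂ * R p - 2 * lam) - β₁ * R p))
      = fun p => δ p * dirF X ζ p + ζ p ^ 2 := by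
    ext p
    rw [dirF_mul hζ.smooth H.smooth_δ]
    simp only [ζ]
    ring
  rw [e, 𝒲.unimod.int_add (F := fun p => δ p * dirF X ζ p) (G := fun p => ζ p ^ 2)
    (H.continuous_δ.mul (H.continuous_dirF hζ.smooth))
    (hζ.smooth.continuous.pow 2), h1, zero_add] at h2
  have h3 := 𝒲.unimod.eq_zero_of_int_eq_zero (hζ.smooth.continuous.pow 2)
    (fun _ => sq_nonneg _) h2 p
  have h4 : ζ p = 0 := pow_eq_zero_iff two_ne_zero |>.1 h3
  simp only [ζ] at h4
  linarith

/-- The divergence theorem for `Rⁿ X`, where now `X(R) = -φ R + β₁ R²`. -/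
theorem int_pow (H : WalkerSolitonData g D X β₁ lam β₂ R δ) (𝒲 : WalkerAtlas g D ι)
    (hβ : β₂ ≠ 0) (h0 : ∀ p, δ p = 0) (n : ℕ) :
    (2 * n - 4) * lam * 𝒲.unimod.int (fun p => R p ^ n)
      + ((2 - n) * β₂ + (n - 1) * β₁) * 𝒲.unimod.int (fun p => R p ^ (n + 1)) = 0 := by
  have hR := H.continuous_R
  rw [← 𝒲.unimod.int_lin _ _ (by fun_prop) (by fun_prop), ← H.int_dirF 𝒲 (H.smooth_R.pow n)]
  congr 1
  ext p
  rw [dirF_pow H.smooth_R, H.dirF_R hβ, h0]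
  rcases n with _ | n
  · simp
    ring
  · simp only [Nat.add_sub_cancel]
    push_cast
    ring

/-- Give `R` weight 1 and `δ` weight 2. Without `ε` the function has weight 0, so `φ` drops out of
its derivative. The discriminant `Q = R² - 4 δ` satisfies `X(Q) = 2 (β₁ R - φ) Q`, which leaves only
`-2 β₁ δ Q²` besides the error from `ε`. -/
theorem dirF_mul_rpow (H : WalkerSolitonData g D X β₁ lam β₂ R δ) (𝒲 : WalkerAtlas g D ι)
    (hβ₁ : β₁ ≠ 0) (hβ : β₂ ≠ 0) {ε : ℝ} (hε : 0 < ε) (p : M)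
    (hs : ContMDiff (𝓡 4) 𝓘(ℝ, ℝ) ∞
      fun p => R p * (R p ^ 4 + (R p ^ 2 - 4 * δ p) ^ 2 + ε) ^ (-(1 / 4) : ℝ)) :
    dirF X (fun p => R p * (R p ^ 4 + (R p ^ 2 - 4 * δ p) ^ 2 + ε) ^ (-(1 / 4) : ℝ)) p
      = (R p ^ 4 + (R p ^ 2 - 4 * δ p) ^ 2 + ε) ^ (-(5 / 4) : ℝ)
        * (ε * dirF X R p - 2 * β₁ * δ p * (R p ^ 2 - 4 * δ p) ^ 2) := by
  obtain ⟨γ, h0, hγ⟩ := exists_curve X p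
  have hu := hγ R H.smooth_R
  have hw := hγ δ H.smooth_δ
  have hN : 0 < R p ^ 4 + (R p ^ 2 - 4 * δ p) ^ 2 + ε := by positivity
  have h1 := (((hu.fun_pow 4).fun_add
    (((hu.fun_pow 2).fun_sub (hw.const_mul 4)).fun_pow 2)).add_const ε)
  have h2 := hu.fun_mul (h1.rpow_const (p := (-(1 / 4) : ℝ)) (Or.inl (by rw [h0]; exact hN.ne')))
  have h3 := (hγ _ hs).unique h2
  rw [h0] at h3
  rw [h3]
  have e1 : ∀ {N : ℝ}, 0 < N → N ^ (-(1 / 4) : ℝ) = N ^ (-(5 / 4) : ℝ) * N := fun hN => by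
    rw [← Real.rpow_add_one hN.ne']
    norm_num
  have e2 : (-(1 / 4) : ℝ) - 1 = -(5 / 4) := by norm_num
  rw [e1 hN, e2]
  generalize (R p ^ 4 + (R p ^ 2 - 4 * δ p) ^ 2 + ε) ^ (-(5 / 4) : ℝ) = P
  rw [H.dirF_δ 𝒲 hβ₁ hβ, H.dirF_R hβ]
  norm_num
  ring

theorem rpow_bound {N d s x C : ℝ} (hs : 0 < s) (hN : s ^ 4 ≤ N) (hd : d ^ 2 ≤ N)
    (hx : |x| ≤ C) : |s ^ 4 * (d * x * N ^ (-(5 / 4) : ℝ))| ≤ C * s := by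
  have hN0 : 0 < N := lt_of_lt_of_le (by positivity) hN
  have h1 : |d| ≤ N ^ (1 / 2 : ℝ) := by
    rw [← Real.sqrt_eq_rpow]
    exact Real.abs_le_sqrt hd
  have h2 : N ^ (1 / 2 : ℝ) * N ^ (-(5 / 4) : ℝ) = N ^ (-(3 / 4) : ℝ) := by
    rw [← Real.rpow_add hN0]
    norm_num
  have h3 : N ^ (-(3 / 4) : ℝ) ≤ (s ^ 4) ^ (-(3 / 4) : ℝ) :=
    Real.rpow_le_rpow_of_nonpos (by positivity) hN (by norm_num)
  have h4 : s ^ 4 * (s ^ 4) ^ (-(3 / 4) : ℝ) = s := by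
    rw [← Real.rpow_natCast, ← Real.rpow_mul hs.le, ← Real.rpow_add hs]
    norm_num
  have hP : 0 < N ^ (-(5 / 4) : ℝ) := Real.rpow_pos_of_pos hN0 _
  have hC : 0 ≤ C := (abs_nonneg x).trans hx
  rw [abs_mul, abs_mul, abs_mul, abs_of_pos hP, abs_of_pos (show 0 < s ^ 4 by positivity)]
  calc s ^ 4 * (|d| * |x| * N ^ (-(5 / 4) : ℝ))
      ≤ s ^ 4 * (N ^ (1 / 2 : ℝ) * C * N ^ (-(5 / 4) : ℝ)) := by gcongr
    _ = C * (s ^ 4 * (N ^ (1 / 2 : ℝ) * N ^ (-(5 / 4) : ℝ))) := by ring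
    _ ≤ C * (s ^ 4 * (s ^ 4) ^ (-(3 / 4) : ℝ)) := by rw [h2]; gcongr
    _ = C * s := by rw [h4]

/-- With `ε = s⁴`, `∫ δ X(h) = 0` for this test function equates a multiple of the integral of `(δ
Q)² N^(-5/4)` with an error of order `s`. The integrand is nonnegative and increases as `s`
decreases, so its integral at `s = 1` is already zero. -/
theorem det_mul_eq_zero (H : WalkerSolitonData g D X β₁ lam β₂ R δ) (𝒲 : WalkerAtlas g D ι)
    (hβ₁ : β₁ ≠ 0) (hβ : β₂ ≠ 0) (p : M) : δ p * (R p ^ 2 - 4 * δ p) = 0 := by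
  have hbR := H.basic_R hβ
  have hbδ := H.basic_δ hβ₁ hβ
  have hR := H.continuous_R
  have hδ := H.continuous_δ
  have hX := H.continuous_dirF H.smooth_R
  obtain ⟨C, hC⟩ := isCompact_univ.exists_bound_of_continuousOn hX.continuousOn
  let N : ℝ → M → ℝ := fun s p => R p ^ 4 + (R p ^ 2 - 4 * δ p) ^ 2 + s ^ 4
  have hN : ∀ s, 0 < s → ∀ p, 0 < N s p := fun s hs p => by positivity
  have hNc : ∀ s, 0 < s → Continuous fun p => N s p ^ (-(5 / 4) : ℝ) := fun s hs =>
    Continuous.rpow_const (by fun_prop) fun p => Or.inl (hN s hs p).ne'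
  let F : ℝ → M → ℝ := fun s p => (δ p * (R p ^ 2 - 4 * δ p)) ^ 2 * N s p ^ (-(5 / 4) : ℝ)
  have hFc : ∀ s, 0 < s → Continuous (F s) := fun s hs =>
    Continuous.mul (by fun_prop) (hNc s hs)
  have hGc : ∀ s, 0 < s → Continuous fun p =>
      s ^ 4 * (δ p * dirF X R p * N s p ^ (-(5 / 4) : ℝ)) := fun s hs =>
    continuous_const.mul ((hδ.mul hX).mul (hNc s hs))
  have hF0 : ∀ s, 0 < s → ∀ p, 0 ≤ F s p := fun s hs p =>
    mul_nonneg (sq_nonneg _) (Real.rpow_pos_of_pos (hN s hs p) _).le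
  have key : ∀ s, 0 < s → 2 * β₁ * 𝒲.unimod.int (F s) = 𝒲.unimod.int
      fun p => s ^ 4 * (δ p * dirF X R p * N s p ^ (-(5 / 4) : ℝ)) := by
    intro s hs
    have hbN : IsBasic g D (N s) := by
      have hq := (hbR.mul hbR).add ((IsBasic.const (-4)).mul hbδ)
      have := (((hbR.mul hbR).mul (hbR.mul hbR)).add (hq.mul hq)).add (IsBasic.const (s ^ 4))
      convert this using 1
      ext p
      simp only [N]
      ring
    have hb := hbR.mul (hbN.rpow (hN s hs) (-(1 / 4)))
    have h1 := H.int_det_mul_dirF 𝒲 hb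
    have e : (fun p => δ p * dirF X (fun p => R p * N s p ^ (-(1 / 4) : ℝ)) p)
        = fun p => 1 * (s ^ 4 * (δ p * dirF X R p * N s p ^ (-(5 / 4) : ℝ)))
          + (-(2 * β₁)) * F s p := by
      ext p
      have h2 := H.dirF_mul_rpow 𝒲 hβ₁ hβ (ε := s ^ 4) (by positivity) p hb.smooth
      refine (congrArg (δ p * ·) h2).trans ?_
      simp only [F, N]
      ring
    rw [e, 𝒲.unimod.int_lin _ _ (hGc s hs) (hFc s hs)] at h1
    linarith
  have bound : ∀ s, 0 < s → s ≤ 1 → |2 * β₁| * 𝒲.unimod.int (F 1)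
      ≤ C * 𝒲.unimod.int (fun _ => 1) * s := by
    intro s hs hs1
    have h1 : 𝒲.unimod.int (F 1) ≤ 𝒲.unimod.int (F s) := by
      refine 𝒲.unimod.int_mono (hFc 1 one_pos) (hFc s hs) fun p => ?_
      refine mul_le_mul_of_nonneg_left (Real.rpow_le_rpow_of_nonpos (hN s hs p) ?_ (by norm_num))
        (sq_nonneg _)
      have : s ^ 4 ≤ 1 ^ 4 := by gcongr
      simp only [N]
      linarith
    have h2 : ∀ p, |s ^ 4 * (δ p * dirF X R p * N s p ^ (-(5 / 4) : ℝ))| ≤ C * s := fun p => by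
      refine rpow_bound hs ?_ ?_ (hC p (Set.mem_univ p))
      · simp only [N]
        nlinarith [sq_nonneg (R p ^ 2), sq_nonneg (R p ^ 2 - 4 * δ p)]
      · simp only [N]
        -- `4 δ` is the difference of `R²` and `R² - 4 δ`, so `16 δ²` is at most twice the sum of
        -- their squares.
        nlinarith [sq_nonneg (R p ^ 2 + (R p ^ 2 - 4 * δ p)), sq_nonneg (δ p),
          show 0 < s ^ 4 by positivity, sq_nonneg (R p ^ 2)]
    have e : 𝒲.unimod.int (fun _ => C * s * 1) = C * 𝒲.unimod.int (fun _ => 1) * s := by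
      rw [𝒲.unimod.int_const_mul]
      ring
    have h3 := 𝒲.unimod.int_mono (hGc s hs) (G := fun _ => C * s * 1) continuous_const
      fun p => by simpa using (abs_le.1 (h2 p)).2
    have h4 := 𝒲.unimod.int_mono (F := fun _ => (-1) * (C * s * 1)) continuous_const (hGc s hs)
      fun p => by simpa using (abs_le.1 (h2 p)).1
    rw [𝒲.unimod.int_const_mul, e, ← key s hs] at h4
    rw [e, ← key s hs] at h3
    have h5 : |2 * β₁ * 𝒲.unimod.int (F s)| ≤ C * 𝒲.unimod.int (fun _ => 1) * s :=
      abs_le.2 ⟨by linarith, h3⟩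
    rw [abs_mul, abs_of_nonneg (𝒲.unimod.int_nonneg (hF0 s hs))] at h5
    exact (mul_le_mul_of_nonneg_left h1 (abs_nonneg _)).trans h5
  have hnn := 𝒲.unimod.int_nonneg (hF0 1 one_pos)
  have hI : 𝒲.unimod.int (F 1) = 0 := by
    by_contra hne
    have ha : 0 < |2 * β₁| * 𝒲.unimod.int (F 1) :=
      mul_pos (abs_pos.2 (mul_ne_zero two_ne_zero hβ₁)) (lt_of_le_of_ne hnn (Ne.symm hne))
    set a := |2 * β₁| * 𝒲.unimod.int (F 1)
    set B := C * 𝒲.unimod.int fun _ => 1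
    have hB : 0 < B := by
      have := bound 1 one_pos le_rfl
      linarith
    have h1 : a ≤ B := by simpa using bound 1 one_pos le_rfl
    -- With `a ≤ B s` for all `s ≤ 1`, this choice of `s` gives `a ≤ a / 2`.
    have h2 := bound (a / (2 * B)) (by positivity) (by rw [div_le_one (by positivity)]; linarith)
    have h3 : B * (a / (2 * B)) = a / 2 := by field_simp
    rw [h3] at h2
    linarith
  have h1 := 𝒲.unimod.eq_zero_of_int_eq_zero (hFc 1 one_pos) (hF0 1 one_pos) hI p
  have h2 := (mul_eq_zero.1 h1).resolve_right (Real.rpow_pos_of_pos (hN 1 one_pos p) _).ne'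
  exact pow_eq_zero_iff two_ne_zero |>.1 h2

/-- At each point `δ` is either `0` or `R² / 4`, hence nonnegative, while its integral vanishes. -/
theorem det_eq_zero (H : WalkerSolitonData g D X β₁ lam β₂ R δ) (𝒲 : WalkerAtlas g D ι)
    (hβ₁ : β₁ ≠ 0) (hβ : β₂ ≠ 0) (p : M) : δ p = 0 := by
  refine 𝒲.unimod.eq_zero_of_int_eq_zero H.continuous_δ (fun p => ?_)
    (𝒲.int_det_eq_zero H.cover H.δ_eq) p
  rcases mul_eq_zero.1 (H.det_mul_eq_zero 𝒲 hβ₁ hβ p) with h | h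
  · exact h.ge
  · nlinarith [sq_nonneg (R p)]

theorem lam_eq_zero_of_det_eq_zero [Nonempty M] (H : WalkerSolitonData g D X β₁ lam β₂ R δ)
    (𝒲 : WalkerAtlas g D ι) (hβ₁ : β₁ ≠ 0) (hβ : β₂ ≠ 0) (h0 : ∀ p, δ p = 0) : lam = 0 := by
  have hR := H.continuous_R
  have hV := 𝒲.unimod.int_one_pos
  have k0 := H.int_one 𝒲
  have k1 := H.int_pow 𝒲 hβ h0 1
  have k2 := H.int_pow 𝒲 hβ h0 2
  -- Exponent 2 gives `∫ R³ = 0`, so exponent 3 leaves `(2 β₁ - β₂) ∫ R⁴ = 0`. This decides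
  -- everything unless `β₂ = 2 β₁`.
  have k3 := H.int_pow 𝒲 hβ h0 3
  norm_num at k1 k2 k3
  have k2' := k2.resolve_left hβ₁
  rw [k2', mul_zero, zero_add] at k3
  by_cases h : β₂ = 2 * β₁
  · have c1 : 𝒲.unimod.int R = 4 * lam / (3 * β₁) * 𝒲.unimod.int fun _ => 1 := by
      rw [h] at k0
      field_simp
      linarith
    have c2 : 𝒲.unimod.int (fun p => R p ^ 2) = lam / β₁ * 𝒲.unimod.int R := by
      rw [h] at k1
      field_simp
      linarith
    -- For `β₂ = 2 β₁` the mean of `R` is `4 λ / (3 β₁)` and that of `R²` is `(4/3) (λ/β₁)²`, so the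
    -- variance would be `-(4/9) (λ/β₁)²`.
    have c3 := 𝒲.unimod.int_nonneg (F := fun p => (R p - 4 * lam / (3 * β₁)) ^ 2)
      fun p => sq_nonneg _
    have e : (fun p => (R p - 4 * lam / (3 * β₁)) ^ 2) = fun p => 1 * (R p ^ 2)
        + 1 * ((-2 * (4 * lam / (3 * β₁))) * R p + (4 * lam / (3 * β₁)) ^ 2 * 1) := by
      ext p
      ring
    rw [e, 𝒲.unimod.int_lin _ _ (by fun_prop) (by fun_prop),
      𝒲.unimod.int_lin _ _ hR continuous_const, c2, c1] at c3
    have c4 : 0 ≤ -(4 / 9 : ℝ) * (lam / β₁) ^ 2 * 𝒲.unimod.int fun _ => 1 := by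
      refine c3.trans_eq ?_
      field_simp
      ring
    have c5 : (lam / β₁) ^ 2 = 0 := by
      by_contra hne
      have : 0 < (lam / β₁) ^ 2 := lt_of_le_of_ne (sq_nonneg _) (Ne.symm hne)
      nlinarith [mul_pos this hV]
    have c6 := pow_eq_zero_iff two_ne_zero |>.1 c5
    exact (div_eq_zero_iff.1 c6).resolve_right hβ₁
  · have c1 : 𝒲.unimod.int (fun p => R p ^ 4) = 0 := by
      rcases mul_eq_zero.1 (show (2 * β₁ - β₂) * 𝒲.unimod.int (fun p => R p ^ 4) = 0 by
        linarith) with h1 | h1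
      · exact absurd (by linarith) h
      · exact h1
    have c2 : ∀ p, R p = 0 := fun p => pow_eq_zero_iff four_ne_zero |>.1
      (𝒲.unimod.eq_zero_of_int_eq_zero (by fun_prop) (fun p => by positivity) c1 p)
    have c3 : 𝒲.unimod.int R = 0 := by
      rw [show R = fun p => 0 * (1 : ℝ) by ext p; rw [c2]; ring, 𝒲.unimod.int_const_mul, zero_mul]
    rw [c3, mul_zero] at k0
    have := (mul_eq_zero.1 k0.symm).resolve_right hV.ne'
    linarith

theorem lam_eq_zero_or [Nonempty M] (H : WalkerSolitonData g D X β₁ lam β₂ R δ)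
    (𝒲 : WalkerAtlas g D ι) :
    lam = 0 ∨ (β₁ = 0 ∧ β₂ ≠ 0 ∧ ∀ p, β₂ * R p - 2 * lam = 0) := by
  by_cases hβ : β₂ = 0
  · exact .inl (H.lam_eq_zero_of_right_eq_zero 𝒲 hβ)
  by_cases hβ₁ : β₁ = 0
  · exact .inr ⟨hβ₁, hβ, H.factor_eq_zero_of_left_eq_zero 𝒲 hβ₁ hβ⟩
  · exact .inl (H.lam_eq_zero_of_det_eq_zero 𝒲 hβ₁ hβ (H.det_eq_zero 𝒲 hβ₁ hβ))

end WalkerSolitonData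

/-! ### Tensoriality of the Lie derivative of the metric -/

section Tensor

variable {A A' : Type*} [CommRing A] [Algebra ℝ A] [CommRing A'] [Algebra ℝ A']
variable {d : Fin 4 → Derivation ℝ A A} {d' : Fin 4 → Derivation ℝ A' A'}

theorem map_derivation_mul (D : Derivation ℝ A A) (P Q : Matrix (Fin 4) (Fin 4) A) :
    (P * Q).map D = P.map D * Q + P * Q.map D := by
  ext i j
  simp only [Matrix.map_apply, Matrix.mul_apply, Matrix.add_apply, map_sum, Derivation.leibniz,
    smul_eq_mul, Finset.sum_add_distrib]
  rw [add_comm]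
  exact congrArg₂ _ (Finset.sum_congr rfl fun k _ => mul_comm _ _) rfl

/-- The Lie derivative of the metric is a tensor. -/
theorem lieD_coordChange {t : A' →+* A} {y : Fin 4 → A} {G : Fin 4 → Fin 4 → A}
    {G' : Fin 4 → Fin 4 → A'} {X : Fin 4 → A} {X' : Fin 4 → A'}
    (hd : ∀ i j a, d i (d j a) = d j (d i a))
    (hc : ∀ k h, d k (t h) = ∑ l, t (d' l h) * d k (y l))
    (hG : ∀ i j, G i j = ∑ k, ∑ l, d i (y k) * d j (y l) * t (G' k l))
    (hX : IsPush d t y X X') (i j : Fin 4) :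
    lieD d G X i j = ∑ k, ∑ l, d i (y k) * d j (y l) * t (lieD d' G' X' k l) := by
  let L : Derivation ℝ A A := ∑ m, X m • d m
  have hL : ∀ a, L a = dirD d X a := fun a => by
    simp [L, dirD, Fin.sum_univ_four]
  let P : Matrix (Fin 4) (Fin 4) A := .of fun i k => d i (y k)
  let H : Matrix (Fin 4) (Fin 4) A := .of fun k l => t (G' k l)
  let T : Matrix (Fin 4) (Fin 4) A := .of fun n k => t (d' n (X' k))
  let W : Matrix (Fin 4) (Fin 4) A := .of fun i m => d i (X m)
  have key : ∀ (B : Matrix (Fin 4) (Fin 4) A) i j, (P * B * P.transpose) i j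
      = ∑ k, ∑ l, d i (y k) * d j (y l) * B k l := fun B i j => by
    simp only [Matrix.mul_apply, Matrix.transpose_apply, Finset.sum_mul]
    rw [Finset.sum_comm]
    exact Finset.sum_congr rfl fun k _ => Finset.sum_congr rfl fun l _ => by
      simp only [P, Matrix.of_apply]
      ring
  have hG' : Matrix.of G = P * H * P.transpose := by
    ext i j
    rw [key]
    exact hG i j
  -- The transformation law of `X`, differentiated in direction `i`: commuting derivatives turn the
  -- second derivatives of the coordinates into the derivative of the Jacobian `P` along `X`.
  have h1 : P.map L + W * P = P * T := by
    ext i k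
    have h := congrArg (d i) (hX k)
    rw [hc, map_sum] at h
    simp only [Derivation.leibniz, smul_eq_mul, Finset.sum_add_distrib] at h
    simp only [Matrix.add_apply, Matrix.map_apply, Matrix.mul_apply, hL, dirD, P, T, W,
      Matrix.of_apply]
    refine Eq.trans ?_ (h.symm.trans (Finset.sum_congr rfl fun _ _ => mul_comm _ _))
    exact congrArg₂ _ (Finset.sum_congr rfl fun m _ => by rw [hd])
      (Finset.sum_congr rfl fun m _ => mul_comm _ _)
  have h2 : Matrix.of (lieD d G X) = (Matrix.of G).map L + W * Matrix.of G
      + Matrix.of G * W.transpose := by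
    ext i j
    simp only [lieD, Matrix.of_apply, Matrix.add_apply, Matrix.map_apply, Matrix.mul_apply, hL,
      dirD, W, Matrix.transpose_apply, ← Finset.sum_add_distrib]
    exact Finset.sum_congr rfl fun m _ => by ring
  have h3 : H.map L + T * H + H * T.transpose = .of fun k l => t (lieD d' G' X' k l) := by
    ext k l
    simp only [lieD, Matrix.of_apply, Matrix.add_apply, Matrix.map_apply, Matrix.mul_apply, hL,
      H, T, Matrix.transpose_apply]
    rw [hX.dirD hc, dirD, map_sum, map_sum, ← Finset.sum_add_distrib, ← Finset.sum_add_distrib]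
    exact Finset.sum_congr rfl fun m _ => by simp only [map_add, map_mul]; ring
  have h4 : Matrix.of (lieD d G X)
      = P * (H.map L + T * H + H * T.transpose) * P.transpose := by
    have h5 : (P.map L).transpose + P.transpose * W.transpose = T.transpose * P.transpose := by
      rw [← Matrix.transpose_mul, ← Matrix.transpose_add, h1, Matrix.transpose_mul]
    have h6 : (P.transpose).map L = (P.map L).transpose := rfl
    rw [h2, hG', map_derivation_mul, map_derivation_mul, h6]
    calc _ = (P.map L + W * P) * H * P.transpose + P * H.map L * P.transpose
          + P * H * ((P.map L).transpose + P.transpose * W.transpose) := by noncomm_ring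
      _ = _ := by rw [h1, h5]; noncomm_ring
  have h7 := congrFun (congrFun h4 i) j
  rw [h3, key] at h7
  exact h7

end Tensor

/-! ### From Walker charts to arbitrary charts -/

section Charts

variable {M : Type*} [TopologicalSpace M] [ChartedSpace E4 M] [IsManifold (𝓡 4) ∞ M]
variable {g : PseudoMetric M} {D : ∀ p : M, Submodule ℝ (TangentSpace (𝓡 4) p)}
  {X : ∀ p : M, TangentSpace (𝓡 4) p}

theorem contDiffOn_components_ovl {e e' : OpenPartialHomeomorph M E4}
    (he : e ∈ IsManifold.maximalAtlas (𝓡 4) ∞ M) (he' : e' ∈ IsManifold.maximalAtlas (𝓡 4) ∞ M)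
    (hX : ContDiffOn ℝ ∞ (components X e') e'.target) :
    ContDiffOn ℝ ∞ (components X e) (ovl e e') := by
  have h1 := contDiffOn_coordChange he' he
  refine WalkerChart.contDiffOn_of_coord fun k => ?_
  have h2 : ContDiffOn ℝ ∞ (fun z => ∑ l, components X e' z l
      * pderiv l (fun w => coordChange e' e w k) z) (ovl e' e) :=
    ContDiffOn.sum fun l _ => ((contDiffOn_coord hX l).mono fun z hz => ovl_le hz).mul
      (ContDiffOn.pderiv_open (contDiffOn_coord h1 k) l)
  refine (h2.comp (contDiffOn_coordChange he he') fun z hz => coordChange_mem_ovl hz).congr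
    fun z hz => ?_
  have hz' := coordChange_mem_ovl hz
  have h3 := components_coordChange he' he X hz'
  rw [coordChange_coordChange hz, clm_apply_eq_sum] at h3
  rw [h3]
  simp [fderiv_stdBasis (h1.differentiableAt_open hz')]

set_option maxHeartbeats 1000000 in
/-- If the Lie derivative of the metric vanishes in a Walker chart then it vanishes in all
charts. -/
theorem lieMetric_eq_zero (K : WalkerChart g D)
    (hX : ContDiffOn ℝ ∞ (components X K.e) K.e.target)
    (h : ∀ i j, lieD (dS (U := tgt K.e))
      (walkerD (K.aS K.self_le) (K.bS K.self_le) (K.cS K.self_le))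
      (K.compS K.self_le hX) i j = 0) {e : OpenPartialHomeomorph M E4}
    (he : e ∈ IsManifold.maximalAtlas (𝓡 4) ∞ M) {x : E4} (hx : x ∈ ovl e K.e) (i j : Fin 4) :
    lieMetric (gram g e) (components X e) i j x = 0 := by
  have hτ := contDiffOn_coordChange he K.mem
  let t : SmoothFun (tgt K.e) →+* SmoothFun (ovl e K.e) :=
    pullS (coordChange e K.e) hτ fun _ hx => coordChange_mem hx
  let y : Fin 4 → SmoothFun (ovl e K.e) := fun l => mkS (fun z => coordChange e K.e z l)
    (contDiffOn_coord hτ l)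
  have hy : ∀ (z : ovl e K.e) k l, evS z (dS k (y l))
      = pderiv k (fun w => coordChange e K.e w l) z := fun z k l => by
    rw [dS_mkS, evS_mkS]
  let G' : Fin 4 → Fin 4 → SmoothFun (tgt K.e) :=
    walkerD (K.aS K.self_le) (K.bS K.self_le) (K.cS K.self_le)
  let G : Fin 4 → Fin 4 → SmoothFun (ovl e K.e) := fun i j =>
    ∑ k, ∑ l, dS i (y k) * dS j (y l) * t (G' k l)
  let XS : Fin 4 → SmoothFun (ovl e K.e) := fun l => mkS (fun z => components X e z l)
    (contDiffOn_coord (contDiffOn_components_ovl he K.mem hX) l)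
  have hG : ∀ i j z (hz : z ∈ ovl e K.e), gram g e z i j = evS ⟨z, hz⟩ (G i j) := by
    intro i j z hz
    rw [gram_coordChange he K.mem g hz, map_sum]
    refine Finset.sum_congr rfl fun k _ => ?_
    rw [map_sum]
    refine Finset.sum_congr rfl fun l _ => ?_
    rw [map_mul, map_mul, hy, hy, evS_pullS,
      ← K.gram_ev K.self_le k l _ (coordChange_mem hz)]
  have hpush : IsPush (dS (U := ovl e K.e)) t y XS (K.compS K.self_le hX) := by
    intro k
    refine SmoothFun.ext_ev fun z => ?_
    rw [evS_pullS, map_sum]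
    simp only [map_mul, hy, XS, evS_mkS, WalkerChart.compS]
    rw [components_coordChange he K.mem X z.2, clm_apply_eq_sum]
    simp [fderiv_stdBasis (hτ.differentiableAt_open z.2)]
  have h1 := lieMetric_eq (U := ovl e K.e) (G := gram g e) (gS := G) (X := components X e)
    (XS := XS) hG (fun _ _ _ => rfl) i j ⟨x, hx⟩
  have h2 := lieD_coordChange (d := dS (U := ovl e K.e)) (d' := dS (U := tgt K.e)) (t := t)
    (y := y) (G := G) (G' := G') dS_comm (fun k u => dS_pullS _ hτ _ k u) (fun _ _ => rfl)
    hpush i j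
  have h3 : ∀ k l, lieD (dS (U := tgt K.e)) G' (K.compS K.self_le hX) k l = 0 := h
  simp only [h3, map_zero, mul_zero, Finset.sum_const_zero] at h2
  rw [h1, h2, map_zero]

/-- With `β₁ = 0` and `φ = 0` the field is Killing in Walker charts, hence in every chart. The
soliton equation in the preferred chart then reads `0 = (β₂ R - 2 λ) g` with `g ≠ 0`, so no
transformation law for the Ricci tensor is needed. -/
theorem scalar_eq_of_conformal {β₁ lam β₂ : ℝ} {R δ : M → ℝ}
    (H : WalkerSolitonData g D X β₁ lam β₂ R δ) (hβ₁ : β₁ = 0)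
    (hR : ∀ p, β₂ * R p - 2 * lam = 0) (p : M) : β₂ * scalarCurvature g p = 2 * lam := by
  obtain ⟨K, hK⟩ := H.cover p
  let e := chartAt E4 p
  have he : e ∈ IsManifold.maximalAtlas (𝓡 4) ∞ M := IsManifold.chart_mem_maximalAtlas p
  have hp : p ∈ e.source := mem_chart_source E4 p
  have hx : e p ∈ ovl e K.e := mem_ovl.2 ⟨e.map_source hp, by rwa [e.left_inv hp]⟩
  have hx' : K.e p ∈ ovl K.e e := mem_ovl.2 ⟨K.e.map_source hK, by rwa [K.e.left_inv hK]⟩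
  have h0 : ∀ i j, lieD (dS (U := tgt K.e))
      (walkerD (K.aS K.self_le) (K.bS K.self_le) (K.cS K.self_le))
      (K.compS K.self_le (H.field K)) i j = 0 := by
    intro i j
    have h1 := K.isSolD K.self_le (H.field K) H.soliton i j
    have h2 : K.factorS K.self_le lam β₂ = 0 := SmoothFun.ext_ev fun x => by
      rw [H.factor_ev, hR, map_zero]
    have h3 : (constS β₁ : SmoothFun (tgt K.e)) = 0 := by rw [hβ₁]; exact map_zero _
    rw [h2, h3, mul_zero, zero_mul, zero_mul, zero_add] at h1
    exact h1
  have h1 : ∀ i j, (β₂ * scalarCurvature g p - 2 * lam) * gram g e (e p) i j = 0 := by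
    intro i j
    have h2 := H.soliton e he (e p) (e.map_source hp) i j
    rw [lieMetric_eq_zero K (H.field K) h0 he hx, hβ₁] at h2
    have h3 : scalarCurvature g p = scalar (gram g e) (e p) := rfl
    rw [h3]
    linear_combination -h2
  by_contra hne
  have h2 : ∀ i j, gram g e (e p) i j = 0 := fun i j =>
    (mul_eq_zero.1 (h1 i j)).resolve_left (sub_ne_zero.2 hne)
  -- If the metric vanished in the preferred chart, the Walker entry `(0, 2)`, which is 1, would
  -- vanish too.
  have h3 := gram_coordChange K.mem he g hx' 0 2
  have h4 : coordChange K.e e (K.e p) = e p := by rw [coordChange, K.e.left_inv hK]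
  rw [h4, K.gram_eq _ (K.e.map_source hK)] at h3
  simp [h2, walkerMatrix] at h3

end Charts

end WalkerSoliton

end

theorem theorem3p3 {M : Type*} [TopologicalSpace M] [ChartedSpace WalkerSoliton.E4 M]
    [IsManifold (𝓡 4) ∞ M] [T2Space M] [CompactSpace M] [Nonempty M]
    (g : WalkerSoliton.PseudoMetric M) (hg : WalkerSoliton.IsWalker g)
    (f : M → ℝ) (hf : ContMDiff (𝓡 4) 𝓘(ℝ, ℝ) ∞ f)
    (X Y : ∀ p : M, TangentSpace (𝓡 4) p)
    (hY : WalkerSoliton.IsSmoothField Y) (hdiv : WalkerSoliton.IsDivergenceFree g Y)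
    (hX : ∀ p, X p = WalkerSoliton.gradient g f p + Y p)
    (β₁ lam β₂ : ℝ) (hsol : WalkerSoliton.IsRicciYamabeSoliton g X β₁ lam β₂) :
    lam = 0 ∨
      (β₂ ≠ 2 * β₁ ∧ ∀ p, WalkerSoliton.scalarCurvature g p = 2 * lam / (β₂ - 2 * β₁)) := by
  obtain ⟨D, hcov⟩ := WalkerSoliton.exists_walkerChart hg
  obtain ⟨t, ⟨𝒲⟩⟩ := WalkerSoliton.exists_walkerAtlas hcov
  obtain ⟨R, hR, hRe⟩ := WalkerSoliton.exists_scalar hcov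
  obtain ⟨δ, hδ, hδe⟩ := WalkerSoliton.exists_det hcov
  have H : WalkerSoliton.WalkerSolitonData g D X β₁ lam β₂ R δ :=
    ⟨hcov, fun K => K.contDiffOn_components_of_eq hf hY hX, hsol, hR, hRe, hδ, hδe⟩
  rcases H.lam_eq_zero_or 𝒲 with h | ⟨h1, h2, h3⟩
  · exact .inl h
  · refine .inr ⟨by rwa [h1, mul_zero], fun p => ?_⟩
    rw [h1, mul_zero, sub_zero, eq_div_iff h2, mul_comm]
    exact WalkerSoliton.scalar_eq_of_conformal H h1 h3 p
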